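/- **Setting.** Let $P>0$ and let $V\in\mathcal C^\infty(\mathbb R)$. For $N\ge 1$ let $\mathbb P_N^V$ be the probability measure on $\mathbb R^N$ with density $$p_N^V(x_1,\dots,x_N)=\frac1{\mathcal Z_N[V]}\prod_{i<j}|x_i-x_j|^{2P/N}\prod_{i=1}^N e^{-V(x_i)},$$ let $\mathbb E_N^V$ be its expectation and $L_N=\frac1N\sum_{a=1}^N\delta_{x_a}$ the empirical measure. Let $\mu_V$ be the equilibrium measure, i.e. the minimizer, among absolutely continuous probability measures on $\mathbb R$, of $$\mathcal E(\mu)=\int V\,d\mu-P\iint\log|x-y|\,d\mu(x)d\mu(y)+\int\log\Big(\frac{d\mu}{dx}\Big)d\mu ,$$ and let $\rho_V$ be its density. Assume that 1. $V(x)\to+\infty$ and $|V'(x)|\to+\infty$ as $|x|\to\infty$; 2. $\mu_V$ satisfies a Poincaré inequality: there is $C_{\mathrm{Poinc}}>0$ with $\operatorname{Var}_{\mu_V}(g)\le C_{\mathrm{Poinc}}\int (g')^2d\mu_V$ for all $g\in\mathcal C^1_c(\mathbb R)$; 3. for all real polynomials $Q$, all $\alpha>0$ and all integers $p\ge0$,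 $Q(V^{(p)}(x))e^{-V(x)}=o(|x|^{-\alpha})$ as $|x|\to\infty$; 4. $1/V'^2$ is integrable at infinity, and $V^{(k)}(x)/V'(x)=O(1)$ as $|x|\to\infty$ for all $k\ge2$. For a real constant $c$ that does not depend on $V$, put $$K_V=2P\,\|\mathcal H[\rho_V]\|_\infty+c+P\,\Big|\iint\log|x-y|\,d\mu_V(x)d\mu_V(y)\Big|,\qquad \mathcal H[g](x)=\mathrm{p.v.}\!\int_{\mathbb R}\frac{g(y)}{y-x}\,dy .$$ On real-valued functions on $\mathbb R^n$ let $\|f\|_{W^{1,\infty}}=\max\big(\|f\|_\infty,\max_i\|\partial_if\|_\infty\big)$ (weak derivatives; $f\in W^{1,\infty}$ is identified with its continuous representative) and, for $f\in L^2$, $\|f\|_{H^{m}}^2=\int_{\mathbb R^n}(1+\|t\|_2)^{2m}|\mathcal F[f](t)|^2dt$ with $\mathcal F[f](t)=\int f(x)e^{-i\langle t,x\rangle}dx$. **Theorem (A priori bound on linear statistics).** Let $P>0$, $c\in\mathbb R$, $\varepsilon>0$ and $n\ge1$. There is a constant $C>0$, depending only on $P,c,\varepsilon,n$, such that for every $V$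 as above, every $f\in W^{1,\infty}(\mathbb R^n)\cap H^{n/2}(\mathbb R^n)$ and every $N\ge1$, $$\Big|\mathbb E_N^V\Big[\int_{\mathbb R^n} f\,d(L_N-\mu_V)^{\otimes n}\Big]\Big|\le\frac{C\,e^{K_V}}{N^{\frac n2(1-\varepsilon)}}\Big(\|f\|_{W^{1,\infty}(\mathbb R^n)}+\|f\|_{H^{n/2}(\mathbb R^n)}\Big).$$ -/

import Mathlib

open Filter Topology MeasureTheory
open scoped ENNReal ContDiff FourierTransform

noncomputable section

namespace HighTemp

/-! ### The particle system -/

/-- The unnormalised density `∏_{i<j} |x_i - x_j|^{2P/N} ∏_i exp (-V (x_i))`. -/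
def weight (P : ℝ) (V : ℝ → ℝ) (N : ℕ) (x : Fin N → ℝ) : ℝ :=
  (∏ i, ∏ j ∈ Finset.Ioi i, |x i - x j| ^ (2 * P / (N : ℝ))) * ∏ i, Real.exp (-V (x i))

/-- The partition function. -/
def partitionFunction (P : ℝ) (V : ℝ → ℝ) (N : ℕ) : ℝ :=
  ∫ x : Fin N → ℝ, weight P V N x

/-- The density `p_N` of the law of the `N` particles. -/
def particleDensity (P : ℝ) (V : ℝ → ℝ) (N : ℕ) (x : Fin N → ℝ) : ℝ :=
  weight P V N x / partitionFunction P V N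

/-- The law of the `N` particles on `ℝ^N`. -/
def particleLaw (P : ℝ) (V : ℝ → ℝ) (N : ℕ) : Measure (Fin N → ℝ) :=
  volume.withDensity fun x => ENNReal.ofReal (particleDensity P V N x)

/-- The empirical measure `L_N = N⁻¹ ∑_a δ_{x_a}` of a configuration. -/
def empiricalMeasure {N : ℕ} (x : Fin N → ℝ) : Measure ℝ :=
  (N : ℝ≥0∞)⁻¹ • ∑ a, Measure.dirac (x a)

/-! ### The equilibrium measure -/

/-- The density (a function on `ℝ`) of the absolutely continuous part of `μ`. -/
def density (μ : Measure ℝ) (x : ℝ) : ℝ := (μ.rnDeriv volume x).toReal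

/-- The double logarithmic integral `∬ log |x - y| dμ(x) dμ(y)`. -/
def logEnergy (μ : Measure ℝ) : ℝ := ∫ p : ℝ × ℝ, Real.log |p.1 - p.2| ∂(μ.prod μ)

/-- Absolutely continuous probability measures for which the three terms of the free energy are
finite. For the confining potentials below these are exactly the measures of finite free energy;
the functional is `+∞` at all the others. -/
structure FiniteFreeEnergy (V : ℝ → ℝ) (μ : Measure ℝ) : Prop where
  isProbabilityMeasure : IsProbabilityMeasure μ
  absolutelyContinuous : μ ≪ volume
  potential : Integrable V μ
  interaction : Integrable (fun p : ℝ × ℝ => Real.log |p.1 - p.2|) (μ.prod μ)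
  entropy : Integrable (fun x => Real.log (density μ x)) μ

/-- The free energy `∫ V dμ - P ∬ log |x - y| dμ dμ + ∫ log (dμ/dx) dμ`. -/
def freeEnergy (P : ℝ) (V : ℝ → ℝ) (μ : Measure ℝ) : ℝ :=
  (∫ x, V x ∂μ) - P * logEnergy μ + ∫ x, Real.log (density μ x) ∂μ

/-- `μ` is the equilibrium measure: it minimises the free energy. -/
structure IsEquilibriumMeasure (P : ℝ) (V : ℝ → ℝ) (μ : Measure ℝ) : Prop where
  finite : FiniteFreeEnergy V μ
  minimal : ∀ ν : Measure ℝ, FiniteFreeEnergy V ν → freeEnergy P V μ ≤ freeEnergy P V ν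

/-! ### Assumptions on the potential -/

/-- The Poincaré inequality for `μ`. -/
def SatisfiesPoincare (μ : Measure ℝ) : Prop :=
  ∃ K : ℝ, 0 < K ∧ ∀ f : ℝ → ℝ, ContDiff ℝ 1 f → HasCompactSupport f →
    ∫ x, (f x - ∫ y, f y ∂μ) ^ 2 ∂μ ≤ K * ∫ x, (deriv f x) ^ 2 ∂μ

/-- The assumptions on the potential `V`, whose equilibrium measure is `μ`. The limit
`|x| → ∞` is the filter `cocompact ℝ`. -/
structure Admissible (V : ℝ → ℝ) (μ : Measure ℝ) : Prop where
  smooth : ContDiff ℝ ∞ V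
  tendsto_atTop : Tendsto V (cocompact ℝ) atTop
  tendsto_abs_deriv_atTop : Tendsto (fun x => |deriv V x|) (cocompact ℝ) atTop
  poincare : SatisfiesPoincare μ
  decay : ∀ (Q : Polynomial ℝ) (α : ℝ) (p : ℕ), 0 < α →
    (fun x => Q.eval (iteratedDeriv p V x) * Real.exp (-V x))
      =o[cocompact ℝ] fun x => |x| ^ (-α)
  integrable_inv_sq : IntegrableAtFilter (fun x => 1 / (deriv V x) ^ 2) (cocompact ℝ) volume
  deriv_ratio : ∀ k : ℕ, 2 ≤ k →
    (fun x => iteratedDeriv k V x / deriv V x) =O[cocompact ℝ] fun _ => (1 : ℝ)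

/-! ### The constant `K_V` -/

/-- The Hilbert transform, as a Cauchy principal value: `p.v. ∫ f(y) / (y - x) dy`. -/
def hilbertTransform (f : ℝ → ℝ) (x : ℝ) : ℝ :=
  limUnder (𝓝[>] (0 : ℝ)) fun δ => ∫ y in {y : ℝ | δ < |y - x|}, f y / (y - x)

/-- `K_V = 2P ‖H[ρ_V]‖_∞ + c + P |∬ log |x - y| dμ_V dμ_V|`. -/
def constK (P c : ℝ) (μ : Measure ℝ) : ℝ :=
  2 * P * (eLpNorm (hilbertTransform (density μ)) ⊤ volume).toReal + c + P * |logEnergy μ|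

/-! ### Linear statistics -/

/-- The integral `∫ f d(α - β)^{⊗ n}` against the `n`-th tensor power of the signed measure
`α - β`, for finite measures `α`, `β`: by multilinearity
`(α - β)^{⊗ n} = ∑_S (-1)^{n - |S|} ⨂_i (α if i ∈ S, β otherwise)`. -/
def integralTensorDiff {n : ℕ} (α β : Measure ℝ) (f : EuclideanSpace ℝ (Fin n) → ℝ) : ℝ :=
  ∑ S : Finset (Fin n), (-1 : ℝ) ^ (n - S.card) *
    ∫ ξ : Fin n → ℝ, f (WithLp.toLp 2 ξ) ∂(Measure.pi fun i => if i ∈ S then α else β)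

/-- The `n`-linear statistic `E_N [∫ f d(L_N - μ)^{⊗ n}]`. -/
def linearStatistic (P : ℝ) (V : ℝ → ℝ) (μ : Measure ℝ) (N : ℕ) {n : ℕ}
    (f : EuclideanSpace ℝ (Fin n) → ℝ) : ℝ :=
  ∫ x, integralTensorDiff (empiricalMeasure x) μ f ∂(particleLaw P V N)

/-! ### The space `W^{1,∞}(ℝ^n)` -/

/-- `g` is a bounded weak partial derivative of `f` in the `i`-th direction. -/
def IsBoundedWeakPartial {n : ℕ} (f g : EuclideanSpace ℝ (Fin n) → ℝ) (i : Fin n) : Prop :=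
  MemLp g ⊤ volume ∧
    ∀ φ : EuclideanSpace ℝ (Fin n) → ℝ, ContDiff ℝ ∞ φ → HasCompactSupport φ →
      ∫ x, f x * fderiv ℝ φ x (EuclideanSpace.single i 1) = -∫ x, g x * φ x

/-- `f ∈ W^{1,∞}(ℝ^n)`. An element of this space has a unique continuous representative; `f` is
taken to be that one, since it is evaluated on the diagonals of `ℝ^n`, which are null sets. -/
structure MemW1inf {n : ℕ} (f : EuclideanSpace ℝ (Fin n) → ℝ) : Prop where
  continuous : Continuous f
  bounded : MemLp f ⊤ volume
  weakPartial : ∀ i, ∃ g, IsBoundedWeakPartial f g i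

open Classical in
/-- The weak partial derivative `∂_i f`, unique up to null sets. -/
def weakPartial {n : ℕ} (f : EuclideanSpace ℝ (Fin n) → ℝ) (i : Fin n) :
    EuclideanSpace ℝ (Fin n) → ℝ :=
  if h : ∃ g, IsBoundedWeakPartial f g i then h.choose else 0

/-- The norm of `W^{1,∞}(ℝ^n)`: the maximum of `‖f‖_∞` and of all the `‖∂_i f‖_∞`. -/
def normW1inf {n : ℕ} (f : EuclideanSpace ℝ (Fin n) → ℝ) : ℝ :=
  (eLpNorm f ⊤ volume ⊔ ⨆ i, eLpNorm (weakPartial f i) ⊤ volume).toReal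

/-! ### The Sobolev spaces `H^m(ℝ^n)` -/

open Classical in
/-- The Fourier transform `F[u](t) = ∫ u(x) exp (-i ⟨t, x⟩) dx` on `L²(ℝ^n)` (extended from
`L¹ ∩ L²`). Mathlib's `𝓕` has the kernel `exp (-2πi ⟨t, x⟩)`, hence the rescaling. -/
def fourierL2 {n : ℕ} (u : EuclideanSpace ℝ (Fin n) → ℝ) (t : EuclideanSpace ℝ (Fin n)) : ℂ :=
  if h : MemLp (fun x => (u x : ℂ)) 2 (volume : Measure (EuclideanSpace ℝ (Fin n))) then
    (𝓕 (h.toLp (fun x => (u x : ℂ))) : Lp ℂ 2 (volume : Measure (EuclideanSpace ℝ (Fin n))))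
      ((2 * Real.pi)⁻¹ • t)
  else 0

/-- `‖u‖²_{H^m} = ∫ (1 + ‖t‖)^{2m} |F[u](t)|² dt`, possibly infinite. -/
def normHSq {n : ℕ} (m : ℝ) (u : EuclideanSpace ℝ (Fin n) → ℝ) : ℝ≥0∞ :=
  ∫⁻ t, ENNReal.ofReal ((1 + ‖t‖) ^ (2 * m)) * ‖fourierL2 u t‖ₑ ^ 2

/-- `u ∈ H^m(ℝ^n)`. -/
structure MemH {n : ℕ} (m : ℝ) (u : EuclideanSpace ℝ (Fin n) → ℝ) : Prop where
  memLp : MemLp u 2 volume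
  finite : normHSq m u < ⊤

/-- The norm of `H^m(ℝ^n)`. -/
def normH {n : ℕ} (m : ℝ) (u : EuclideanSpace ℝ (Fin n) → ℝ) : ℝ := √(normHSq m u).toReal

end HighTemp

end

noncomputable section

namespace HighTemp

/-! Fix a scale η, a large negative power of N, and replace log |u| by ½ log (u² + η²). The new
kernel is finite on the diagonal and, by Frullani's formula (`frullani_cos`), equals log η plus a
positive superposition of the functions 1 - cos (t u). Hence the squared energy distance D² = ∫
e^{-ηt}/t |F[L_N] - F[μ_V]|² dt is minus the regularised logarithmic energy of the neutral signed
measure L_N - μ_V (`energyDistSq_eq`).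

The Euler–Lagrange equation (`density_eq_exp`) reads ρ_V = exp (λ - V + 2P U) with U the logarithmic
potential of μ_V. It trades e^{-V} for ρ_V, so that the weight of a configuration is at most
ρ_V^{⊗N} times exp (-P N D²), an explicit constant and an error (`weight_le`). Jensen's inequality
under μ_V^{⊗N} bounds the partition function from below (`exp_le_lintegral_weight`). The terms of
order N cancel in the quotient. What remains is exp (P ∬ log), a factor η^{-P} from the N diagonal
terms, and the cost of regularising U. So exp (P N D²) is integrable up to a power of N
(`lintegral_particleLaw_le`), which means that D² is of order 1/N up to logarithms.

The cost of regularising U must involve V only through K_V. The potential U is Lipschitz with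
constant ‖H[ρ_V]‖_∞ (`abs_logPot_sub_le`), and the regularised potential is an average of U against
a Cauchy law of width η. This gives an error at most an absolute constant times (1 + ‖H[ρ_V]‖_∞) √η
per particle (`regPot_sub_logPot_le`). Once N √η is small enough, the total cost is exp (2P
‖H[ρ_V]‖_∞ + 2P). Boundedness and Hölder continuity of ρ_V are needed too, but only qualitatively:
their constants never enter the result.

The rest is deterministic (`abs_integralTensorDiff_le`). Cutting F[f] off at frequency 2/η changes f
by O(η ‖f‖_{W^{1,∞}}), because f is Lipschitz (`MemW1inf.abs_sub_le`). Below that frequency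
e^{-η|t_i|} is bounded below, and Cauchy–Schwarz bounds the n-linear statistic of the smoothed
function by ‖f‖_{H^{n/2}} D^n times a constant. The weights 1/|t_i| in D² are what cost the factor
(1 + ‖t‖)^n, that is, n/2 derivatives.

Finally D^n is compared with a threshold D² = u = N^{-(1-ε)}. Below it the bound is the desired one.
Above it a high moment of D²/u gains N^{-εj}, which absorbs the polynomial loss η^{-P} once j is
large. -/

/-! ### The regularised logarithm -/

/-- The regularised logarithm `½ log (u² + η²)`. -/
def regLog (η u : ℝ) : ℝ := Real.log (u ^ 2 + η ^ 2) / 2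

lemma regLog_zero_left (u : ℝ) : regLog 0 u = Real.log |u| := by
  simp [regLog]

lemma regLog_zero_right (η : ℝ) : regLog η 0 = Real.log η := by
  simp [regLog]

lemma log_abs_le_regLog {η u : ℝ} (hu : u ≠ 0) : Real.log |u| ≤ regLog η u := by
  have h : 0 < u ^ 2 := by positivity
  have := Real.log_le_log h (by nlinarith [sq_nonneg η] : u ^ 2 ≤ u ^ 2 + η ^ 2)
  rw [Real.log_pow] at this
  rw [regLog, Real.log_abs]
  push_cast at this
  linarith

lemma regLog_neg (η u : ℝ) : regLog η (-u) = regLog η u := by simp [regLog]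

lemma measurable_regLog (η : ℝ) : Measurable (regLog η) := by
  unfold regLog; fun_prop

lemma regLog_le_log_one_add {η u : ℝ} (hη : 0 < η) (hη1 : η ≤ 1) :
    regLog η u ≤ Real.log (1 + |u|) := by
  have h : u ^ 2 + η ^ 2 ≤ (1 + |u|) ^ 2 := by
    nlinarith [abs_nonneg u, sq_abs u]
  have := Real.log_le_log (by positivity) h
  rw [Real.log_pow] at this
  rw [regLog]; push_cast at this; linarith

lemma log_le_regLog {η : ℝ} (u : ℝ) (hη : 0 < η) : Real.log η ≤ regLog η u := by
  have := Real.log_le_log (by positivity) (by nlinarith [sq_nonneg u] : η ^ 2 ≤ u ^ 2 + η ^ 2)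
  rw [Real.log_pow] at this
  rw [regLog]; push_cast at this; linarith

/-- For θ uniform, η tan θ has a Cauchy law, so this is Poisson's formula for the harmonic extension
of log |·| to the upper half plane. With u + iη = R e^{iφ} one has u - η tan θ = R cos (θ + φ) / cos
θ, and the two integrals of log |cos| over a period cancel. -/
lemma integral_regLog_poisson {η : ℝ} (hη : 0 < η) (u : ℝ) :
    IntervalIntegrable (fun θ => Real.log |u - η * Real.tan θ|) volume
        (-(Real.pi / 2)) (Real.pi / 2) ∧
      ∫ θ in (-(Real.pi / 2))..(Real.pi / 2), Real.log |u - η * Real.tan θ| =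
        Real.pi * regLog η u := by
  set z : ℂ := ⟨u, η⟩
  have hz : z ≠ 0 := fun h => hη.ne' (by simpa [z] using congrArg Complex.im h)
  have hR : 0 < ‖z‖ := norm_pos_iff.2 hz
  have hR2 : ‖z‖ ^ 2 = u ^ 2 + η ^ 2 := by
    rw [← Complex.normSq_eq_norm_sq, Complex.normSq_apply]; simp [z]; ring
  set φ := z.arg
  have hu : u = ‖z‖ * Real.cos φ := by
    exact (Complex.norm_mul_cos_arg z).symm
  have hh : η = ‖z‖ * Real.sin φ := by
    exact (Complex.norm_mul_sin_arg z).symm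
  have hlogR : Real.log ‖z‖ = regLog η u := by
    rw [regLog, ← hR2, Real.log_pow]; push_cast; ring
  have i0 : ∀ a b : ℝ, IntervalIntegrable (fun θ => Real.log (Real.cos θ)) volume a b :=
    fun a b => intervalIntegrable_log_cos
  have i1 : ∀ a b : ℝ, IntervalIntegrable (fun θ => Real.log (Real.cos (θ + φ))) volume a b :=
    fun a b => by
      have := (i0 (a + φ) (b + φ)).comp_add_right φ
      simpa using this
  have hper : Function.Periodic (fun θ => Real.log (Real.cos θ)) Real.pi := fun θ => by
    simp [Real.cos_add_pi, Real.log_neg_eq_log]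
  have key : ∀ᵐ θ ∂volume.restrict (Set.uIoc (-(Real.pi / 2)) (Real.pi / 2)),
      (Real.log ‖z‖ + Real.log (Real.cos (θ + φ)) - Real.log (Real.cos θ)) =
        Real.log |u - η * Real.tan θ| := by
    rw [ae_restrict_iff' measurableSet_uIoc]
    have hc : ∀ᵐ θ : ℝ, θ ∉ {θ : ℝ | θ = Real.pi / 2} ∪ {θ | Real.cos (θ + φ) = 0} := by
      have h1 : ({θ : ℝ | θ = Real.pi / 2} ∪ {θ | Real.cos (θ + φ) = 0}).Countable := by
        refine Set.Countable.union (Set.countable_singleton _) ?_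
        have : {θ | Real.cos (θ + φ) = 0} ⊆
            Set.range fun k : ℤ => (2 * k + 1) * Real.pi / 2 - φ := by
          intro θ hθ
          obtain ⟨k, hk⟩ := Real.cos_eq_zero_iff.1 hθ
          exact ⟨k, by simp only; rw [← hk]; ring⟩
        exact (Set.countable_range _).mono this
      exact measure_eq_zero_iff_ae_notMem.1 (h1.measure_zero _)
    filter_upwards [hc] with θ hθ hmem
    rw [Set.uIoc_of_le (by linarith [Real.pi_pos])] at hmem
    simp only [Set.mem_union, Set.mem_ofPred_eq, not_or] at hθ
    have hcos : 0 < Real.cos θ := Real.cos_pos_of_mem_Ioo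
      ⟨by linarith [hmem.1], lt_of_le_of_ne hmem.2 hθ.1⟩
    have e : u - η * Real.tan θ = ‖z‖ * Real.cos (θ + φ) / Real.cos θ := by
      rw [Real.tan_eq_sin_div_cos, Real.cos_add]
      field_simp
      linear_combination Real.cos θ * hu - Real.sin θ * hh
    rw [Real.log_abs, e, Real.log_div (mul_ne_zero hR.ne' hθ.2) hcos.ne',
      Real.log_mul hR.ne' hθ.2]
  have i2 := ((intervalIntegrable_const (c := Real.log ‖z‖)
    (a := -(Real.pi / 2)) (b := Real.pi / 2) (μ := volume)).add (i1 _ _)).sub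
      (i0 (-(Real.pi / 2)) (Real.pi / 2))
  refine ⟨i2.congr_ae key, ?_⟩
  rw [← intervalIntegral.integral_congr_ae_restrict key,
    intervalIntegral.integral_sub ((intervalIntegrable_const).add (i1 _ _)) (i0 _ _),
    intervalIntegral.integral_add intervalIntegrable_const (i1 _ _),
    intervalIntegral.integral_const,
    intervalIntegral.integral_comp_add_right (fun θ => Real.log (Real.cos θ)) φ]
  have := hper.intervalIntegral_add_eq (-(Real.pi / 2) + φ) (-(Real.pi / 2))
  rw [show -(Real.pi / 2) + φ + Real.pi = Real.pi / 2 + φ by ring,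
    show -(Real.pi / 2) + Real.pi = Real.pi / 2 by ring] at this
  rw [this, hlogR]
  simp only [smul_eq_mul]; ring

/-! ### Frullani representation -/

lemma integral_exp_neg_mul_sin_Ioi {η : ℝ} (hη : 0 < η) (w : ℝ) :
    ∫ t in Set.Ioi (0 : ℝ), Real.exp (-(η * t)) * Real.sin (t * w) = w / (w ^ 2 + η ^ 2) := by
  have h := integral_exp_mul_complex_Ioi (a := ⟨-η, w⟩) (by simpa using hη) 0
  have hi := integrableOn_exp_mul_complex_Ioi (a := ⟨-η, w⟩) (by simpa using hη) 0
  have h2 := congrArg Complex.im h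
  rw [← RCLike.im_eq_complex_im, ← integral_im hi] at h2
  have e : ∀ t : ℝ, RCLike.im (Complex.exp ((⟨-η, w⟩ : ℂ) * t)) =
      Real.exp (-(η * t)) * Real.sin (t * w) := fun t => by
    rw [RCLike.im_eq_complex_im, Complex.exp_im]; simp [mul_comm]
  simp only [e] at h2
  rw [h2]
  simp [Complex.div_im, Complex.normSq_apply]
  field_simp; ring

lemma one_sub_cos_nonneg (x : ℝ) : 0 ≤ 1 - Real.cos x := by linarith [Real.cos_le_one x]

/-- Write (1 - cos (tz))/t as the integral of sin (tw) over w from 0 to z and exchange: the Laplace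
transform of the sine is the derivative of `regLog η`. The positivity of the weight e^{-ηt}/t is
what makes the energy distance a nonnegative quantity. -/
lemma frullani_cos {η : ℝ} (hη : 0 < η) (z : ℝ) :
    IntegrableOn (fun t => Real.exp (-(η * t)) / t * (1 - Real.cos (t * z))) (Set.Ioi 0) ∧
    ∫ t in Set.Ioi (0 : ℝ), Real.exp (-(η * t)) / t * (1 - Real.cos (t * z)) =
      regLog η z - Real.log η := by
  have hint : Integrable (fun p : ℝ × ℝ => Real.exp (-(η * p.1)) * Real.sin (p.1 * p.2))
      ((volume.restrict (Set.Ioi 0)).prod (volume.restrict (Set.uIoc 0 z))) := by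
    have h1 : Integrable (fun t : ℝ => Real.exp (-(η * t))) (volume.restrict (Set.Ioi 0)) := by
      have := exp_neg_integrableOn_Ioi 0 hη
      simpa [neg_mul, IntegrableOn] using this
    have h2 : Integrable (fun _ : ℝ => (1 : ℝ)) (volume.restrict (Set.uIoc 0 z)) := by
      rw [Set.uIoc]; exact integrable_const _
    refine (h1.mul_prod h2).mono' (by fun_prop) (Eventually.of_forall fun p => ?_)
    rw [norm_mul, Real.norm_eq_abs, Real.norm_eq_abs, Real.abs_exp]
    exact mul_le_mul_of_nonneg_left (Real.abs_sin_le_one _) (Real.exp_pos _).le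
  have hsin : ∀ t ∈ Set.Ioi (0 : ℝ),
      ∫ w in (0 : ℝ)..z, Real.exp (-(η * t)) * Real.sin (t * w) =
        Real.exp (-(η * t)) / t * (1 - Real.cos (t * z)) := fun t ht => by
    have ht' : t ≠ 0 := ne_of_gt ht
    rw [intervalIntegral.integral_const_mul, intervalIntegral.integral_comp_mul_left _ ht']
    simp; field_simp
  constructor
  · have h3 := hint.integral_prod_left
    rcases le_total 0 z with hz | hz
    · refine h3.congr ?_
      rw [EventuallyEq, ae_restrict_iff' measurableSet_Ioi]
      refine Eventually.of_forall fun t ht => ?_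
      rw [← hsin t ht, intervalIntegral.integral_of_le hz, Set.uIoc_of_le hz]
    · refine h3.neg.congr ?_
      rw [EventuallyEq, ae_restrict_iff' measurableSet_Ioi]
      refine Eventually.of_forall fun t ht => ?_
      rw [← hsin t ht, intervalIntegral.integral_of_ge hz, Set.uIoc_of_ge hz]; rfl
  · rw [← setIntegral_congr_fun measurableSet_Ioi hsin]
    have hswap : ∫ t in Set.Ioi (0 : ℝ), ∫ w in (0 : ℝ)..z, Real.exp (-(η * t)) * Real.sin (t * w) =
        ∫ w in (0 : ℝ)..z, ∫ t in Set.Ioi (0 : ℝ), Real.exp (-(η * t)) * Real.sin (t * w) := by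
      simp only [intervalIntegral.intervalIntegral_eq_integral_uIoc]
      rw [integral_smul, integral_integral_swap hint]
    rw [hswap]
    simp only [integral_exp_neg_mul_sin_Ioi hη]
    have hd : ∀ w ∈ Set.uIcc 0 z, HasDerivAt (regLog η) (w / (w ^ 2 + η ^ 2)) w := fun w _ => by
      have hp : w ^ 2 + η ^ 2 ≠ 0 := by positivity
      have := (((hasDerivAt_pow 2 w).add_const (η ^ 2)).log hp).div_const 2
      refine this.congr_deriv ?_
      field_simp; norm_num [mul_comm]
    rw [intervalIntegral.integral_eq_sub_of_hasDerivAt hd, regLog_zero_right]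
    refine Continuous.intervalIntegrable ?_ _ _
    exact continuous_id.div (by fun_prop) fun w => by positivity

/-! ### Elementary bounds on the logarithm -/

/-- The locally integrable singularity `|u|^{-1/2}`. -/
def invSqrt (u : ℝ) : ℝ := (√|u|)⁻¹

lemma invSqrt_nonneg (u : ℝ) : 0 ≤ invSqrt u := by unfold invSqrt; positivity

lemma measurable_invSqrt : Measurable invSqrt := by unfold invSqrt; fun_prop

lemma invSqrt_neg (u : ℝ) : invSqrt (-u) = invSqrt u := by simp [invSqrt]

lemma invSqrt_le_one {u : ℝ} (hu : 1 ≤ |u|) : invSqrt u ≤ 1 := by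
  unfold invSqrt
  exact inv_le_one_of_one_le₀ (by rwa [Real.one_le_sqrt])

lemma neg_log_abs_le (u : ℝ) : -Real.log |u| ≤ 2 * invSqrt u := by
  rcases eq_or_ne u 0 with rfl | hu
  · simp [invSqrt]
  have h : 0 < √|u| := Real.sqrt_pos.2 (abs_pos.2 hu)
  have h1 := Real.log_le_self (inv_pos.2 h).le
  rw [Real.log_inv, Real.log_sqrt (abs_nonneg u)] at h1
  unfold invSqrt; linarith

lemma log_one_add_abs_nonneg (u : ℝ) : 0 ≤ Real.log (1 + |u|) :=
  Real.log_nonneg (by linarith [abs_nonneg u])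

lemma log_abs_le_log_one_add (u : ℝ) : Real.log |u| ≤ Real.log (1 + |u|) := by
  rcases eq_or_ne u 0 with rfl | hu
  · simp
  · exact Real.log_le_log (abs_pos.2 hu) (by linarith)

lemma log_one_add_abs_add_le (u v : ℝ) :
    Real.log (1 + |u + v|) ≤ Real.log (1 + |u|) + Real.log (1 + |v|) := by
  rw [← Real.log_mul (by positivity) (by positivity)]
  refine Real.log_le_log (by positivity) ?_
  nlinarith [abs_add_le u v, abs_nonneg u, abs_nonneg v, mul_nonneg (abs_nonneg u) (abs_nonneg v)]

lemma log_one_add_abs_sub_le (u v : ℝ) :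
    Real.log (1 + |u - v|) ≤ Real.log (1 + |u|) + Real.log (1 + |v|) := by
  simpa [sub_eq_add_neg] using log_one_add_abs_add_le u (-v)

lemma abs_log_abs_le (u : ℝ) : |Real.log (|u|)| ≤ Real.log (1 + |u|) + 2 * invSqrt u := by
  have h1 := neg_log_abs_le u
  have h2 := log_abs_le_log_one_add u
  have h3 := log_one_add_abs_nonneg u
  have h4 := invSqrt_nonneg u
  exact abs_le.2 ⟨by linarith, by linarith⟩

lemma abs_log_abs_sub_le (x y : ℝ) :
    |Real.log (|x - y|)| ≤ Real.log (1 + |x|) + Real.log (1 + |y|) + 2 * invSqrt (x - y) :=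
  (abs_log_abs_le _).trans (by linarith [log_one_add_abs_sub_le x y])

lemma log_one_add_abs_le (u : ℝ) : Real.log (1 + |u|) ≤ Real.log 2 + |Real.log (|u|)| := by
  rcases le_total |u| 1 with h | h
  · have := Real.log_le_log (by positivity) (by linarith : 1 + |u| ≤ 2)
    linarith [abs_nonneg (Real.log |u|)]
  · have := Real.log_le_log (by positivity) (by linarith : 1 + |u| ≤ 2 * |u|)
    rw [Real.log_mul (by norm_num) (by linarith)] at this
    linarith [le_abs_self (Real.log |u|)]

/-- Square √|a| ≤ √|b| + √|a - b|, take logarithms and use log (1 + x) ≤ x. The exponent 1/2 leaves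
a singularity in b that is still locally integrable. -/
lemma log_sub_log_le {a b : ℝ} (ha : a ≠ 0) (hb : b ≠ 0) :
    Real.log |a| - Real.log |b| ≤ 2 * √|a - b| * invSqrt b := by
  have ha' := abs_pos.2 ha
  have hb' := abs_pos.2 hb
  have hs : 0 < √|b| := Real.sqrt_pos.2 hb'
  have h1 : |a| ≤ |b| * (1 + √|a - b| * invSqrt b) ^ 2 := by
    have e : |b| * (1 + √|a - b| * invSqrt b) ^ 2 = (√|b| + √|a - b|) ^ 2 := by
      rw [invSqrt]
      nth_rewrite 1 [← Real.sq_sqrt (abs_nonneg b)]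
      field_simp
    rw [e]
    have h2 : |a| ≤ |b| + |a - b| := by
      have := abs_add_le b (a - b); simpa using this
    nlinarith [Real.sq_sqrt (abs_nonneg b), Real.sq_sqrt (abs_nonneg (a - b)),
      Real.sqrt_nonneg |b|, Real.sqrt_nonneg |a - b|,
      mul_nonneg (Real.sqrt_nonneg |b|) (Real.sqrt_nonneg |a - b|)]
  have h0 : 0 ≤ √|a - b| * invSqrt b := mul_nonneg (Real.sqrt_nonneg _) (invSqrt_nonneg _)
  have h3 := Real.log_le_log ha' h1
  rw [Real.log_mul hb'.ne' (by positivity), Real.log_pow] at h3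
  have h4 := Real.log_le_sub_one_of_pos (by linarith : 0 < 1 + √|a - b| * invSqrt b)
  push_cast at h3
  linarith

lemma abs_log_sub_log_le {a b : ℝ} (ha : a ≠ 0) (hb : b ≠ 0) :
    |Real.log |a| - Real.log (|b|)| ≤ 2 * √|a - b| * (invSqrt a + invSqrt b) := by
  have h1 := log_sub_log_le ha hb
  have h2 := log_sub_log_le hb ha
  rw [abs_sub_comm b a] at h2
  have h3 : 0 ≤ 2 * √|a - b| * invSqrt a := mul_nonneg (by positivity) (invSqrt_nonneg _)
  have h4 : 0 ≤ 2 * √|a - b| * invSqrt b := mul_nonneg (by positivity) (invSqrt_nonneg _)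
  exact abs_le.2 ⟨by linarith, by linarith⟩

lemma integrableOn_invSqrt : IntegrableOn invSqrt (Set.Icc (-1) 1) := by
  have h0 : IntegrableOn invSqrt (Set.Ioc 0 1) := by
    have := (intervalIntegral.intervalIntegrable_rpow' (a := 0) (b := 1)
      (by norm_num : (-1 : ℝ) < -(1 / 2)))
    rw [intervalIntegrable_iff_integrableOn_Ioc_of_le zero_le_one] at this
    refine this.congr_fun (fun u hu => ?_) measurableSet_Ioc
    simp only [invSqrt]
    rw [abs_of_pos hu.1, Real.sqrt_eq_rpow, Real.rpow_neg hu.1.le]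
  have h1 : IntegrableOn invSqrt (Set.Icc 0 1) := by rwa [integrableOn_Icc_iff_integrableOn_Ioc]
  have h2 : IntegrableOn invSqrt (Set.Icc (-1) 0) := by
    have := (Measure.measurePreserving_neg (volume : Measure ℝ)).integrableOn_comp_preimage
      (MeasurableEquiv.neg ℝ).measurableEmbedding (f := invSqrt) (s := Set.Icc 0 1)
    have h3 := this.2 h1
    simpa [Function.comp_def, invSqrt_neg] using h3
  have := h2.union h1
  rwa [Set.Icc_union_Icc_eq_Icc (by norm_num) (by norm_num)] at this

/-- The mass of `|u|^{-1/2}` on `[-1, 1]`. -/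
def invSqrtMass : ℝ := ∫ u in Set.Icc (-1) 1, invSqrt u

lemma invSqrtMass_nonneg : 0 ≤ invSqrtMass :=
  integral_nonneg fun _ => invSqrt_nonneg _

/-! ### Logarithmic integrals against measures of bounded density -/

section BoundedDensity

variable {β : Measure ℝ} {M : ℝ≥0∞}

/-- Off [-1, 1] the kernel is at most 1 and the total mass suffices; on [-1, 1] domination by M
times Lebesgue measure suffices. The bound is uniform in x. -/
lemma lintegral_invSqrt_le (hβ : β ≤ M • volume) (x : ℝ) :
    ∫⁻ y, ENNReal.ofReal (invSqrt (x - y)) ∂β ≤ β Set.univ + M * ENNReal.ofReal invSqrtMass := by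
  have hle : ∀ y, ENNReal.ofReal (invSqrt (x - y)) ≤
      1 + (Set.Icc (-1) 1).indicator (fun u => ENNReal.ofReal (invSqrt u)) (x - y) := fun y => by
    by_cases h : x - y ∈ Set.Icc (-1 : ℝ) 1
    · rw [Set.indicator_of_mem h]; exact le_add_self
    · rw [Set.indicator_of_notMem h, add_zero]
      have : 1 ≤ |x - y| := by
        by_contra hlt
        push Not at hlt
        exact h ⟨(abs_le.1 hlt.le).1, (abs_le.1 hlt.le).2⟩
      exact ENNReal.ofReal_le_one.2 (invSqrt_le_one this)
  have hm : Measurable ((Set.Icc (-1 : ℝ) 1).indicator fun u => ENNReal.ofReal (invSqrt u)) :=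
    (measurable_invSqrt.ennreal_ofReal).indicator measurableSet_Icc
  calc ∫⁻ y, ENNReal.ofReal (invSqrt (x - y)) ∂β
      ≤ ∫⁻ y, (1 + (Set.Icc (-1) 1).indicator (fun u => ENNReal.ofReal (invSqrt u)) (x - y)) ∂β :=
        lintegral_mono hle
    _ = β Set.univ +
        ∫⁻ y, (Set.Icc (-1) 1).indicator (fun u => ENNReal.ofReal (invSqrt u)) (x - y) ∂β := by
        rw [lintegral_add_left measurable_const, lintegral_one]
    _ ≤ β Set.univ + ∫⁻ y, (Set.Icc (-1) 1).indicator (fun u => ENNReal.ofReal (invSqrt u)) (x - y)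
          ∂(M • volume) := by gcongr
    _ = β Set.univ + M * ENNReal.ofReal invSqrtMass := by
        rw [lintegral_smul_measure, smul_eq_mul,
          lintegral_sub_left_eq_self (fun u => (Set.Icc (-1 : ℝ) 1).indicator
            (fun u => ENNReal.ofReal (invSqrt u)) u) x,
          lintegral_indicator measurableSet_Icc, invSqrtMass,
          ofReal_integral_eq_lintegral_ofReal integrableOn_invSqrt
            (Eventually.of_forall fun _ => invSqrt_nonneg _)]

lemma integrable_invSqrt_sub [IsFiniteMeasure β] (hβ : β ≤ M • volume) (hM : M ≠ ⊤) (x : ℝ) :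
    Integrable (fun y => invSqrt (x - y)) β := by
  refine ⟨(measurable_invSqrt.comp (measurable_const.sub measurable_id)).aestronglyMeasurable, ?_⟩
  rw [hasFiniteIntegral_iff_ofReal (Eventually.of_forall fun _ => invSqrt_nonneg _)]
  exact (lintegral_invSqrt_le hβ x).trans_lt
    (ENNReal.add_lt_top.2 ⟨measure_lt_top _ _,
      ENNReal.mul_lt_top hM.lt_top ENNReal.ofReal_lt_top⟩)

lemma integral_invSqrt_sub_le [IsFiniteMeasure β] (hβ : β ≤ M • volume) (hM : M ≠ ⊤) (x : ℝ) :
    ∫ y, invSqrt (x - y) ∂β ≤ β.real Set.univ + M.toReal * invSqrtMass := by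
  rw [integral_eq_lintegral_of_nonneg_ae (Eventually.of_forall fun _ => invSqrt_nonneg _)
    (Measurable.aestronglyMeasurable (measurable_invSqrt.comp (by fun_prop)))]
  have hfin : M * ENNReal.ofReal invSqrtMass ≠ ⊤ := ENNReal.mul_ne_top hM ENNReal.ofReal_ne_top
  refine (ENNReal.toReal_mono (ENNReal.add_ne_top.2 ⟨measure_ne_top _ _, hfin⟩)
    (lintegral_invSqrt_le hβ x)).trans_eq ?_
  rw [ENNReal.toReal_add (measure_ne_top _ _) hfin, ENNReal.toReal_mul,
    ENNReal.toReal_ofReal invSqrtMass_nonneg, Measure.real]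

lemma measurable_log_abs_sub : Measurable fun p : ℝ × ℝ => Real.log |p.1 - p.2| :=
  Real.measurable_log.comp (measurable_fst.sub measurable_snd).abs

lemma integrable_log_sub [IsFiniteMeasure β] (hβ : β ≤ M • volume) (hM : M ≠ ⊤)
    (hlog : Integrable (fun y => Real.log (1 + |y|)) β) (x : ℝ) :
    Integrable (fun y => Real.log |x - y|) β := by
  refine (((integrable_const (Real.log (1 + |x|))).add hlog).add
    ((integrable_invSqrt_sub hβ hM x).const_mul 2)).mono'
    (Measurable.aestronglyMeasurable (by fun_prop)) (Eventually.of_forall fun y => ?_)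
  exact abs_log_abs_sub_le x y

/-- One bounded density is enough: the singularity is integrated against β first, uniformly in the
other variable. Thus α may be any finite measure with a logarithmic moment. -/
lemma integrable_log_prod {α : Measure ℝ} [IsFiniteMeasure α] [IsFiniteMeasure β]
    (hβ : β ≤ M • volume) (hM : M ≠ ⊤) (hα : Integrable (fun y => Real.log (1 + |y|)) α)
    (hlog : Integrable (fun y => Real.log (1 + |y|)) β) :
    Integrable (fun p : ℝ × ℝ => Real.log |p.1 - p.2|) (α.prod β) := by
  have hs : Integrable (fun p : ℝ × ℝ => invSqrt (p.1 - p.2)) (α.prod β) := by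
    have hm : Measurable fun p : ℝ × ℝ => invSqrt (p.1 - p.2) :=
      measurable_invSqrt.comp (measurable_fst.sub measurable_snd)
    refine ⟨hm.aestronglyMeasurable, ?_⟩
    rw [hasFiniteIntegral_iff_ofReal (Eventually.of_forall fun _ => invSqrt_nonneg _),
      lintegral_prod _ hm.ennreal_ofReal.aemeasurable]
    refine (lintegral_mono fun x => lintegral_invSqrt_le hβ x).trans_lt ?_
    rw [lintegral_const]
    exact ENNReal.mul_lt_top (ENNReal.add_lt_top.2 ⟨measure_lt_top _ _,
      ENNReal.mul_lt_top hM.lt_top ENNReal.ofReal_lt_top⟩) (measure_lt_top _ _)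
  refine (((hα.comp_fst β).add (hlog.comp_snd α)).add (hs.const_mul 2)).mono'
    measurable_log_abs_sub.aestronglyMeasurable (Eventually.of_forall fun p => ?_)
  exact abs_log_abs_sub_le p.1 p.2

end BoundedDensity

/-- By Fubini log |x - y| is μ-integrable in y for some fixed x, and log (1 + |y|) differs from its
absolute value by at most a constant depending on x. -/
lemma integrable_log_one_add_of_interaction {μ : Measure ℝ} [IsProbabilityMeasure μ]
    (h : Integrable (fun p : ℝ × ℝ => Real.log |p.1 - p.2|) (μ.prod μ)) :
    Integrable (fun y => Real.log (1 + |y|)) μ := by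
  obtain ⟨x, hx⟩ := h.prod_right_ae.exists
  refine (((integrable_const (Real.log (1 + |x|) + Real.log 2)).add hx.abs)).mono'
    (Measurable.aestronglyMeasurable (by fun_prop)) (Eventually.of_forall fun y => ?_)
  rw [Real.norm_of_nonneg (log_one_add_abs_nonneg _)]
  have h1 := log_one_add_abs_sub_le x (x - y)
  have h2 := log_one_add_abs_le (x - y)
  rw [sub_sub_cancel] at h1
  simp only [Pi.add_apply]
  linarith

/-! ### Euler–Lagrange equation -/

/-- The logarithmic potential `∫ log |x - y| dμ(y)`. -/
def logPot (μ : Measure ℝ) (x : ℝ) : ℝ := ∫ y, Real.log |x - y| ∂μ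

lemma measurable_logPot (μ : Measure ℝ) [SFinite μ] : Measurable (logPot μ) :=
  (measurable_log_abs_sub.stronglyMeasurable.integral_prod_right (ν := μ)).measurable

section Mixture

variable {X : Type*} [MeasurableSpace X] {α β : Measure X} {g : X → ℝ} {a b : ℝ}

lemma integrable_mixture (hα : Integrable g α) (hβ : Integrable g β) :
    Integrable g (ENNReal.ofReal a • α + ENNReal.ofReal b • β) :=
  (hα.smul_measure ENNReal.ofReal_ne_top).add_measure (hβ.smul_measure ENNReal.ofReal_ne_top)

lemma integral_mixture (ha : 0 ≤ a) (hb : 0 ≤ b) (hα : Integrable g α) (hβ : Integrable g β) :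
    ∫ x, g x ∂(ENNReal.ofReal a • α + ENNReal.ofReal b • β) =
      a * ∫ x, g x ∂α + b * ∫ x, g x ∂β := by
  rw [integral_add_measure (hα.smul_measure ENNReal.ofReal_ne_top)
    (hβ.smul_measure ENNReal.ofReal_ne_top), integral_smul_measure, integral_smul_measure,
    ENNReal.toReal_ofReal ha, ENNReal.toReal_ofReal hb, smul_eq_mul, smul_eq_mul]

lemma prod_mixture [SFinite α] [SFinite β] :
    (ENNReal.ofReal a • α + ENNReal.ofReal b • β).prod
        (ENNReal.ofReal a • α + ENNReal.ofReal b • β) =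
      ENNReal.ofReal a • (ENNReal.ofReal a • α.prod α + ENNReal.ofReal b • α.prod β) +
      ENNReal.ofReal b • (ENNReal.ofReal a • β.prod α + ENNReal.ofReal b • β.prod β) := by
  rw [Measure.prod_add, Measure.add_prod, Measure.add_prod]
  simp only [Measure.prod_smul_left, Measure.prod_smul_right, smul_add, smul_smul]
  rw [mul_comm (ENNReal.ofReal b) (ENNReal.ofReal a)]
  abel

end Mixture

lemma integrable_log_swap {α β : Measure ℝ} [SFinite α] [SFinite β]
    (h : Integrable (fun p : ℝ × ℝ => Real.log |p.1 - p.2|) (α.prod β)) :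
    Integrable (fun p : ℝ × ℝ => Real.log |p.1 - p.2|) (β.prod α) := by
  have := h.swap
  refine this.congr (Eventually.of_forall fun p => ?_)
  simp [Function.comp, abs_sub_comm]

lemma integral_log_swap {α β : Measure ℝ} [SFinite α] [SFinite β] :
    ∫ p : ℝ × ℝ, Real.log |p.1 - p.2| ∂(β.prod α) =
      ∫ p : ℝ × ℝ, Real.log |p.1 - p.2| ∂(α.prod β) := by
  rw [← integral_prod_swap]
  simp [abs_sub_comm]

lemma measurable_density (μ : Measure ℝ) : Measurable (density μ) :=
  (Measure.measurable_rnDeriv _ _).ennreal_toReal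

lemma density_nonneg (μ : Measure ℝ) (x : ℝ) : 0 ≤ density μ x := ENNReal.toReal_nonneg

lemma density_pos_ae {μ : Measure ℝ} [IsProbabilityMeasure μ] (h : μ ≪ volume) :
    ∀ᵐ x ∂μ, 0 < density μ x := by
  filter_upwards [Measure.rnDeriv_pos h, h.ae_le (Measure.rnDeriv_lt_top μ volume)] with x h1 h2
  exact ENNReal.toReal_pos h1.ne' h2.ne

lemma ofReal_density_ae (μ : Measure ℝ) [IsProbabilityMeasure μ] :
    ∀ᵐ x ∂(volume : Measure ℝ), ENNReal.ofReal (density μ x) = μ.rnDeriv volume x := by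
  filter_upwards [Measure.rnDeriv_lt_top μ volume] with x h2
  exact ENNReal.ofReal_toReal h2.ne

/-- The uniform probability measure on `A`. -/
def uniformOn (A : Set ℝ) : Measure ℝ :=
  ENNReal.ofReal (volume.real A)⁻¹ • volume.restrict A

/-! ### First variation of the free energy towards a uniform measure -/

section Variation

variable {P : ℝ} {V : ℝ → ℝ} {μ : Measure ℝ} {A : Set ℝ} {R κ t : ℝ}

lemma ofReal_inv_mul_volume (hA0 : volume A ≠ 0) (hA1 : volume A ≠ ⊤) :
    ENNReal.ofReal (volume.real A)⁻¹ * volume A = 1 := by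
  have h : 0 < volume.real A := ENNReal.toReal_pos hA0 hA1
  rw [ENNReal.ofReal_inv_of_pos h, ofReal_measureReal hA1, ENNReal.inv_mul_cancel hA0 hA1]

lemma isProbabilityMeasure_uniformOn (hA0 : volume A ≠ 0) (hA1 : volume A ≠ ⊤) :
    IsProbabilityMeasure (uniformOn A) := by
  constructor
  rw [uniformOn, Measure.smul_apply, Measure.restrict_apply_univ, smul_eq_mul,
    ofReal_inv_mul_volume hA0 hA1]

lemma uniformOn_le : uniformOn A ≤ ENNReal.ofReal (volume.real A)⁻¹ • volume := by
  intro s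
  simp only [uniformOn, Measure.smul_apply, smul_eq_mul]
  gcongr
  exact Measure.restrict_le_self

lemma uniformOn_ae {p : ℝ → Prop} (hA : MeasurableSet A) (h : ∀ᵐ x, x ∈ A → p x) :
    ∀ᵐ x ∂(uniformOn A), p x :=
  (Measure.smul_absolutelyContinuous).ae_le ((ae_restrict_iff' hA).2 h)

lemma integrable_uniformOn_of_continuous {g : ℝ → ℝ} (hAR : A ⊆ Set.Icc (-R) R) (hg : Continuous g) :
    Integrable g (uniformOn A) :=
  (hg.continuousOn.integrableOn_Icc.mono_set hAR).smul_measure ENNReal.ofReal_ne_top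

lemma density_mixture [IsProbabilityMeasure μ] (hA : MeasurableSet A)
    (hA1 : volume A ≠ ⊤) (ht0 : 0 ≤ t) (ht1 : t ≤ 1) :
    ∀ᵐ x, density (ENNReal.ofReal (1 - t) • μ + ENNReal.ofReal t • uniformOn A) x =
      (1 - t) * density μ x + t * A.indicator (fun _ => (volume.real A)⁻¹) x := by
  have : IsFiniteMeasure (volume.restrict A) := ⟨by simpa using hA1.lt_top⟩
  have : IsFiniteMeasure (uniformOn A) := by
    unfold uniformOn; exact Measure.smul_finite _ ENNReal.ofReal_ne_top
  have : IsFiniteMeasure (ENNReal.ofReal (1 - t) • μ) := Measure.smul_finite _ ENNReal.ofReal_ne_top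
  have : IsFiniteMeasure (ENNReal.ofReal t • uniformOn A) :=
    Measure.smul_finite _ ENNReal.ofReal_ne_top
  filter_upwards [Measure.rnDeriv_add' (ENNReal.ofReal (1 - t) • μ)
      (ENNReal.ofReal t • uniformOn A) volume,
    Measure.rnDeriv_smul_left_of_ne_top μ volume (r := ENNReal.ofReal (1 - t)) ENNReal.ofReal_ne_top,
    Measure.rnDeriv_smul_left_of_ne_top (uniformOn A) volume (r := ENNReal.ofReal t)
      ENNReal.ofReal_ne_top,
    Measure.rnDeriv_smul_left_of_ne_top (volume.restrict A) volume
      (r := ENNReal.ofReal (volume.real A)⁻¹) ENNReal.ofReal_ne_top,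
    Measure.rnDeriv_restrict_self volume hA, Measure.rnDeriv_lt_top μ volume]
    with x h1 h2 h3 h4 h5 h6
  have h4' : (uniformOn A).rnDeriv volume x =
      ENNReal.ofReal (A.indicator (fun _ => (volume.real A)⁻¹) x) := by
    rw [uniformOn, h4, Pi.smul_apply, h5]
    by_cases hx : x ∈ A <;> simp [hx]
  have hnn : 0 ≤ A.indicator (fun _ => (volume.real A)⁻¹) x :=
    Set.indicator_nonneg (fun _ _ => inv_nonneg.2 measureReal_nonneg) x
  rw [density, h1, Pi.add_apply, h2, h3, Pi.smul_apply, Pi.smul_apply, h4', smul_eq_mul,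
    smul_eq_mul, ENNReal.toReal_add (ENNReal.mul_ne_top ENNReal.ofReal_ne_top h6.ne)
    (ENNReal.mul_ne_top ENNReal.ofReal_ne_top ENNReal.ofReal_ne_top), ENNReal.toReal_mul,
    ENNReal.toReal_mul, ENNReal.toReal_ofReal (by linarith), ENNReal.toReal_ofReal ht0,
    ENNReal.toReal_ofReal hnn]
  rfl

/-- Against μ, concavity of the logarithm bounds the gain by t (∫ w dμ - 1) ≤ 0, where w is the
ratio of the uniform density to that of μ. Against the uniform measure the mixed density is at most
κ + t/|A|. The bound keeps the logarithm finite as t → 0 even where the density of μ vanishes on A.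
-/
lemma entropy_mixture (hμ : FiniteFreeEnergy V μ) (hA : MeasurableSet A)
    (hA0 : volume A ≠ 0) (hA1 : volume A ≠ ⊤) (hκ : ∀ x ∈ A, density μ x ≤ κ)
    (ht0 : 0 < t) (ht1 : t < 1) :
    Integrable (fun x => Real.log (density
        (ENNReal.ofReal (1 - t) • μ + ENNReal.ofReal t • uniformOn A) x))
      (ENNReal.ofReal (1 - t) • μ + ENNReal.ofReal t • uniformOn A) ∧
    ∫ x, Real.log (density (ENNReal.ofReal (1 - t) • μ + ENNReal.ofReal t • uniformOn A) x)
        ∂(ENNReal.ofReal (1 - t) • μ + ENNReal.ofReal t • uniformOn A) ≤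
      (1 - t) * ∫ x, Real.log (density μ x) ∂μ + t * Real.log (κ + t * (volume.real A)⁻¹) := by
  have := hμ.isProbabilityMeasure
  have := isProbabilityMeasure_uniformOn hA0 hA1
  set s := (volume.real A)⁻¹ with hs
  have hs0 : 0 < s := inv_pos.2 (ENNReal.toReal_pos hA0 hA1)
  set ν := ENNReal.ofReal (1 - t) • μ + ENNReal.ofReal t • uniformOn A
  have hdens := density_mixture (μ := μ) hA hA1 ht0.le ht1.le
  set w : ℝ → ℝ := fun x => A.indicator (fun _ => s) x / density μ x with hw
  have hind : ∀ x, 0 ≤ A.indicator (fun _ => s) x :=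
    fun x => Set.indicator_nonneg (fun _ _ => hs0.le) x
  have hw0 : ∀ x, 0 ≤ w x := fun x => div_nonneg (hind x) (density_nonneg _ _)
  have hwm : Measurable w := (measurable_const.indicator hA).div (measurable_density μ)
  -- Only an inequality: where the density of μ vanishes, w is 0 by the convention for division, so
  -- mass of A may be lost.
  have hwl : ∫⁻ x, ENNReal.ofReal (w x) ∂μ ≤ 1 := by
    rw [← lintegral_rnDeriv_mul hμ.absolutelyContinuous hwm.ennreal_ofReal.aemeasurable]
    calc ∫⁻ x, μ.rnDeriv volume x * ENNReal.ofReal (w x)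
        ≤ ∫⁻ x, A.indicator (fun _ => ENNReal.ofReal s) x := by
          refine lintegral_mono_ae ?_
          filter_upwards [ofReal_density_ae μ] with x hx
          rw [← hx, ← ENNReal.ofReal_mul (density_nonneg _ _)]
          rw [show A.indicator (fun _ => ENNReal.ofReal s) x =
            ENNReal.ofReal (A.indicator (fun _ => s) x) by by_cases h : x ∈ A <;> simp [h]]
          refine ENNReal.ofReal_le_ofReal ?_
          rcases eq_or_ne (density μ x) 0 with h | h
          · simpa [h] using hind x
          · exact (mul_div_cancel₀ _ h).le
      _ = 1 := by
          rw [lintegral_indicator_const hA, hs, ofReal_inv_mul_volume hA0 hA1]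
  have hwi : Integrable w μ := by
    refine ⟨hwm.aestronglyMeasurable, ?_⟩
    rw [hasFiniteIntegral_iff_ofReal (Eventually.of_forall hw0)]
    exact hwl.trans_lt ENNReal.one_lt_top
  have hw1 : ∫ x, w x ∂μ ≤ 1 := by
    rw [integral_eq_lintegral_of_nonneg_ae (Eventually.of_forall hw0) hwm.aestronglyMeasurable]
    exact ENNReal.toReal_le_of_le_ofReal zero_le_one (by simpa using hwl)
  have hmeas : Measurable fun x => Real.log (density ν x) :=
    Real.measurable_log.comp (measurable_density ν)
  have hμb : ∀ᵐ x ∂μ, Real.log (1 - t) + Real.log (density μ x) ≤ Real.log (density ν x) ∧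
      Real.log (density ν x) ≤ Real.log (density μ x) + t * (w x - 1) := by
    filter_upwards [hμ.absolutelyContinuous.ae_le hdens,
      density_pos_ae hμ.absolutelyContinuous] with x h1 h2
    have h3 : density ν x = density μ x * ((1 - t) + t * w x) := by
      rw [h1, mul_add, mul_left_comm, mul_div_cancel₀ _ h2.ne']; ring
    have h4 : 0 < (1 - t) + t * w x := by nlinarith [hw0 x]
    rw [h3, Real.log_mul h2.ne' h4.ne']
    have h5 := Real.log_le_log (by linarith : 0 < 1 - t)
      (by nlinarith [hw0 x] : 1 - t ≤ (1 - t) + t * w x)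
    have h6 := Real.log_le_sub_one_of_pos h4
    constructor <;> linarith
  have hiμ : Integrable (fun x => Real.log (density ν x)) μ := by
    have hu := hμ.entropy.add ((hwi.sub (integrable_const (1 : ℝ))).const_mul t)
    have hl := (integrable_const (Real.log (1 - t))).add hμ.entropy
    refine (hu.abs.add hl.abs).mono' hmeas.aestronglyMeasurable ?_
    filter_upwards [hμb] with x hx
    simp only [Pi.add_apply, Pi.sub_apply, Real.norm_eq_abs]
    rw [abs_le]
    constructor
    · linarith [neg_abs_le (Real.log (1 - t) + Real.log (density μ x)),
        abs_nonneg (Real.log (density μ x) + t * (w x - 1))]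
    · linarith [le_abs_self (Real.log (density μ x) + t * (w x - 1)),
        abs_nonneg (Real.log (1 - t) + Real.log (density μ x))]
  have hσb : ∀ᵐ x ∂(uniformOn A), Real.log (t * s) ≤ Real.log (density ν x) ∧
      Real.log (density ν x) ≤ Real.log (κ + t * s) := by
    refine uniformOn_ae hA ?_
    filter_upwards [hdens] with x h1 hx
    rw [Set.indicator_of_mem hx] at h1
    have h2 : t * s ≤ density ν x := by
      rw [h1]; nlinarith [mul_nonneg (by linarith : 0 ≤ 1 - t) (density_nonneg μ x)]
    have h3 : density ν x ≤ κ + t * s := by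
      rw [h1]; nlinarith [hκ x hx, density_nonneg μ x]
    have h4 : 0 < t * s := by positivity
    exact ⟨Real.log_le_log h4 h2, Real.log_le_log (by linarith) h3⟩
  have hiσ : Integrable (fun x => Real.log (density ν x)) (uniformOn A) := by
    refine (integrable_const (|Real.log (t * s)| + |Real.log (κ + t * s)|)).mono'
      hmeas.aestronglyMeasurable ?_
    filter_upwards [hσb] with x hx
    rw [Real.norm_eq_abs, abs_le]
    constructor
    · linarith [neg_abs_le (Real.log (t * s)), abs_nonneg (Real.log (κ + t * s))]
    · linarith [le_abs_self (Real.log (κ + t * s)), abs_nonneg (Real.log (t * s))]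
  refine ⟨integrable_mixture hiμ hiσ, ?_⟩
  rw [integral_mixture (by linarith) ht0.le hiμ hiσ]
  have e1 : ∫ x, Real.log (density ν x) ∂μ ≤ ∫ x, Real.log (density μ x) ∂μ := by
    have hi2 : Integrable (fun x => t * (w x - 1)) μ :=
      (hwi.sub (integrable_const (1 : ℝ))).const_mul t
    calc ∫ x, Real.log (density ν x) ∂μ
        ≤ ∫ x, (Real.log (density μ x) + t * (w x - 1)) ∂μ :=
          integral_mono_ae hiμ (hμ.entropy.add hi2) (hμb.mono fun x hx => hx.2)
      _ = ∫ x, Real.log (density μ x) ∂μ + t * (∫ x, w x ∂μ - 1) := by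
          rw [integral_add hμ.entropy hi2, integral_const_mul,
            integral_sub hwi (integrable_const _)]
          simp
      _ ≤ _ := by nlinarith
  have e2 : ∫ x, Real.log (density ν x) ∂(uniformOn A) ≤ Real.log (κ + t * s) := by
    calc ∫ x, Real.log (density ν x) ∂(uniformOn A)
        ≤ ∫ _, Real.log (κ + t * s) ∂(uniformOn A) :=
          integral_mono_ae hiσ (integrable_const _) (hσb.mono fun x hx => hx.2)
      _ = _ := by simp
  have : 0 ≤ 1 - t := by linarith
  gcongr

/-- The Lagrange multiplier of the equilibrium measure. -/
def lagrange (P : ℝ) (V : ℝ → ℝ) (μ : Measure ℝ) : ℝ :=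
  (∫ x, V x ∂μ) - 2 * P * logEnergy μ + ∫ x, Real.log (density μ x) ∂μ

/-- Minimality is tested on (1 - t) μ + t · uniform(A); dividing the increment of the free energy by
t and letting t → 0 gives the averaged Euler–Lagrange inequality. Boundedness of A makes all mutual
energies finite. -/
lemma lagrange_le (hμ : IsEquilibriumMeasure P V μ) (hV : Continuous V) (hA : MeasurableSet A)
    (hA0 : volume A ≠ 0) (hAR : A ⊆ Set.Icc (-R) R) (hκ0 : 0 < κ)
    (hκ : ∀ x ∈ A, density μ x ≤ κ) :
    Integrable (fun x => V x - 2 * P * logPot μ x) (uniformOn A) ∧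
    lagrange P V μ ≤ ∫ x, (V x - 2 * P * logPot μ x) ∂(uniformOn A) + Real.log κ := by
  have hA1 : volume A ≠ ⊤ := ((measure_mono hAR).trans_lt measure_Icc_lt_top).ne
  have := hμ.finite.isProbabilityMeasure
  have := isProbabilityMeasure_uniformOn hA0 hA1
  set σ := uniformOn A
  set s := (volume.real A)⁻¹
  have hs0 : 0 < s := inv_pos.2 (ENNReal.toReal_pos hA0 hA1)
  have hVσ : Integrable V σ := integrable_uniformOn_of_continuous hAR hV
  have hlogμ := integrable_log_one_add_of_interaction hμ.finite.interaction
  have hlogσ : Integrable (fun y => Real.log (1 + |y|)) σ :=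
    integrable_uniformOn_of_continuous hAR
      ((continuous_const.add continuous_abs).log fun x => (by positivity : 1 + |x| ≠ 0))
  have hμσ := integrable_log_prod uniformOn_le ENNReal.ofReal_ne_top hlogμ hlogσ
  have hσσ := integrable_log_prod uniformOn_le ENNReal.ofReal_ne_top hlogσ hlogσ
  have hσμ := integrable_log_swap hμσ
  set I := ∫ p : ℝ × ℝ, Real.log |p.1 - p.2| ∂(σ.prod μ) with hI
  have hIμ : ∫ p : ℝ × ℝ, Real.log |p.1 - p.2| ∂(μ.prod σ) = I := integral_log_swap
  set J := ∫ p : ℝ × ℝ, Real.log |p.1 - p.2| ∂(σ.prod σ)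
  have hUσ : Integrable (logPot μ) σ := hσμ.integral_prod_left
  have hIU : I = ∫ x, logPot μ x ∂σ := by rw [hI, integral_prod _ hσμ]; rfl
  refine ⟨hVσ.sub (hUσ.const_mul _), ?_⟩
  set E := logEnergy μ with hE
  -- The interaction bracket is the increment of the logarithmic energy divided by t, namely
  -- (((1-t)² - 1) E + 2t(1-t) I + t² J)/t.
  have key : ∀ t ∈ Set.Ioo (0 : ℝ) 1, (∫ x, V x ∂μ) + ∫ x, Real.log (density μ x) ∂μ ≤
      (∫ x, V x ∂σ) + Real.log (κ + t * s) - P * ((t - 2) * E + 2 * (1 - t) * I + t * J) := by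
    rintro t ⟨ht0, ht1⟩
    have h1t : 0 ≤ 1 - t := by linarith
    obtain ⟨hent, hentle⟩ := entropy_mixture hμ.finite hA hA0 hA1 hκ ht0 ht1
    set ν := ENNReal.ofReal (1 - t) • μ + ENNReal.ofReal t • σ with hν
    have hi1 := integrable_mixture (a := 1 - t) (b := t) hμ.finite.interaction hμσ
    have hi2 := integrable_mixture (a := 1 - t) (b := t) hσμ hσσ
    have hνν : Integrable (fun p : ℝ × ℝ => Real.log |p.1 - p.2|) (ν.prod ν) := by
      rw [hν, prod_mixture]; exact integrable_mixture hi1 hi2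
    have hEν : logEnergy ν = (1 - t) ^ 2 * E + 2 * t * (1 - t) * I + t ^ 2 * J := by
      rw [logEnergy, hν, prod_mixture, integral_mixture h1t ht0.le hi1 hi2,
        integral_mixture h1t ht0.le hμ.finite.interaction hμσ,
        integral_mixture h1t ht0.le hσμ hσσ, hIμ, ← logEnergy]
      ring
    have hνp : IsProbabilityMeasure ν := by
      constructor
      rw [hν, Measure.add_apply, Measure.smul_apply, Measure.smul_apply, measure_univ, measure_univ,
        smul_eq_mul, smul_eq_mul, mul_one, mul_one, ← ENNReal.ofReal_add h1t ht0.le]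
      simp
    have hνac : ν ≪ volume := by
      refine Measure.AbsolutelyContinuous.add_left (Measure.AbsolutelyContinuous.smul_left
        hμ.finite.absolutelyContinuous _) (Measure.AbsolutelyContinuous.smul_left ?_ _)
      exact Measure.AbsolutelyContinuous.smul_left Measure.absolutelyContinuous_restrict _
    have hmin := hμ.minimal ν ⟨hνp, hνac, integrable_mixture hμ.finite.potential hVσ, hνν, hent⟩
    rw [freeEnergy, freeEnergy, hEν, hν, integral_mixture h1t ht0.le hμ.finite.potential hVσ,
      ← hν] at hmin
    have h2 : t * ((∫ x, V x ∂μ) + ∫ x, Real.log (density μ x) ∂μ) ≤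
      t * ((∫ x, V x ∂σ) + Real.log (κ + t * s) -
        P * ((t - 2) * E + 2 * (1 - t) * I + t * J)) := by
      simp only [← hE] at hmin
      linear_combination hmin + hentle
    exact le_of_mul_le_mul_left h2 ht0
  have hlim : Tendsto (fun t => (∫ x, V x ∂σ) + Real.log (κ + t * s) -
      P * ((t - 2) * E + 2 * (1 - t) * I + t * J)) (𝓝[>] 0)
      (𝓝 ((∫ x, V x ∂σ) + Real.log (κ + 0 * s) -
        P * ((0 - 2) * E + 2 * (1 - 0) * I + 0 * J))) := by
    refine tendsto_nhdsWithin_of_tendsto_nhds (ContinuousAt.tendsto ?_)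
    have hc : ContinuousAt (fun t => Real.log (κ + t * s)) 0 :=
      ContinuousAt.log (by fun_prop) (by simpa using hκ0.ne')
    fun_prop
  have hle := ge_of_tendsto hlim (by
    filter_upwards [Ioo_mem_nhdsGT (zero_lt_one' ℝ)] with t ht using key t ht)
  have hsub : ∫ x, (V x - 2 * P * logPot μ x) ∂σ = (∫ x, V x ∂σ) - 2 * P * I := by
    rw [integral_sub hVσ (hUσ.const_mul _), integral_const_mul, hIU]
  rw [hsub, lagrange]
  simp only [zero_mul, add_zero] at hle
  linarith

/-- The set where the inequality fails is covered by countably many bounded sets A on which ρ < e^q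
and G + q < m, with q rational. On such a set of positive measure `lagrange_le` with κ = e^q would
give m ≤ mean of G + q < m. -/
lemma exp_lagrange_le_density (hμ : IsEquilibriumMeasure P V μ) (hV : Continuous V) :
    ∀ᵐ x, Real.exp (lagrange P V μ - (V x - 2 * P * logPot μ x)) ≤ density μ x := by
  have := hμ.finite.isProbabilityMeasure
  set m := lagrange P V μ
  set G : ℝ → ℝ := fun x => V x - 2 * P * logPot μ x with hG
  have hGm : Measurable G := hV.measurable.sub ((measurable_logPot μ).const_mul _)
  set A : ℚ → ℕ → Set ℝ := fun q R =>
    {x | density μ x < Real.exp q} ∩ {x | G x + q < m} ∩ Set.Icc (-R) R with hAdef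
  have hAm : ∀ q R, MeasurableSet (A q R) := fun q R =>
    ((measurableSet_lt (measurable_density μ) measurable_const).inter
      (measurableSet_lt (hGm.add_const _) measurable_const)).inter measurableSet_Icc
  have hA : ∀ q R, volume (A q R) = 0 := by
    intro q R
    by_contra h0
    have hAR : A q R ⊆ Set.Icc (-(R : ℝ)) R := Set.inter_subset_right
    have hA1 : volume (A q R) ≠ ⊤ := ((measure_mono hAR).trans_lt measure_Icc_lt_top).ne
    have := isProbabilityMeasure_uniformOn h0 hA1
    obtain ⟨hi, hle⟩ := lagrange_le hμ hV (hAm q R) h0 hAR (Real.exp_pos q)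
      (fun x hx => hx.1.1.le)
    rw [Real.log_exp] at hle
    have hi' : Integrable (fun x => m - q - G x) (uniformOn (A q R)) :=
      (integrable_const _).sub hi
    have hpos : 0 < ∫ x, (m - q - G x) ∂(uniformOn (A q R)) := by
      have hae : ∀ᵐ x ∂(uniformOn (A q R)), 0 < m - q - G x :=
        uniformOn_ae (hAm q R) (Eventually.of_forall fun x hx => by
          have : G x + q < m := hx.1.2
          linarith)
      rw [integral_pos_iff_support_of_nonneg_ae (hae.mono fun x hx => hx.le) hi']
      have : (uniformOn (A q R)) (Function.support fun x => m - q - G x) =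
          (uniformOn (A q R)) Set.univ :=
        measure_congr (by filter_upwards [hae] with x hx; exact eq_true (ne_of_gt hx))
      rw [this, measure_univ]; exact one_pos
    rw [integral_sub (integrable_const _) hi] at hpos
    simp only [integral_const, probReal_univ, one_smul] at hpos
    linarith
  have hnull : volume (⋃ q : ℚ, ⋃ R : ℕ, A q R) = 0 :=
    measure_iUnion_null fun q => measure_iUnion_null fun R => hA q R
  filter_upwards [measure_eq_zero_iff_ae_notMem.1 hnull] with x hx
  by_contra hlt
  push Not at hlt
  apply hx
  have : ∃ q : ℚ, density μ x < Real.exp q ∧ (q : ℝ) < m - G x := by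
    rcases (density_nonneg μ x).eq_or_lt with h | h
    · obtain ⟨q, hq⟩ := exists_rat_lt (m - G x)
      exact ⟨q, by rw [← h]; exact Real.exp_pos _, hq⟩
    · obtain ⟨q, hq1, hq2⟩ := exists_rat_btwn ((Real.log_lt_iff_lt_exp h).2 hlt)
      exact ⟨q, (Real.log_lt_iff_lt_exp h).1 hq1, hq2⟩
  obtain ⟨q, hq1, hq2⟩ := this
  obtain ⟨R, hR⟩ := exists_nat_ge |x|
  exact Set.mem_iUnion.2 ⟨q, Set.mem_iUnion.2 ⟨R, ⟨hq1, by
    change G x + q < m; linarith⟩, abs_le.1 hR⟩⟩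

/-- The one-sided bound suffices: G + log ρ - m is nonnegative μ-almost everywhere and, by the
definition of the multiplier m, has μ-integral zero. -/
theorem density_eq_exp (hμ : IsEquilibriumMeasure P V μ) (hV : Continuous V) :
    ∀ᵐ x, density μ x = Real.exp (lagrange P V μ - (V x - 2 * P * logPot μ x)) := by
  have := hμ.finite.isProbabilityMeasure
  set m := lagrange P V μ with hm
  set G : ℝ → ℝ := fun x => V x - 2 * P * logPot μ x with hG
  have hle := exp_lagrange_le_density hμ hV
  have hU : Integrable (logPot μ) μ := hμ.finite.interaction.integral_prod_left
  have hEU : logEnergy μ = ∫ x, logPot μ x ∂μ := by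
    rw [logEnergy, integral_prod _ hμ.finite.interaction]; rfl
  have hGi : Integrable G μ := hμ.finite.potential.sub (hU.const_mul _)
  have hint : ∫ x, (G x + Real.log (density μ x) - m) ∂μ = 0 := by
    have hi : Integrable (fun x => G x + Real.log (density μ x)) μ := hGi.add hμ.finite.entropy
    rw [integral_sub hi (integrable_const _),
      integral_add hGi hμ.finite.entropy, hG,
      integral_sub hμ.finite.potential (hU.const_mul _), integral_const_mul, ← hEU]
    simp only [integral_const, probReal_univ, one_smul]
    rw [hm, lagrange]; ring
  have hnn : 0 ≤ᵐ[μ] fun x => G x + Real.log (density μ x) - m := by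
    filter_upwards [hμ.finite.absolutelyContinuous.ae_le hle,
      density_pos_ae hμ.finite.absolutelyContinuous] with x h1 h2
    have := (Real.le_log_iff_exp_le h2).2 h1
    simp only [Pi.zero_apply]; linarith
  have heq := (integral_eq_zero_iff_of_nonneg_ae hnn
    ((hGi.add hμ.finite.entropy).sub (integrable_const _))).1 hint
  -- The lower bound makes the density positive almost everywhere, so equality μ-almost everywhere
  -- upgrades to Lebesgue-almost everywhere.
  have hvol : (volume : Measure ℝ) ≪ μ := by
    have hpos : ∀ᵐ x ∂(volume : Measure ℝ), μ.rnDeriv volume x ≠ 0 := by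
      filter_upwards [hle] with x hx h0
      rw [density, h0] at hx
      exact absurd hx (by simpa using Real.exp_pos _)
    have := withDensity_absolutelyContinuous' (μ := volume)
      (Measure.measurable_rnDeriv μ volume).aemeasurable hpos
    rwa [Measure.withDensity_rnDeriv_eq _ _ hμ.finite.absolutelyContinuous] at this
  filter_upwards [hvol.ae_le heq, hle] with x h1 h2
  have hpos := (Real.exp_pos _).trans_le h2
  simp only [Pi.zero_apply] at h1
  rw [← Real.exp_log hpos]
  congr 1; linarith

end Variation

/-! ### Regularity of the equilibrium density -/

/-- The continuous version of the density of the equilibrium measure. -/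
def eqDensity (P : ℝ) (V : ℝ → ℝ) (μ : Measure ℝ) (x : ℝ) : ℝ :=
  Real.exp (lagrange P V μ - (V x - 2 * P * logPot μ x))

lemma eqDensity_pos (P : ℝ) (V : ℝ → ℝ) (μ : Measure ℝ) (x : ℝ) : 0 < eqDensity P V μ x :=
  Real.exp_pos _

lemma exists_bound_of_eventually {g : ℝ → ℝ} (hg : Continuous g) {C : ℝ}
    (h : ∀ᶠ x in cocompact ℝ, g x ≤ C) : ∃ M, 0 < M ∧ ∀ x, g x ≤ M := by
  obtain ⟨K, hK, hKC⟩ := mem_cocompact.1 h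
  obtain ⟨B, hB⟩ := hK.bddAbove_image hg.continuousOn
  refine ⟨max 1 (max B C), by positivity, fun x => ?_⟩
  by_cases hx : x ∈ K
  · exact (hB (Set.mem_image_of_mem g hx)).trans ((le_max_left _ _).trans (le_max_right _ _))
  · exact (hKC hx : g x ≤ C).trans ((le_max_right _ _).trans (le_max_right _ _))

lemma exists_weighted_bound {h : ℝ → ℝ} (hc : Continuous h) {α : ℝ} (hα : 0 < α)
    (ho : h =o[cocompact ℝ] fun x => |x| ^ (-α)) :
    ∃ M, 0 < M ∧ ∀ x, (1 + |x|) ^ α * |h x| ≤ M := by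
  refine exists_bound_of_eventually (C := 2 ^ α)
    (((continuous_const.add continuous_abs).rpow_const fun x => Or.inr hα.le).mul hc.abs) ?_
  have h1 : ∀ᶠ x : ℝ in cocompact ℝ, 1 ≤ |x| := by
    have := tendsto_norm_cocompact_atTop (E := ℝ)
    exact this.eventually_ge_atTop 1
  filter_upwards [h1, ho.bound one_pos] with x hx hb
  have hx0 : 0 < |x| := by linarith
  rw [one_mul, Real.norm_eq_abs, Real.norm_of_nonneg (by positivity)] at hb
  calc (1 + |x|) ^ α * |h x| ≤ (2 * |x|) ^ α * |x| ^ (-α) := by gcongr; linarith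
    _ = 2 ^ α := by
      rw [Real.mul_rpow (by norm_num) hx0.le, mul_assoc, ← Real.rpow_add hx0]; simp

section

variable {P : ℝ} {V : ℝ → ℝ} {μ : Measure ℝ}

lemma logPot_le (hlog : Integrable (fun y => Real.log (1 + |y|)) μ) [IsProbabilityMeasure μ]
    (x : ℝ) : logPot μ x ≤ Real.log (1 + |x|) + ∫ y, Real.log (1 + |y|) ∂μ := by
  have hnn : 0 ≤ ∫ y, Real.log (1 + |y|) ∂μ := integral_nonneg fun y => log_one_add_abs_nonneg y
  by_cases hi : Integrable (fun y => Real.log |x - y|) μ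
  · have h1 : logPot μ x ≤ ∫ y, (Real.log (1 + |x|) + Real.log (1 + |y|)) ∂μ :=
      integral_mono hi ((integrable_const _).add hlog) fun y =>
        (log_abs_le_log_one_add _).trans (log_one_add_abs_sub_le x y)
    rw [integral_add (integrable_const _) hlog] at h1
    simpa using h1
  · rw [logPot, integral_undef hi]
    linarith [log_one_add_abs_nonneg x]

lemma rpow_one_add_eq_exp (x α : ℝ) : (1 + |x|) ^ α = Real.exp (α * Real.log (1 + |x|)) := by
  rw [Real.rpow_def_of_pos (by positivity), mul_comm]

/-- The potential grows at most like log (1 + |x|), so its exponential is polynomially bounded and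
is absorbed by the decay of e^{-V}. -/
lemma exists_exp_logPot_le [IsProbabilityMeasure μ] (hP : 0 < P)
    (hlog : Integrable (fun y => Real.log (1 + |y|)) μ) (m : ℝ) :
    ∃ C, 0 < C ∧ ∀ x, Real.exp (m + 2 * P * logPot μ x) ≤ C * (1 + |x|) ^ (2 * P) := by
  refine ⟨Real.exp (m + 2 * P * ∫ y, Real.log (1 + |y|) ∂μ), Real.exp_pos _, fun x => ?_⟩
  rw [rpow_one_add_eq_exp, ← Real.exp_add, Real.exp_le_exp]
  have := mul_le_mul_of_nonneg_left (logPot_le hlog x) (by linarith : 0 ≤ 2 * P)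
  linarith

lemma eqDensity_eq (x : ℝ) : eqDensity P V μ x =
    Real.exp (-V x) * Real.exp (lagrange P V μ + 2 * P * logPot μ x) := by
  rw [eqDensity, ← Real.exp_add]; congr 1; ring

lemma Admissible.exists_exp_bound (hV : Admissible V μ) (hP : 0 < P) :
    ∃ M, 0 < M ∧ ∀ x, (1 + |x|) ^ (2 * P) * Real.exp (-V x) ≤ M := by
  have h := hV.decay 1 (2 * P) 0 (by linarith)
  simp only [Polynomial.eval_one, one_mul] at h
  obtain ⟨M, hM, hb⟩ := exists_weighted_bound
    (Real.continuous_exp.comp hV.smooth.continuous.neg) (by linarith) h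
  exact ⟨M, hM, fun x => by simpa using hb x⟩

lemma Admissible.exists_deriv_exp_bound (hV : Admissible V μ) (hP : 0 < P) :
    ∃ M, 0 < M ∧ ∀ x, (1 + |x|) ^ (2 * P) * |deriv V x * Real.exp (-V x)| ≤ M := by
  have h := hV.decay Polynomial.X (2 * P) 1 (by linarith)
  simp only [Polynomial.eval_X, iteratedDeriv_one] at h
  exact exists_weighted_bound ((hV.smooth.continuous_deriv (by norm_num)).mul
    (Real.continuous_exp.comp hV.smooth.continuous.neg)) (by linarith) h

lemma exists_eqDensity_le (hμ : IsEquilibriumMeasure P V μ) (hV : Admissible V μ) (hP : 0 < P) :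
    ∃ M, 0 < M ∧ ∀ x, eqDensity P V μ x ≤ M := by
  have := hμ.finite.isProbabilityMeasure
  obtain ⟨C, hC, hCb⟩ := exists_exp_logPot_le hP
    (integrable_log_one_add_of_interaction hμ.finite.interaction) (lagrange P V μ)
  obtain ⟨M, hM, hMb⟩ := hV.exists_exp_bound hP
  refine ⟨C * M, by positivity, fun x => ?_⟩
  rw [eqDensity_eq]
  calc _ ≤ Real.exp (-V x) * (C * (1 + |x|) ^ (2 * P)) := by gcongr; exact hCb x
    _ = C * ((1 + |x|) ^ (2 * P) * Real.exp (-V x)) := by ring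
    _ ≤ C * M := by gcongr; exact hMb x

lemma measurable_eqDensity [SFinite μ] (hV : Continuous V) : Measurable (eqDensity P V μ) :=
  Real.measurable_exp.comp (measurable_const.sub
    (hV.measurable.sub ((measurable_logPot μ).const_mul _)))

lemma eq_withDensity (hμ : IsEquilibriumMeasure P V μ) (hV : Continuous V) :
    μ = volume.withDensity fun x => ENNReal.ofReal (eqDensity P V μ x) := by
  have := hμ.finite.isProbabilityMeasure
  conv_lhs => rw [← Measure.withDensity_rnDeriv_eq _ _ hμ.finite.absolutelyContinuous]
  refine withDensity_congr_ae ?_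
  filter_upwards [density_eq_exp hμ hV, ofReal_density_ae μ] with x h1 h2
  rw [← h2, h1]; rfl

lemma exists_le_smul_volume (hμ : IsEquilibriumMeasure P V μ) (hV : Admissible V μ) (hP : 0 < P) :
    ∃ M : ℝ≥0∞, M ≠ ⊤ ∧ μ ≤ M • volume := by
  obtain ⟨M, hM, hb⟩ := exists_eqDensity_le hμ hV hP
  refine ⟨ENNReal.ofReal M, ENNReal.ofReal_ne_top, ?_⟩
  rw [eq_withDensity hμ hV.smooth.continuous, ← withDensity_const]
  exact withDensity_mono (Eventually.of_forall fun x => ENNReal.ofReal_le_ofReal (hb x))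

lemma lintegral_eqDensity (hμ : IsEquilibriumMeasure P V μ) (hV : Continuous V) :
    ∫⁻ x, ENNReal.ofReal (eqDensity P V μ x) = 1 := by
  have := hμ.finite.isProbabilityMeasure
  have h : μ Set.univ = 1 := measure_univ
  rw [eq_withDensity hμ hV] at h
  simpa using h

lemma integrable_eqDensity (hμ : IsEquilibriumMeasure P V μ) (hV : Continuous V) :
    Integrable (eqDensity P V μ) := by
  have := hμ.finite.isProbabilityMeasure
  refine ⟨(measurable_eqDensity hV).aestronglyMeasurable, ?_⟩
  rw [hasFiniteIntegral_iff_ofReal (Eventually.of_forall fun x => (eqDensity_pos _ _ _ x).le),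
    lintegral_eqDensity hμ hV]
  exact ENNReal.one_lt_top

lemma integral_eqDensity (hμ : IsEquilibriumMeasure P V μ) (hV : Continuous V) :
    ∫ x, eqDensity P V μ x = 1 := by
  have := hμ.finite.isProbabilityMeasure
  rw [integral_eq_lintegral_of_nonneg_ae (Eventually.of_forall fun x => (eqDensity_pos _ _ _ x).le)
    (measurable_eqDensity hV).aestronglyMeasurable, lintegral_eqDensity hμ hV, ENNReal.toReal_one]

lemma integral_eq_integral_eqDensity (hμ : IsEquilibriumMeasure P V μ) (hV : Continuous V)
    (g : ℝ → ℝ) : ∫ y, g y ∂μ = ∫ y, eqDensity P V μ y * g y := by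
  have := hμ.finite.isProbabilityMeasure
  conv_lhs => rw [eq_withDensity hμ hV]
  rw [integral_withDensity_eq_integral_toReal_smul
    (measurable_eqDensity hV).ennreal_ofReal (Eventually.of_forall fun x => ENNReal.ofReal_lt_top)]
  simp [ENNReal.toReal_ofReal (eqDensity_pos _ _ _ _).le]

/-- The pointwise bound `abs_log_sub_log_le` is integrated against μ, the inverse square roots
having integrals bounded uniformly in their centre. -/
lemma exists_holder_logPot {M : ℝ≥0∞} [IsProbabilityMeasure μ] (hM : M ≠ ⊤)
    (hμM : μ ≤ M • volume) (hlog : Integrable (fun y => Real.log (1 + |y|)) μ) :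
    ∃ C, 0 < C ∧ ∀ x y, |logPot μ x - logPot μ y| ≤ C * √|x - y| := by
  set B := 1 + M.toReal * invSqrtMass
  have hB : 0 < B := by
    have := mul_nonneg (ENNReal.toReal_nonneg (a := M)) invSqrtMass_nonneg
    positivity
  refine ⟨4 * B, by positivity, fun x y => ?_⟩
  have hi := integrable_log_sub hμM hM hlog
  have hs := integrable_invSqrt_sub hμM hM
  have hne : ∀ x : ℝ, ∀ᵐ z ∂μ, x - z ≠ 0 := fun x => by
    have h0 : ∀ᵐ z ∂(volume : Measure ℝ), x - z ≠ 0 := by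
      filter_upwards [Measure.ae_ne volume x] with z hz
      exact sub_ne_zero.2 (Ne.symm hz)
    exact ((Measure.absolutelyContinuous_of_le hμM).trans
      Measure.smul_absolutelyContinuous).ae_le h0
  have hsb : ∀ x, ∫ z, invSqrt (x - z) ∂μ ≤ B := fun x => by
    simpa using integral_invSqrt_sub_le hμM hM x
  rw [logPot, logPot, ← integral_sub (hi x) (hi y)]
  calc |∫ z, (Real.log |x - z| - Real.log |y - z|) ∂μ|
      ≤ ∫ z, |Real.log |x - z| - Real.log (|y - z|)| ∂μ := abs_integral_le_integral_abs
    _ ≤ ∫ z, 2 * √|x - y| * (invSqrt (x - z) + invSqrt (y - z)) ∂μ := by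
        refine integral_mono_ae ((hi x).sub (hi y)).abs
          (((hs x).add (hs y)).const_mul _) ?_
        filter_upwards [hne x, hne y] with z h1 h2
        have := abs_log_sub_log_le h1 h2
        rwa [sub_sub_sub_cancel_right] at this
    _ = 2 * √|x - y| * (∫ z, invSqrt (x - z) ∂μ + ∫ z, invSqrt (y - z) ∂μ) := by
        rw [integral_const_mul, integral_add (hs x) (hs y)]
    _ ≤ 2 * √|x - y| * (B + B) := by gcongr <;> exact hsb _
    _ = 4 * B * √|x - y| := by ring

lemma abs_exp_sub_one_le' (a : ℝ) : |Real.exp a - 1| ≤ |a| * Real.exp |a| := by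
  have h1 := Real.add_one_le_exp (-a)
  have h2 := Real.add_one_le_exp a
  have h3 : Real.exp a * Real.exp (-a) = 1 := by rw [← Real.exp_add]; simp
  have h4 := Real.exp_pos a
  have h5 : Real.exp a ≤ Real.exp |a| := Real.exp_le_exp.2 (le_abs_self a)
  have h6 : 1 ≤ Real.exp |a| := Real.one_le_exp (abs_nonneg a)
  have h7 : Real.exp a - 1 ≤ a * Real.exp a := by nlinarith
  rw [abs_le]
  constructor
  · nlinarith [neg_abs_le a, abs_nonneg a]
  · nlinarith [le_abs_self a, abs_nonneg a, mul_le_mul_of_nonneg_right (le_abs_self a) h4.le,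
      mul_le_mul_of_nonneg_left h5 (abs_nonneg a)]

lemma le_sqrt_self {a : ℝ} (h0 : 0 ≤ a) (h1 : a ≤ 1) : a ≤ √a := by
  have := Real.sqrt_le_sqrt (by nlinarith : a ^ 2 ≤ a)
  rwa [Real.sqrt_sq h0] at this

/-- Two factors vary: e^{-V}, whose derivative beats the polynomial growth of exp (2P U), and exp
(2P U) itself, Hölder of exponent 1/2 through U. At distance at most 1 the Lipschitz part is also
dominated by the square root. This modulus is what makes the principal value converge absolutely. -/
lemma exists_holder_eqDensity (hμ : IsEquilibriumMeasure P V μ) (hV : Admissible V μ)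
    (hP : 0 < P) : ∃ C, 0 < C ∧ ∀ x y, |x - y| ≤ 1 →
      |eqDensity P V μ x - eqDensity P V μ y| ≤ C * √|x - y| := by
  have := hμ.finite.isProbabilityMeasure
  have hlog := integrable_log_one_add_of_interaction hμ.finite.interaction
  obtain ⟨M0, hM0, hμM⟩ := exists_le_smul_volume hμ hV hP
  obtain ⟨CU, hCU, hU⟩ := exists_holder_logPot hM0 hμM hlog
  obtain ⟨CW, hCW, hW⟩ := exists_exp_logPot_le hP hlog (lagrange P V μ)
  obtain ⟨M, hM, hMb⟩ := exists_eqDensity_le hμ hV hP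
  obtain ⟨D, hD, hDb⟩ := hV.exists_deriv_exp_bound hP
  set m := lagrange P V μ
  refine ⟨CW * 2 ^ (2 * P) * D + M * (2 * P * CU * Real.exp (2 * P * CU)), by positivity,
    fun x y hxy => ?_⟩
  set W : ℝ → ℝ := fun x => m + 2 * P * logPot μ x with hWdef
  have hsq : √|x - y| ≤ 1 := Real.sqrt_le_one.2 hxy
  have hle := le_sqrt_self (abs_nonneg _) hxy
  have hrep : eqDensity P V μ x - eqDensity P V μ y =
      (Real.exp (-V x) - Real.exp (-V y)) * Real.exp (W x) +
        eqDensity P V μ y * (Real.exp (W x - W y) - 1) := by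
    rw [eqDensity_eq, eqDensity_eq, Real.exp_sub]
    have := (Real.exp_pos (W y)).ne'
    field_simp
    ring
  have h1 : |Real.exp (-V x) - Real.exp (-V y)| * Real.exp (W x) ≤
      CW * 2 ^ (2 * P) * D * √|x - y| := by
    have hd : ∀ z ∈ Metric.closedBall x 1,
        ‖Real.exp (W x) * deriv (fun z => Real.exp (-V z)) z‖ ≤ CW * 2 ^ (2 * P) * D := by
      intro z hz
      have hVd : DifferentiableAt ℝ V z := (hV.smooth.differentiable (by norm_num)) z
      have e : deriv (fun z => Real.exp (-V z)) z = -(deriv V z * Real.exp (-V z)) := by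
        have := hVd.hasDerivAt.neg.exp.deriv
        simp only [Pi.neg_apply] at this
        rw [this]; ring
      rw [e, norm_mul, norm_neg, Real.norm_eq_abs, Real.norm_eq_abs, Real.abs_exp]
      have hxz : 1 + |x| ≤ 2 * (1 + |z|) := by
        rw [Metric.mem_closedBall, Real.dist_eq] at hz
        have := abs_sub_abs_le_abs_sub x z
        rw [abs_sub_comm] at hz
        linarith [abs_nonneg z]
      calc Real.exp (W x) * |deriv V z * Real.exp (-V z)|
          ≤ CW * (1 + |x|) ^ (2 * P) * |deriv V z * Real.exp (-V z)| := by gcongr; exact hW x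
        _ ≤ CW * (2 * (1 + |z|)) ^ (2 * P) * |deriv V z * Real.exp (-V z)| := by gcongr
        _ = CW * 2 ^ (2 * P) * ((1 + |z|) ^ (2 * P) * |deriv V z * Real.exp (-V z)|) := by
            rw [Real.mul_rpow (by norm_num) (by positivity)]; ring
        _ ≤ _ := by gcongr; exact hDb z
    have hdiff : ∀ z ∈ Metric.closedBall x 1, DifferentiableAt ℝ
        (fun z => Real.exp (W x) * Real.exp (-V z)) z := fun z _ =>
      (((hV.smooth.differentiable (by norm_num)) z).neg.exp).const_mul _
    have hmv := (convex_closedBall x 1).norm_image_sub_le_of_norm_deriv_le hdiff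
      (C := CW * 2 ^ (2 * P) * D) (fun z hz => by
        have he : DifferentiableAt ℝ (fun z => Real.exp (-V z)) z :=
          ((hV.smooth.differentiable (by norm_num)) z).neg.exp
        rw [deriv_const_mul _ he]
        exact hd z hz)
      (x := y) (y := x) (by rwa [Metric.mem_closedBall, Real.dist_eq, abs_sub_comm])
      (Metric.mem_closedBall_self zero_le_one)
    rw [← mul_sub, norm_mul, Real.norm_eq_abs, Real.norm_eq_abs, Real.norm_eq_abs,
      Real.abs_exp] at hmv
    rw [mul_comm]
    exact hmv.trans (by gcongr)
  have h2 : |Real.exp (W x - W y) - 1| ≤ 2 * P * CU * Real.exp (2 * P * CU) * √|x - y| := by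
    have hw : |W x - W y| ≤ 2 * P * CU * √|x - y| := by
      have : W x - W y = 2 * P * (logPot μ x - logPot μ y) := by simp only [hWdef]; ring
      rw [this, abs_mul, abs_of_pos (by linarith : 0 < 2 * P)]
      have := mul_le_mul_of_nonneg_left (hU x y) (by linarith : 0 ≤ 2 * P)
      linarith
    have hw' : |W x - W y| ≤ 2 * P * CU := hw.trans (mul_le_of_le_one_right (by positivity) hsq)
    calc _ ≤ |W x - W y| * Real.exp |W x - W y| := abs_exp_sub_one_le' _
      _ ≤ 2 * P * CU * √|x - y| * Real.exp (2 * P * CU) := by gcongr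
      _ = _ := by ring
  rw [hrep]
  refine (abs_add_le _ _).trans ?_
  rw [abs_mul, abs_mul, Real.abs_exp, abs_of_pos (eqDensity_pos _ _ _ _), add_mul, mul_assoc M]
  gcongr
  exact hMb y

end

/-! ### The Hilbert transform and the Lipschitz bound on the potential -/

/-- The absolutely integrable integrand of the Hilbert transform, obtained by subtracting the odd
function `ρ(x) / u` near `u = 0`. -/
def hilbertKernel (ρ : ℝ → ℝ) (x u : ℝ) : ℝ :=
  (ρ (x + u) - (Set.Icc (-1) 1).indicator (fun _ => ρ x) u) / u

section Kernel

variable {ρ : ℝ → ℝ} {C : ℝ}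

lemma measurable_hilbertKernel (hρ : Measurable ρ) (x : ℝ) : Measurable (hilbertKernel ρ x) :=
  ((hρ.comp (measurable_const_add x)).sub
    (measurable_const.indicator measurableSet_Icc)).div measurable_id

/-- An integrable majorant of the kernel of the Hilbert transform. -/
def hilbertBound (ρ : ℝ → ℝ) (C x u : ℝ) : ℝ :=
  (Set.Icc (-1) 1).indicator (fun u => C * invSqrt u) u + ρ (x + u)

lemma integrable_hilbertBound (hi : Integrable ρ) (x : ℝ) : Integrable (hilbertBound ρ C x) :=
  ((integrable_indicator_iff measurableSet_Icc).2 (integrableOn_invSqrt.const_mul C)).add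
    (hi.comp_add_left x)

lemma integral_hilbertBound (hi : Integrable ρ) (x : ℝ) :
    ∫ u, hilbertBound ρ C x u = C * invSqrtMass + ∫ u, ρ u := by
  unfold hilbertBound
  rw [integral_add ((integrable_indicator_iff measurableSet_Icc).2
    (integrableOn_invSqrt.const_mul C)) (hi.comp_add_left x), integral_indicator measurableSet_Icc,
    integral_const_mul, integral_add_left_eq_self (fun u => ρ u) x]
  rfl

/-- Near u = 0 the Hölder modulus gives C √|u| / |u|; for |u| > 1 division by u only decreases ρ (x
+ u). -/
lemma abs_hilbertKernel_le (hρ : ∀ x, 0 ≤ ρ x)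
    (hC : ∀ x y, |x - y| ≤ 1 → |ρ x - ρ y| ≤ C * √|x - y|) (x u : ℝ) :
    |hilbertKernel ρ x u| ≤ hilbertBound ρ C x u := by
  unfold hilbertKernel hilbertBound
  by_cases hu : u ∈ Set.Icc (-1 : ℝ) 1
  · rw [Set.indicator_of_mem hu, Set.indicator_of_mem hu, abs_div]
    rcases eq_or_ne u 0 with rfl | h0
    · simpa [invSqrt] using hρ x
    have h1 := hC (x + u) x (by simpa using abs_le.2 hu)
    rw [add_sub_cancel_left] at h1
    have hs : 0 < √|u| := Real.sqrt_pos.2 (abs_pos.2 h0)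
    have h2 : |ρ (x + u) - ρ x| / |u| ≤ C * invSqrt u := by
      rw [div_le_iff₀ (abs_pos.2 h0), invSqrt]
      refine h1.trans_eq ?_
      nth_rewrite 3 [← Real.mul_self_sqrt (abs_nonneg u)]
      field_simp
    linarith [hρ (x + u)]
  · rw [Set.indicator_of_notMem hu, Set.indicator_of_notMem hu, sub_zero, zero_add, abs_div,
      abs_of_nonneg (hρ _)]
    refine div_le_self (hρ _) ?_
    by_contra h
    push Not at h
    exact hu ⟨(abs_le.1 h.le).1, (abs_le.1 h.le).2⟩

lemma integrable_hilbertKernel (hm : Measurable ρ) (hρ : ∀ x, 0 ≤ ρ x)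
    (hC : ∀ x y, |x - y| ≤ 1 → |ρ x - ρ y| ≤ C * √|x - y|) (hi : Integrable ρ) (x : ℝ) :
    Integrable (hilbertKernel ρ x) :=
  (integrable_hilbertBound hi x).mono' (measurable_hilbertKernel hm x).aestronglyMeasurable
    (Eventually.of_forall fun u => abs_hilbertKernel_le hρ hC x u)

lemma abs_integral_hilbertKernel_le (hρ : ∀ x, 0 ≤ ρ x)
    (hC : ∀ x y, |x - y| ≤ 1 → |ρ x - ρ y| ≤ C * √|x - y|) (hi : Integrable ρ) {g : ℝ → ℝ}
    (hg : ∀ u, |g u| ≤ 1) (x : ℝ) :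
    |∫ u, g u * hilbertKernel ρ x u| ≤ C * invSqrtMass + ∫ u, ρ u := by
  rw [← integral_hilbertBound hi x, ← Real.norm_eq_abs]
  refine norm_integral_le_of_norm_le (integrable_hilbertBound hi x)
    (Eventually.of_forall fun u => ?_)
  rw [norm_mul, Real.norm_eq_abs, Real.norm_eq_abs]
  exact (mul_le_of_le_one_left (abs_nonneg _) (hg u)).trans (abs_hilbertKernel_le hρ hC x u)

lemma integral_eq_zero_of_odd {g : ℝ → ℝ} (hg : ∀ u, g (-u) = -g u) : ∫ u, g u = 0 := by
  have h := integral_neg_eq_self g volume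
  simp only [hg, integral_neg] at h
  linarith

/-- Against an even weight `g u`, the odd correction in the kernel integrates to zero. -/
lemma integral_mul_hilbertKernel {g : ℝ → ℝ} (hg : ∀ u, g (-u) = g u) {x : ℝ}
    (h1 : Integrable fun u => g u * (ρ (x + u) / u))
    (h2 : Integrable fun u => g u * hilbertKernel ρ x u) :
    ∫ u, g u * (ρ (x + u) / u) = ∫ u, g u * hilbertKernel ρ x u := by
  rw [← sub_eq_zero, ← integral_sub h1 h2]
  refine integral_eq_zero_of_odd fun u => ?_
  have e : (Set.Icc (-1 : ℝ) 1).indicator (fun _ => ρ x) (-u) =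
      (Set.Icc (-1 : ℝ) 1).indicator (fun _ => ρ x) u := by
    by_cases h : u ∈ Set.Icc (-1 : ℝ) 1
    · rw [Set.indicator_of_mem h, Set.indicator_of_mem
        (show -u ∈ Set.Icc (-1 : ℝ) 1 from ⟨by linarith [h.2], by linarith [h.1]⟩)]
    · rw [Set.indicator_of_notMem h, Set.indicator_of_notMem fun h' =>
        h ⟨by linarith [h'.2], by linarith [h'.1]⟩]
  simp only [hilbertKernel, hg, e]
  rcases eq_or_ne u 0 with rfl | h0
  · simp
  · field_simp; ring

/-- The truncation is an even weight, so the odd correction may be inserted for each δ; dominated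
convergence then removes the truncation. In particular the limit defining the principal value
exists, and `limUnder` is not a default value. -/
lemma tendsto_truncated (hm : Measurable ρ) (hρ : ∀ x, 0 ≤ ρ x)
    (hC : ∀ x y, |x - y| ≤ 1 → |ρ x - ρ y| ≤ C * √|x - y|) (hi : Integrable ρ) (x : ℝ) :
    Tendsto (fun δ => ∫ y in {y : ℝ | δ < |y - x|}, ρ y / (y - x)) (𝓝[>] (0 : ℝ))
      (𝓝 (∫ u, hilbertKernel ρ x u)) := by
  have hS : ∀ δ : ℝ, MeasurableSet {u : ℝ | δ < |u|} := fun δ =>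
    measurableSet_lt measurable_const measurable_id.abs
  have hkm := measurable_hilbertKernel hm x
  have hrep : ∀ δ > 0, ∫ y in {y : ℝ | δ < |y - x|}, ρ y / (y - x) =
      ∫ u, {u : ℝ | δ < |u|}.indicator 1 u * hilbertKernel ρ x u := by
    intro δ hδ
    have hgm : Measurable ({u : ℝ | δ < |u|}.indicator (1 : ℝ → ℝ)) :=
      measurable_one.indicator (hS δ)
    have hle : ∀ u, ‖{u : ℝ | δ < |u|}.indicator (1 : ℝ → ℝ) u‖ ≤ 1 := fun u => by
      by_cases h : u ∈ {u : ℝ | δ < |u|} <;> simp [h]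
    rw [← integral_mul_hilbertKernel]
    · rw [← integral_indicator (measurableSet_lt measurable_const (by fun_prop)),
        ← integral_add_left_eq_self _ x]
      refine integral_congr_ae (Eventually.of_forall fun u => ?_)
      by_cases h : δ < |u| <;> simp [Set.indicator, h]
    · intro u; simp [Set.indicator]
    · refine ((hi.comp_add_left x).const_mul δ⁻¹).mono' (hgm.mul
        ((hm.comp (measurable_const_add x)).div measurable_id)).aestronglyMeasurable
        (Eventually.of_forall fun u => ?_)
      by_cases h : δ < |u|
      · simp only [Set.indicator, Set.mem_ofPred_eq, h, if_true, Pi.one_apply, one_mul,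
          Real.norm_eq_abs, abs_div, abs_of_nonneg (hρ _)]
        rw [div_eq_inv_mul]
        exact mul_le_mul_of_nonneg_right (inv_anti₀ hδ h.le) (hρ _)
      · simp only [Set.indicator, Set.mem_ofPred_eq, h, if_false, zero_mul, norm_zero]
        exact mul_nonneg (inv_nonneg.2 hδ.le) (hρ _)
    · refine (integrable_hilbertKernel hm hρ hC hi x).bdd_mul hgm.aestronglyMeasurable
        (Eventually.of_forall hle)
  have hlim : Tendsto (fun δ : ℝ => ∫ u, {u : ℝ | δ < |u|}.indicator 1 u * hilbertKernel ρ x u)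
      (𝓝[>] (0 : ℝ)) (𝓝 (∫ u, hilbertKernel ρ x u)) := by
    refine tendsto_integral_filter_of_dominated_convergence (hilbertBound ρ C x)
      (Eventually.of_forall fun δ =>
        ((measurable_one.indicator (hS δ)).mul hkm).aestronglyMeasurable)
      (Eventually.of_forall fun δ => Eventually.of_forall fun u => ?_)
      (integrable_hilbertBound hi x) ?_
    · rw [norm_mul, Real.norm_eq_abs, Real.norm_eq_abs]
      refine (mul_le_of_le_one_left (abs_nonneg _) ?_).trans (abs_hilbertKernel_le hρ hC x u)
      by_cases h : u ∈ {u : ℝ | δ < |u|} <;> simp [h]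
    · filter_upwards [Measure.ae_ne volume (0 : ℝ)] with u hu
      refine tendsto_const_nhds.congr' ?_
      have : Set.Ioo (0 : ℝ) |u| ∈ 𝓝[>] (0 : ℝ) := Ioo_mem_nhdsGT (abs_pos.2 hu)
      filter_upwards [this] with δ hδ
      simp [Set.indicator, hδ.2]
  refine hlim.congr' ?_
  filter_upwards [self_mem_nhdsWithin] with δ hδ using (hrep δ hδ).symm

lemma hilbertTransform_eq {ρ' : ℝ → ℝ} (hm : Measurable ρ) (hρ : ∀ x, 0 ≤ ρ x)
    (hC : ∀ x y, |x - y| ≤ 1 → |ρ x - ρ y| ≤ C * √|x - y|) (hi : Integrable ρ)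
    (hae : ρ' =ᵐ[volume] ρ) (x : ℝ) :
    hilbertTransform ρ' x = ∫ u, hilbertKernel ρ x u := by
  refine ((tendsto_truncated hm hρ hC hi x).congr fun δ => ?_).limUnder_eq
  refine integral_congr_ae (ae_restrict_of_ae ?_)
  filter_upwards [hae] with y hy
  rw [hy]

end Kernel

section

variable {P : ℝ} {V : ℝ → ℝ} {μ : Measure ℝ}

/-- The potential of `μ` for the regularised logarithm. -/
def regPot (δ : ℝ) (μ : Measure ℝ) (x : ℝ) : ℝ := ∫ y, regLog δ (x - y) ∂μ

lemma abs_regLog_le {δ u : ℝ} (hδ : 0 < δ) (hδ1 : δ ≤ 1) :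
    |regLog δ u| ≤ Real.log (1 + |u|) - Real.log δ := by
  have h1 := log_le_regLog u hδ
  have h2 := regLog_le_log_one_add (u := u) hδ hδ1
  have h3 := log_one_add_abs_nonneg u
  have h4 := Real.log_nonpos hδ.le hδ1
  exact abs_le.2 ⟨by linarith, by linarith⟩

lemma integrable_regLog_sub [IsFiniteMeasure μ] {δ : ℝ} (hδ : 0 < δ) (hδ1 : δ ≤ 1)
    (hlog : Integrable (fun y => Real.log (1 + |y|)) μ) (x : ℝ) :
    Integrable (fun y => regLog δ (x - y)) μ := by
  refine (((integrable_const (Real.log (1 + |x|) - Real.log δ)).add hlog)).mono'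
    ((measurable_regLog δ).comp (measurable_const.sub measurable_id)).aestronglyMeasurable
    (Eventually.of_forall fun y => ?_)
  have h1 := abs_regLog_le (u := x - y) hδ hδ1
  have h2 := log_one_add_abs_sub_le x y
  simp only [Real.norm_eq_abs, Pi.add_apply]
  linarith

lemma hasDerivAt_regLog {δ : ℝ} (hδ : 0 < δ) (u : ℝ) :
    HasDerivAt (regLog δ) (u / (u ^ 2 + δ ^ 2)) u := by
  have hp : u ^ 2 + δ ^ 2 ≠ 0 := by positivity
  refine ((((hasDerivAt_pow 2 u).add_const (δ ^ 2)).log hp).div_const 2).congr_deriv ?_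
  field_simp; norm_num [mul_comm]

lemma abs_div_sq_add_le {δ : ℝ} (hδ : 0 < δ) (u : ℝ) : |u / (u ^ 2 + δ ^ 2)| ≤ δ⁻¹ := by
  have hp : 0 < u ^ 2 + δ ^ 2 := by positivity
  rw [abs_div, abs_of_pos hp, div_le_iff₀ hp, ← div_eq_inv_mul, le_div_iff₀ hδ]
  nlinarith [sq_nonneg (|u| - δ), sq_abs u, abs_nonneg u]

lemma hasDerivAt_regPot [IsFiniteMeasure μ] {δ : ℝ} (hδ : 0 < δ) (hδ1 : δ ≤ 1)
    (hlog : Integrable (fun y => Real.log (1 + |y|)) μ) (x : ℝ) :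
    HasDerivAt (regPot δ μ) (∫ y, (x - y) / ((x - y) ^ 2 + δ ^ 2) ∂μ) x := by
  refine (hasDerivAt_integral_of_dominated_loc_of_deriv_le (F := fun x y => regLog δ (x - y))
    (F' := fun x y => (x - y) / ((x - y) ^ 2 + δ ^ 2)) (bound := fun _ => δ⁻¹)
    (s := Set.univ) univ_mem
    (Eventually.of_forall fun z => (integrable_regLog_sub hδ hδ1 hlog z).aestronglyMeasurable)
    (integrable_regLog_sub hδ hδ1 hlog x) (Measurable.aestronglyMeasurable (by fun_prop))
    (Eventually.of_forall fun y z _ => abs_div_sq_add_le hδ _) (integrable_const _)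
    (Eventually.of_forall fun y z _ => ?_)).2
  have := (hasDerivAt_regLog hδ (z - y)).comp z ((hasDerivAt_id z).sub_const y)
  rw [mul_one] at this
  exact this

lemma tendsto_regPot [IsProbabilityMeasure μ]
    (hlog : Integrable (fun y => Real.log (1 + |y|)) μ)
    (hi : ∀ x, Integrable (fun y => Real.log |x - y|) μ) (hne : ∀ x : ℝ, ∀ᵐ y ∂μ, x ≠ y) (x : ℝ) :
    Tendsto (fun k : ℕ => regPot (1 / ((k : ℝ) + 1)) μ x) atTop (𝓝 (logPot μ x)) := by
  have hpos : ∀ k : ℕ, (0 : ℝ) < 1 / ((k : ℝ) + 1) := fun k => by positivity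
  have hle : ∀ k : ℕ, 1 / ((k : ℝ) + 1) ≤ 1 := fun k => by
    rw [div_le_one (by positivity)]; linarith [(Nat.cast_nonneg k : (0 : ℝ) ≤ k)]
  refine tendsto_integral_of_dominated_convergence
    (fun y => |Real.log (|x - y|)| + (Real.log (1 + |x|) + Real.log (1 + |y|)))
    (fun k => (integrable_regLog_sub (hpos k) (hle k) hlog x).aestronglyMeasurable)
    ((hi x).abs.add ((integrable_const _).add hlog)) (fun k => ?_) ?_
  · filter_upwards [hne x] with y hy
    have h1 := log_abs_le_regLog (η := 1 / ((k : ℝ) + 1)) (sub_ne_zero.2 hy)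
    have h2 := regLog_le_log_one_add (u := x - y) (hpos k) (hle k)
    have h3 := log_one_add_abs_sub_le x y
    have h4 := log_one_add_abs_nonneg x
    have h5 := log_one_add_abs_nonneg y
    have h6 := neg_abs_le (Real.log |x - y|)
    have h7 := abs_nonneg (Real.log |x - y|)
    rw [Real.norm_eq_abs, abs_le]
    constructor <;> linarith
  · filter_upwards [hne x] with y hy
    have hc : ContinuousAt (fun δ => regLog δ (x - y)) 0 := by
      unfold regLog
      refine (ContinuousAt.log (by fun_prop) ?_).div_const _
      have := sub_ne_zero.2 hy
      positivity
    have := hc.tendsto.comp tendsto_one_div_add_atTop_nhds_zero_nat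
    rwa [regLog_zero_left] at this

/-- The potential of the equilibrium measure is Lipschitz, with the supremum norm of the Hilbert
transform of the density as a constant. -/
theorem abs_logPot_sub_le (hμ : IsEquilibriumMeasure P V μ) (hV : Admissible V μ) (hP : 0 < P)
    (a b : ℝ) : |logPot μ b - logPot μ a| ≤
      (eLpNorm (hilbertTransform (density μ)) ⊤ volume).toReal * |b - a| := by
  have := hμ.finite.isProbabilityMeasure
  have hlog := integrable_log_one_add_of_interaction hμ.finite.interaction
  obtain ⟨M0, hM0, hμM⟩ := exists_le_smul_volume hμ hV hP
  obtain ⟨C, hC0, hC⟩ := exists_holder_eqDensity hμ hV hP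
  set ρ := eqDensity P V μ with hρdef
  have hρ : ∀ x, 0 ≤ ρ x := fun x => (eqDensity_pos _ _ _ x).le
  have hm : Measurable ρ := measurable_eqDensity hV.smooth.continuous
  have hi : Integrable ρ := integrable_eqDensity hμ hV.smooth.continuous
  have hi1 : ∫ x, ρ x = 1 := integral_eqDensity hμ hV.smooth.continuous
  have hne : ∀ x : ℝ, ∀ᵐ y ∂μ, x ≠ y := fun x => by
    filter_upwards [((Measure.absolutelyContinuous_of_le hμM).trans
      Measure.smul_absolutelyContinuous).ae_le (Measure.ae_ne volume x)] with y hy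
    exact hy.symm
  have hH : ∀ x, hilbertTransform (density μ) x = ∫ u, hilbertKernel ρ x u :=
    hilbertTransform_eq hm hρ hC hi (density_eq_exp hμ hV.smooth.continuous)
  set B := C * invSqrtMass + 1 with hB
  have hHB : ∀ x, |hilbertTransform (density μ) x| ≤ B := fun x => by
    have := abs_integral_hilbertKernel_le hρ hC hi (g := fun _ => 1) (by simp) x
    rw [hH, hB, ← hi1]; simpa using this
  -- Finiteness matters: otherwise `toReal` would send the norm to 0 and the Lipschitz constant
  -- would be meaningless.
  have hfin : eLpNorm (hilbertTransform (density μ)) ⊤ volume ≠ ⊤ := by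
    rw [eLpNorm_exponent_top]
    refine ne_top_of_le_ne_top (ENNReal.ofReal_ne_top (r := B))
      (eLpNormEssSup_le_of_ae_bound (Eventually.of_forall fun x => ?_))
    rw [Real.norm_eq_abs]; exact hHB x
  have hae : ∀ᵐ x, ‖hilbertTransform (density μ) x‖ ≤
      (eLpNorm (hilbertTransform (density μ)) ⊤ volume).toReal := by
    filter_upwards [enorm_ae_le_eLpNormEssSup (hilbertTransform (density μ)) volume] with x hx
    rw [eLpNorm_exponent_top] at hfin ⊢
    rw [← toReal_enorm]
    exact ENNReal.toReal_mono hfin hx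
  set w : ℝ → ℝ → ℝ := fun δ u => u ^ 2 / (u ^ 2 + δ ^ 2) with hw
  have hw1 : ∀ δ > 0, ∀ u, |w δ u| ≤ 1 := fun δ hδ u => by
    have hp : 0 < u ^ 2 + δ ^ 2 := by positivity
    rw [hw, abs_of_nonneg (by positivity), div_le_one hp]
    nlinarith
  have hwm : ∀ δ, Measurable (w δ) := fun δ => by fun_prop
  -- The smooth factor u²/(u² + δ²) plays the role of the truncation: it is even, bounded by 1 and
  -- tends to 1, so the derivative of the regularised potential converges to minus the Hilbert
  -- transform.
  have hderiv : ∀ δ, 0 < δ → δ ≤ 1 → ∀ x,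
      HasDerivAt (regPot δ μ) (-∫ u, w δ u * hilbertKernel ρ x u) x := by
    intro δ hδ hδ1 x
    convert hasDerivAt_regPot hδ hδ1 hlog x using 1
    rw [integral_eq_integral_eqDensity hμ hV.smooth.continuous,
      ← hρdef, ← integral_add_left_eq_self
        (fun y => ρ y * ((x - y) / ((x - y) ^ 2 + δ ^ 2))) x]
    have e : ∀ u, ρ (x + u) * ((x - (x + u)) / ((x - (x + u)) ^ 2 + δ ^ 2)) =
        -(w δ u * (ρ (x + u) / u)) := fun u => by
      rcases eq_or_ne u 0 with rfl | h0
      · simp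
      · have hp : u ^ 2 + δ ^ 2 ≠ 0 := by positivity
        rw [hw, show x - (x + u) = -u by ring, neg_sq]
        field_simp
    rw [integral_congr_ae (Eventually.of_forall e), integral_neg, integral_mul_hilbertKernel]
    · intro u; simp [hw]
    · have h2 : Integrable (fun u => u / (u ^ 2 + δ ^ 2) * ρ (x + u)) :=
        (hi.comp_add_left x).bdd_mul (Measurable.aestronglyMeasurable (by fun_prop))
          (Eventually.of_forall fun u => abs_div_sq_add_le hδ u)
      refine h2.congr (Eventually.of_forall fun u => ?_)
      rcases eq_or_ne u 0 with rfl | h0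
      · simp
      · simp only [hw]; field_simp
    · exact (integrable_hilbertKernel hm hρ hC hi x).bdd_mul
        (hwm δ).aestronglyMeasurable (Eventually.of_forall (hw1 δ hδ))
  have hpos : ∀ k : ℕ, (0 : ℝ) < 1 / ((k : ℝ) + 1) := fun k => by positivity
  have hle : ∀ k : ℕ, 1 / ((k : ℝ) + 1) ≤ 1 := fun k => by
    rw [div_le_one (by positivity)]; linarith [(Nat.cast_nonneg k : (0 : ℝ) ≤ k)]
  set h : ℕ → ℝ → ℝ := fun k x => -∫ u, w (1 / ((k : ℝ) + 1)) u * hilbertKernel ρ x u with hh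
  have hhm : ∀ k, Measurable (h k) := fun k => by
    have : h k = deriv (regPot (1 / ((k : ℝ) + 1)) μ) :=
      funext fun x => (hderiv _ (hpos k) (hle k) x).deriv.symm
    rw [this]; exact measurable_deriv _
  have hhB : ∀ k x, ‖h k x‖ ≤ B := fun k x => by
    have := abs_integral_hilbertKernel_le hρ hC hi (hw1 _ (hpos k)) x
    rw [hi1] at this
    rwa [hh, norm_neg, Real.norm_eq_abs, hB]
  have hftc : ∀ k : ℕ, ∫ x in a..b, h k x =
      regPot (1 / ((k : ℝ) + 1)) μ b - regPot (1 / ((k : ℝ) + 1)) μ a := fun k =>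
    intervalIntegral.integral_eq_sub_of_hasDerivAt (fun x _ => hderiv _ (hpos k) (hle k) x)
      ((intervalIntegrable_const (c := B)).mono_fun' (hhm k).aestronglyMeasurable
        (Eventually.of_forall (hhB k)))
  -- The limit δ = 1/(k+1) → 0 is taken in the integrated identity, in two ways. This yields U(b) -
  -- U(a) = -∫ H[ρ] over [a, b] without differentiating U.
  have hlim1 : Tendsto (fun k : ℕ => ∫ x in a..b, h k x) atTop
      (𝓝 (logPot μ b - logPot μ a)) := by
    simp only [hftc]
    exact (tendsto_regPot hlog (integrable_log_sub hμM hM0 hlog) hne b).sub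
      (tendsto_regPot hlog (integrable_log_sub hμM hM0 hlog) hne a)
  have hlim2 : Tendsto (fun k : ℕ => ∫ x in a..b, h k x) atTop
      (𝓝 (∫ x in a..b, -hilbertTransform (density μ) x)) := by
    refine intervalIntegral.tendsto_integral_filter_of_dominated_convergence (fun _ => B)
      (Eventually.of_forall fun k => (hhm k).aestronglyMeasurable)
      (Eventually.of_forall fun k => Eventually.of_forall fun x _ => hhB k x)
      intervalIntegrable_const (Eventually.of_forall fun x _ => ?_)
    rw [hH]
    refine Tendsto.neg ?_
    refine tendsto_integral_of_dominated_convergence (hilbertBound ρ C x)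
      (fun k => ((hwm _).mul (measurable_hilbertKernel hm x)).aestronglyMeasurable)
      (integrable_hilbertBound hi x) (fun k => Eventually.of_forall fun u => ?_) ?_
    · rw [norm_mul, Real.norm_eq_abs, Real.norm_eq_abs]
      exact (mul_le_of_le_one_left (abs_nonneg _) (hw1 _ (hpos k) u)).trans
        (abs_hilbertKernel_le hρ hC x u)
    · filter_upwards [Measure.ae_ne volume (0 : ℝ)] with u hu
      have hc : ContinuousAt (fun δ => w δ u * hilbertKernel ρ x u) 0 := by
        simp only [hw]
        have h0 : u ^ 2 + (0 : ℝ) ^ 2 ≠ 0 := by positivity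
        refine ContinuousAt.mul (ContinuousAt.div₀ (by fun_prop) (by fun_prop) h0) (by fun_prop)
      have := hc.tendsto.comp tendsto_one_div_add_atTop_nhds_zero_nat
      have h1 : w 0 u = 1 := by simp only [hw]; field_simp; simp
      rwa [h1, one_mul] at this
  rw [tendsto_nhds_unique hlim1 hlim2, ← Real.norm_eq_abs]
  refine intervalIntegral.norm_integral_le_of_norm_le_const_ae ?_
  filter_upwards [hae] with x hx _
  rwa [norm_neg]

end

/-! ### Comparison of the potential with its regularisation -/

/-- The interval `(-π/2, π/2]` of angles. -/
def angles : Set ℝ := Set.Ioc (-(Real.pi / 2)) (Real.pi / 2)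

lemma measurable_tan : Measurable Real.tan := by
  have : Real.tan = fun x => Real.sin x / Real.cos x := funext Real.tan_eq_sin_div_cos
  rw [this]; fun_prop

instance : IsFiniteMeasure (volume.restrict angles) :=
  ⟨by rw [Measure.restrict_apply_univ, angles]; exact measure_Ioc_lt_top⟩

lemma restrict_le_one_smul (s : Set ℝ) : (volume.restrict s : Measure ℝ) ≤ (1 : ℝ≥0∞) • volume := by
  rw [one_smul]; exact Measure.restrict_le_self

/-- Jordan's inequality bounds cos θ below linearly near ±π/2, leaving an inverse square root
singularity. A Cauchy variable has a moment of order 1/2 but no mean, so a plain Lipschitz bound on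
the potential could not be averaged. -/
lemma integrable_sqrt_tan : Integrable (fun θ => √|Real.tan θ|) (volume.restrict angles) := by
  have h1 := integrable_invSqrt_sub (restrict_le_one_smul angles) ENNReal.one_ne_top (Real.pi / 2)
  have h2 := integrable_invSqrt_sub (restrict_le_one_smul angles) ENNReal.one_ne_top
    (-(Real.pi / 2))
  refine ((h1.add h2).const_mul √(Real.pi / 2)).mono'
    (measurable_tan.abs.sqrt).aestronglyMeasurable ?_
  rw [angles, ae_restrict_iff' measurableSet_Ioc]
  filter_upwards [Measure.ae_ne volume (Real.pi / 2)] with θ hne hθ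
  have hpi := Real.pi_pos
  have hlt : θ < Real.pi / 2 := lt_of_le_of_ne hθ.2 hne
  set a := Real.pi / 2 - |θ| with ha
  have ha0 : 0 < a := by
    rw [ha, sub_pos, abs_lt]; exact ⟨hθ.1, hlt⟩
  have hcos : 2 / Real.pi * a ≤ Real.cos θ := by
    rw [← Real.cos_abs, ← Real.sin_pi_div_two_sub]
    exact Real.mul_le_sin ha0.le (by linarith [abs_nonneg θ])
  have hc0 : 0 < 2 / Real.pi * a := by positivity
  have hc : 0 < Real.cos θ := hc0.trans_le hcos
  have hpos : |Real.tan θ| ≤ Real.pi / 2 * a⁻¹ := by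
    rw [Real.tan_eq_sin_div_cos, abs_div, abs_of_pos hc, div_le_iff₀ hc]
    calc |Real.sin θ| ≤ 1 := Real.abs_sin_le_one _
      _ = Real.pi / 2 * a⁻¹ * (2 / Real.pi * a) := by field_simp
      _ ≤ _ := by gcongr
  have h3 : √|Real.tan θ| ≤ √(Real.pi / 2) * invSqrt a := by
    rw [invSqrt, abs_of_pos ha0, ← Real.sqrt_inv, ← Real.sqrt_mul (by positivity)]
    exact Real.sqrt_le_sqrt hpos
  have h4 : invSqrt a ≤ invSqrt (Real.pi / 2 - θ) + invSqrt (-(Real.pi / 2) - θ) := by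
    rcases le_total 0 θ with h | h
    · rw [ha, abs_of_nonneg h]; linarith [invSqrt_nonneg (-(Real.pi / 2) - θ)]
    · rw [ha, abs_of_nonpos h, ← invSqrt_neg]
      rw [show -(Real.pi / 2 - -θ) = -(Real.pi / 2) - θ by ring]
      linarith [invSqrt_nonneg (Real.pi / 2 - θ)]
  rw [Real.norm_of_nonneg (Real.sqrt_nonneg _)]
  exact h3.trans (mul_le_mul_of_nonneg_left h4 (Real.sqrt_nonneg _))

lemma integrable_log_tan :
    Integrable (fun θ => Real.log (1 + |Real.tan θ|)) (volume.restrict angles) := by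
  have h := (integral_regLog_poisson one_pos 0).1
  rw [intervalIntegrable_iff_integrableOn_Ioc_of_le (by linarith [Real.pi_pos])] at h
  refine ((integrable_const (Real.log 2)).add h.abs).mono'
    (Real.measurable_log.comp (measurable_const.add measurable_tan.abs)).aestronglyMeasurable
    (Eventually.of_forall fun θ => ?_)
  have := log_one_add_abs_le (Real.tan θ)
  rw [Real.norm_of_nonneg (log_one_add_abs_nonneg _)]
  simpa using this

section

variable {μ : Measure ℝ} [IsProbabilityMeasure μ] {M : ℝ≥0∞} {K η : ℝ}

/-- Poisson's formula for a single logarithm is integrated against μ. Fubini applies because the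
Cauchy law has a logarithmic moment and μ has a bounded density. -/
lemma regPot_eq_integral_logPot (hM : M ≠ ⊤) (hμM : μ ≤ M • volume)
    (hlog : Integrable (fun y => Real.log (1 + |y|)) μ) (hη : 0 < η) (hη1 : η ≤ 1) (x : ℝ) :
    Integrable (fun θ => logPot μ (x - η * Real.tan θ)) (volume.restrict angles) ∧
    ∫ θ in angles, logPot μ (x - η * Real.tan θ) = Real.pi * regPot η μ x := by
  have hfm : Measurable fun θ => x - η * Real.tan θ :=
    measurable_const.sub (measurable_tan.const_mul _)
  set α := Measure.map (fun θ => x - η * Real.tan θ) (volume.restrict angles) with hα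
  have hαfin : IsFiniteMeasure α := Measure.isFiniteMeasure_map _ _
  have hαlog : Integrable (fun y => Real.log (1 + |y|)) α := by
    rw [hα, integrable_map_measure (Measurable.aestronglyMeasurable (by fun_prop)) hfm.aemeasurable]
    refine ((integrable_const (Real.log (1 + |x|))).add integrable_log_tan).mono'
      (Measurable.aestronglyMeasurable (Measurable.comp (by fun_prop) hfm))
      (Eventually.of_forall fun θ => ?_)
    rw [Function.comp_apply, Real.norm_of_nonneg (log_one_add_abs_nonneg _)]
    refine (log_one_add_abs_sub_le _ _).trans ?_
    have h1 : |η * Real.tan θ| ≤ |Real.tan θ| := by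
      rw [abs_mul, abs_of_pos hη]
      exact mul_le_of_le_one_left (abs_nonneg _) hη1
    have h2 := Real.log_le_log (by positivity) (by linarith : 1 + |η * Real.tan θ| ≤ 1 + |Real.tan θ|)
    simp only [Pi.add_apply]
    linarith
  have hi := integrable_log_prod hμM hM hαlog hlog
  have hUm := measurable_logPot μ
  have hU : Integrable (logPot μ) α := hi.integral_prod_left
  refine ⟨(integrable_map_measure hUm.aestronglyMeasurable hfm.aemeasurable).1 hU, ?_⟩
  rw [← integral_map (f := logPot μ) hfm.aemeasurable hUm.aestronglyMeasurable, ← hα]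
  unfold logPot regPot
  rw [integral_integral_swap hi, ← integral_const_mul]
  refine integral_congr_ae (Eventually.of_forall fun y => ?_)
  simp only
  rw [← (integral_regLog_poisson hη (x - y)).2, hα, integral_map hfm.aemeasurable
    (Measurable.aestronglyMeasurable (by fun_prop)),
    intervalIntegral.integral_of_le (by linarith [Real.pi_pos])]
  refine integral_congr_ae (Eventually.of_forall fun θ => ?_)
  simp only
  rw [sub_right_comm]

lemma log_one_add_sub_log_le {u : ℝ} (hu : u ≠ 0) :
    Real.log (1 + |u|) - Real.log |u| ≤ Real.log 2 + 2 * invSqrt u := by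
  have hu' := abs_pos.2 hu
  rcases le_total |u| 1 with h | h
  · have := Real.log_le_log (by positivity) (by linarith : 1 + |u| ≤ 2)
    linarith [neg_log_abs_le u]
  · have := Real.log_le_log (by positivity) (by linarith : 1 + |u| ≤ 2 * |u|)
    rw [Real.log_mul (by norm_num) (by linarith)] at this
    linarith [invSqrt_nonneg u]

/-- The absolute constant in the bound on the oscillation of a Lipschitz potential. -/
def oscConst : ℝ := 2 * Real.log 2 + 2 * (1 + invSqrtMass)

lemma oscConst_nonneg : 0 ≤ oscConst := by
  have := invSqrtMass_nonneg
  have := Real.log_nonneg (by norm_num : (1 : ℝ) ≤ 2)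
  unfold oscConst; positivity

/-- Both values are compared with Λ = ∫ log (1 + |x - y|) dμ(y). From above this is subadditivity.
From below U may be negative and large at x, but the Lipschitz bound replaces U(x) by its mean over
[x, x + 1], and there the singularity is integrated against Lebesgue measure. The bound M on the
density of μ therefore does not enter the constant. -/
lemma logPot_sub_le_add_log (hM : M ≠ ⊤) (hμM : μ ≤ M • volume)
    (hlog : Integrable (fun y => Real.log (1 + |y|)) μ) (hK0 : 0 ≤ K)
    (hK : ∀ a b, |logPot μ b - logPot μ a| ≤ K * |b - a|) (x z : ℝ) :
    logPot μ (x - z) - logPot μ x ≤ K + oscConst + Real.log (1 + |z|) := by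
  set α : Measure ℝ := volume.restrict (Set.Icc x (x + 1)) with hα
  have hαp : IsProbabilityMeasure α := ⟨by simp [hα]⟩
  have hαlog : Integrable (fun y => Real.log (1 + |y|)) α :=
    Continuous.integrableOn_Icc
      ((continuous_const.add continuous_abs).log fun x => (by positivity : 1 + |x| ≠ 0))
  have hi := integrable_log_prod hμM hM hαlog hlog
  have hlogx : Integrable (fun y => Real.log (1 + |x - y|)) μ := by
    refine ((integrable_const (Real.log (1 + |x|))).add hlog).mono'
      (Measurable.aestronglyMeasurable (by fun_prop)) (Eventually.of_forall fun y => ?_)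
    rw [Real.norm_of_nonneg (log_one_add_abs_nonneg _)]
    exact log_one_add_abs_sub_le x y
  set Λ := ∫ y, Real.log (1 + |x - y|) ∂μ with hΛ
  have h1 : ∫ v, logPot μ v ∂α ≤ logPot μ x + K := by
    have : ∫ v, logPot μ v ∂α ≤ ∫ _, (logPot μ x + K) ∂α := by
      refine integral_mono_ae hi.integral_prod_left (integrable_const _) ?_
      rw [EventuallyLE, hα, ae_restrict_iff' measurableSet_Icc]
      refine Eventually.of_forall fun v hv => ?_
      have h2 := (abs_le.1 (hK x v)).2
      have h3 : |v - x| ≤ 1 := by rw [abs_le]; constructor <;> linarith [hv.1, hv.2]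
      nlinarith
    simpa using this
  have h2 : Λ - oscConst ≤ ∫ v, logPot μ v ∂α := by
    unfold logPot
    rw [integral_integral_swap hi]
    have e : Λ - oscConst = ∫ y, (Real.log (1 + |x - y|) - oscConst) ∂μ := by
      rw [integral_sub hlogx (integrable_const _)]; simp [hΛ]
    rw [e]
    refine integral_mono_ae (hlogx.sub (integrable_const _)) hi.integral_prod_right ?_
    filter_upwards [hi.prod_left_ae] with y hy
    have hs := integrable_invSqrt_sub (restrict_le_one_smul (Set.Icc x (x + 1)))
      ENNReal.one_ne_top y
    have hsb := integral_invSqrt_sub_le (restrict_le_one_smul (Set.Icc x (x + 1)))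
      ENNReal.one_ne_top y
    rw [← hα] at hs hsb
    simp only [probReal_univ, ENNReal.toReal_one, one_mul] at hsb
    -- One log 2 comes from comparing log (1 + |v - y|) with log |v - y|, the other from moving v to
    -- x at distance at most 1.
    have h5 : ∫ v, (Real.log (1 + |x - y|) - 2 * Real.log 2 - 2 * invSqrt (y - v)) ∂α ≤
        ∫ v, Real.log |v - y| ∂α := by
      refine integral_mono_ae ((integrable_const _).sub (hs.const_mul 2)) hy ?_
      rw [EventuallyLE, hα, ae_restrict_iff' measurableSet_Icc]
      filter_upwards [Measure.ae_ne volume y] with v hv hvI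
      have h6 := log_one_add_sub_log_le (sub_ne_zero.2 hv)
      rw [← invSqrt_neg, neg_sub] at h6
      have h7 : |x - y| ≤ 1 + |v - y| := by
        have : |x - v| ≤ 1 := by rw [abs_le]; constructor <;> linarith [hvI.1, hvI.2]
        have := abs_sub_le x v y
        linarith
      have h8 := Real.log_le_log (by positivity)
        (by linarith [abs_nonneg (v - y)] : 1 + |x - y| ≤ 2 * (1 + |v - y|))
      rw [Real.log_mul (by norm_num) (by positivity)] at h8
      linarith
    rw [integral_sub (integrable_const _) (hs.const_mul 2), integral_const_mul] at h5
    simp only [integral_const, probReal_univ, one_smul] at h5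
    rw [oscConst]
    linarith
  have h3 : logPot μ (x - z) ≤ Λ + Real.log (1 + |z|) := by
    have : logPot μ (x - z) ≤ ∫ y, (Real.log (1 + |x - y|) + Real.log (1 + |z|)) ∂μ := by
      refine integral_mono (integrable_log_sub hμM hM hlog _) (hlogx.add (integrable_const _))
        fun y => (log_abs_le_log_one_add _).trans ?_
      rw [sub_right_comm]
      exact log_one_add_abs_sub_le _ _
    rw [integral_add hlogx (integrable_const _)] at this
    simpa [hΛ] using this
  linarith

/-- The Lipschitz bound for |z| ≤ 1 and the logarithmic bound for |z| ≥ 1 are both dominated by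
√|z|, a modulus that is integrable against a Cauchy law and depends on μ only through K. -/
lemma logPot_sub_le_sqrt (hM : M ≠ ⊤) (hμM : μ ≤ M • volume)
    (hlog : Integrable (fun y => Real.log (1 + |y|)) μ) (hK0 : 0 ≤ K)
    (hK : ∀ a b, |logPot μ b - logPot μ a| ≤ K * |b - a|) (x z : ℝ) :
    logPot μ (x - z) - logPot μ x ≤ (oscConst + 2) * (1 + K) * √|z| := by
  have hosc := oscConst_nonneg
  rcases le_total |z| 1 with h | h
  · have h1 := (abs_le.1 (hK x (x - z))).2
    rw [sub_sub_cancel_left, abs_neg] at h1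
    have h2 := le_sqrt_self (abs_nonneg z) h
    have h3 := mul_le_mul_of_nonneg_left h2 hK0
    nlinarith [Real.sqrt_nonneg |z|, mul_nonneg hK0 (Real.sqrt_nonneg |z|),
      mul_nonneg hosc (Real.sqrt_nonneg |z|),
      mul_nonneg (mul_nonneg hosc hK0) (Real.sqrt_nonneg |z|)]
  · have h1 := logPot_sub_le_add_log hM hμM hlog hK0 hK x z
    have hs : 1 ≤ √|z| := by rwa [Real.one_le_sqrt]
    have h2 := Real.log_le_log (by positivity) (by linarith : 1 + |z| ≤ 2 * |z|)
    rw [Real.log_mul (by norm_num) (by linarith)] at h2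
    have h3 := Real.log_le_sub_one_of_pos (by linarith : 0 < √|z|)
    rw [Real.log_sqrt (abs_nonneg z)] at h3
    have h4 := Real.log_le_sub_one_of_pos (by norm_num : (0 : ℝ) < 2)
    have h5 : Real.log (1 + |z|) ≤ 2 * √|z| := by linarith
    nlinarith [mul_le_mul_of_nonneg_left hs hK0, mul_le_mul_of_nonneg_left hs hosc,
      mul_nonneg hosc hK0, mul_nonneg (mul_nonneg hosc hK0) (Real.sqrt_nonneg |z|)]

/-- The absolute constant in the comparison of the potential with its regularisation. -/
def regConst : ℝ := (oscConst + 2) * (∫ θ in angles, √|Real.tan θ|) / Real.pi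

lemma regConst_nonneg : 0 ≤ regConst := by
  have := oscConst_nonneg
  have : 0 ≤ ∫ θ in angles, √|Real.tan θ| := integral_nonneg fun _ => Real.sqrt_nonneg _
  unfold regConst; positivity

theorem regPot_sub_logPot_le (hM : M ≠ ⊤) (hμM : μ ≤ M • volume)
    (hlog : Integrable (fun y => Real.log (1 + |y|)) μ) (hK0 : 0 ≤ K)
    (hK : ∀ a b, |logPot μ b - logPot μ a| ≤ K * |b - a|) (hη : 0 < η) (hη1 : η ≤ 1) (x : ℝ) :
    regPot η μ x - logPot μ x ≤ regConst * (1 + K) * √η := by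
  obtain ⟨hi, heq⟩ := regPot_eq_integral_logPot hM hμM hlog hη hη1 x
  have hpi := Real.pi_pos
  have h1 : ∫ θ in angles, (logPot μ (x - η * Real.tan θ) - logPot μ x) ≤
      ∫ θ in angles, (oscConst + 2) * (1 + K) * √η * √|Real.tan θ| := by
    refine integral_mono (hi.sub (integrable_const _)) (integrable_sqrt_tan.const_mul _)
      fun θ => ?_
    have := logPot_sub_le_sqrt hM hμM hlog hK0 hK x (η * Real.tan θ)
    rwa [abs_mul, abs_of_pos hη, Real.sqrt_mul hη.le, ← mul_assoc] at this
  have hvol : (volume.restrict angles).real Set.univ = Real.pi := by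
    rw [measureReal_restrict_apply_univ, angles, Real.volume_real_Ioc_of_le (by linarith)]; ring
  rw [integral_sub hi (integrable_const _), heq, integral_const_mul, integral_const, hvol,
    smul_eq_mul, ← mul_sub] at h1
  rw [regConst, ← mul_le_mul_iff_right₀ hpi]
  refine h1.trans_eq ?_
  field_simp

end

/-! ### The energy distance in Fourier variables -/

/-- The regularised mutual energy `∬ ½ log ((x - y)² + η²) dα(x) dβ(y)`. -/
def regEnergy (η : ℝ) (α β : Measure ℝ) : ℝ := ∫ p : ℝ × ℝ, regLog η (p.1 - p.2) ∂(α.prod β)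

/-- The square of the regularised energy distance of `α` and `β`. -/
def energyDistSq (η : ℝ) (α β : Measure ℝ) : ℝ :=
  ∫ t in Set.Ioi (0 : ℝ), Real.exp (-(η * t)) / t * ‖charFun α t - charFun β t‖ ^ 2

section

variable {α β : Measure ℝ} [IsProbabilityMeasure α] [IsProbabilityMeasure β] {η : ℝ}

lemma integral_one_sub_cos_prod (t : ℝ) :
    ∫ p : ℝ × ℝ, (1 - Real.cos (t * (p.1 - p.2))) ∂(α.prod β) =
      1 - (charFun α t * (starRingEnd ℂ) (charFun β t)).re := by
  have hc : Integrable (fun p : ℝ × ℝ => Real.cos (t * (p.1 - p.2))) (α.prod β) :=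
    (integrable_const (1 : ℝ)).mono' (Measurable.aestronglyMeasurable (by fun_prop))
      (Eventually.of_forall fun p => Real.abs_cos_le_one _)
  rw [integral_sub (integrable_const _) hc, ← charFun_neg, charFun_apply_real, charFun_apply_real,
    ← integral_prod_mul, ← RCLike.re_eq_complex_re, ← integral_re]
  · simp only [integral_const, probReal_univ, one_smul, RCLike.re_eq_complex_re]
    congr 1
    refine integral_congr_ae (Eventually.of_forall fun p => ?_)
    simp only
    rw [← Complex.exp_add, show (t : ℂ) * p.1 * Complex.I + ((-t : ℝ) : ℂ) * p.2 * Complex.I =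
      ((t * (p.1 - p.2) : ℝ) : ℂ) * Complex.I by push_cast; ring, Complex.exp_ofReal_mul_I_re]
  · refine (integrable_const (1 : ℝ)).mono' (Measurable.aestronglyMeasurable (by fun_prop))
      (Eventually.of_forall fun p => ?_)
    rw [norm_mul, show ((-t : ℝ) : ℂ) * p.2 * Complex.I = ((-t * p.2 : ℝ) : ℂ) * Complex.I by
      push_cast; ring, show (t : ℂ) * p.1 * Complex.I = ((t * p.1 : ℝ) : ℂ) * Complex.I by
      push_cast; ring, Complex.norm_exp_ofReal_mul_I, Complex.norm_exp_ofReal_mul_I, one_mul]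

lemma integrable_regLog_prod (hη : 0 < η) (hη1 : η ≤ 1)
    (hα : Integrable (fun y => Real.log (1 + |y|)) α)
    (hβ : Integrable (fun y => Real.log (1 + |y|)) β) :
    Integrable (fun p : ℝ × ℝ => regLog η (p.1 - p.2)) (α.prod β) := by
  refine (((hα.comp_fst β).add (hβ.comp_snd α)).add (integrable_const (-Real.log η))).mono'
    ((measurable_regLog η).comp (measurable_fst.sub measurable_snd)).aestronglyMeasurable
    (Eventually.of_forall fun p => ?_)
  have h1 := abs_regLog_le (u := p.1 - p.2) hη hη1
  have h2 := log_one_add_abs_sub_le p.1 p.2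
  simp only [Real.norm_eq_abs, Pi.add_apply]
  linarith

/-- Frullani's formula is integrated over α ⊗ β. The integrand is nonnegative, so its absolute
integrability follows from that of `regLog`. -/
lemma regEnergy_eq_integral (hη : 0 < η) (hη1 : η ≤ 1)
    (hα : Integrable (fun y => Real.log (1 + |y|)) α)
    (hβ : Integrable (fun y => Real.log (1 + |y|)) β) :
    IntegrableOn (fun t => Real.exp (-(η * t)) / t *
        (1 - (charFun α t * (starRingEnd ℂ) (charFun β t)).re)) (Set.Ioi 0) ∧
    ∫ t in Set.Ioi (0 : ℝ), Real.exp (-(η * t)) / t *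
        (1 - (charFun α t * (starRingEnd ℂ) (charFun β t)).re) =
      regEnergy η α β - Real.log η := by
  set F : (ℝ × ℝ) × ℝ → ℝ :=
    fun q => Real.exp (-(η * q.2)) / q.2 * (1 - Real.cos (q.2 * (q.1.1 - q.1.2))) with hF
  have hL := integrable_regLog_prod hη hη1 hα hβ
  have hint : Integrable F ((α.prod β).prod (volume.restrict (Set.Ioi 0))) := by
    rw [integrable_prod_iff (Measurable.aestronglyMeasurable (by fun_prop))]
    refine ⟨Eventually.of_forall fun p => (frullani_cos hη (p.1 - p.2)).1, ?_⟩
    refine (hL.sub (integrable_const (Real.log η))).congr (Eventually.of_forall fun p => ?_)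
    simp only [Pi.sub_apply]
    rw [← (frullani_cos hη (p.1 - p.2)).2]
    refine setIntegral_congr_fun measurableSet_Ioi fun t ht => ?_
    have ht' : (0 : ℝ) < t := ht
    simp only [hF]
    rw [Real.norm_of_nonneg (mul_nonneg (by positivity) (one_sub_cos_nonneg _))]
  have e : ∀ t, ∫ p, F (p, t) ∂(α.prod β) = Real.exp (-(η * t)) / t *
      (1 - (charFun α t * (starRingEnd ℂ) (charFun β t)).re) := fun t => by
    rw [← integral_one_sub_cos_prod, ← integral_const_mul]
  constructor
  · refine (hint.integral_prod_right).congr (Eventually.of_forall fun t => ?_)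
    exact e t
  · simp only [← e]
    rw [← integral_integral_swap (f := fun p t => F (p, t)) hint]
    have : ∀ p : ℝ × ℝ, ∫ t in Set.Ioi (0 : ℝ), F (p, t) = regLog η (p.1 - p.2) - Real.log η :=
      fun p => (frullani_cos hη (p.1 - p.2)).2
    simp only [this]
    rw [integral_sub hL (integrable_const _)]
    simp [regEnergy]

/-- Expanding |φ_α - φ_β|² produces three mutual energies with coefficients 2, -1, -1; these sum to
zero, so the constants log η cancel. -/
theorem energyDistSq_eq (hη : 0 < η) (hη1 : η ≤ 1)
    (hα : Integrable (fun y => Real.log (1 + |y|)) α)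
    (hβ : Integrable (fun y => Real.log (1 + |y|)) β) :
    IntegrableOn (fun t => Real.exp (-(η * t)) / t * ‖charFun α t - charFun β t‖ ^ 2)
      (Set.Ioi 0) ∧
    energyDistSq η α β = 2 * regEnergy η α β - regEnergy η α α - regEnergy η β β := by
  obtain ⟨i1, e1⟩ := regEnergy_eq_integral hη hη1 hα hβ
  obtain ⟨i2, e2⟩ := regEnergy_eq_integral hη hη1 hα hα
  obtain ⟨i3, e3⟩ := regEnergy_eq_integral hη hη1 hβ hβ
  have key : ∀ t : ℝ, Real.exp (-(η * t)) / t * ‖charFun α t - charFun β t‖ ^ 2 =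
      2 * (Real.exp (-(η * t)) / t * (1 - (charFun α t * (starRingEnd ℂ) (charFun β t)).re)) -
      Real.exp (-(η * t)) / t * (1 - (charFun α t * (starRingEnd ℂ) (charFun α t)).re) -
      Real.exp (-(η * t)) / t * (1 - (charFun β t * (starRingEnd ℂ) (charFun β t)).re) := by
    intro t
    rw [← Complex.normSq_eq_norm_sq, Complex.normSq_sub]
    simp only [Complex.mul_conj, Complex.ofReal_re]
    ring
  unfold energyDistSq
  simp only [key]
  refine ⟨((i1.const_mul 2).sub i2).sub i3, ?_⟩
  have h1 := integral_sub ((i1.const_mul 2).sub i2) i3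
  have h2 := integral_sub (i1.const_mul 2) i2
  simp only [Pi.sub_apply] at h1
  rw [h1, h2, integral_const_mul, e1, e2, e3]
  ring

end

/-! ### The empirical measure -/

section

variable {N : ℕ} {η : ℝ} {μ : Measure ℝ}

lemma isProbabilityMeasure_empiricalMeasure (hN : 1 ≤ N) (x : Fin N → ℝ) :
    IsProbabilityMeasure (empiricalMeasure x) := by
  constructor
  have hN0 : (N : ℝ≥0∞) ≠ 0 := by exact_mod_cast (by omega : N ≠ 0)
  simp [empiricalMeasure, ENNReal.inv_mul_cancel hN0 (ENNReal.natCast_ne_top N)]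

lemma integrable_empiricalMeasure (x : Fin N → ℝ) {g : ℝ → ℝ} (hN : 1 ≤ N) :
    Integrable g (empiricalMeasure x) := by
  have hN0 : (N : ℝ≥0∞) ≠ 0 := by exact_mod_cast (by omega : N ≠ 0)
  refine Integrable.smul_measure ?_ (ENNReal.inv_ne_top.2 hN0)
  rw [integrable_finsetSum_measure]
  exact fun i _ => integrable_dirac (by simp)

lemma integral_empiricalMeasure (x : Fin N → ℝ) (g : ℝ → ℝ) :
    ∫ y, g y ∂(empiricalMeasure x) = (N : ℝ)⁻¹ * ∑ i, g (x i) := by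
  rw [empiricalMeasure, integral_smul_measure, integral_finsetSum_measure]
  · simp
  · exact fun i _ => integrable_dirac (by simp)

lemma regEnergy_empiricalMeasure_left [IsProbabilityMeasure μ] (hN : 1 ≤ N) (hη : 0 < η)
    (hη1 : η ≤ 1) (hμ : Integrable (fun y => Real.log (1 + |y|)) μ) (x : Fin N → ℝ) :
    regEnergy η (empiricalMeasure x) μ = (N : ℝ)⁻¹ * ∑ i, regPot η μ (x i) := by
  have := isProbabilityMeasure_empiricalMeasure hN x
  rw [regEnergy, integral_prod _ (integrable_regLog_prod hη hη1
    (integrable_empiricalMeasure x hN) hμ), integral_empiricalMeasure]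
  rfl

lemma regEnergy_empiricalMeasure_self (hN : 1 ≤ N) (hη : 0 < η)
    (hη1 : η ≤ 1) (x : Fin N → ℝ) :
    regEnergy η (empiricalMeasure x) (empiricalMeasure x) =
      (N : ℝ)⁻¹ * ((N : ℝ)⁻¹ * ∑ i, ∑ j, regLog η (x i - x j)) := by
  have := isProbabilityMeasure_empiricalMeasure hN x
  rw [regEnergy_empiricalMeasure_left hN hη hη1 (integrable_empiricalMeasure x hN)]
  simp only [regPot, integral_empiricalMeasure, ← Finset.mul_sum]

end

/-! ### Comparison of the particle law with the product measure -/

lemma sum_sum_eq_two_mul_sum_Ioi {N : ℕ} (g : Fin N → Fin N → ℝ) (hg : ∀ i j, g i j = g j i) :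
    ∑ i, ∑ j, g i j = 2 * ∑ i, ∑ j ∈ Finset.Ioi i, g i j + ∑ i, g i i := by
  have h := Finset.sum_sum_Ioi_add_eq_sum_sum_off_diag g
  have h1 : ∑ i, ∑ j ∈ Finset.Ioi i, (g j i + g i j) = 2 * ∑ i, ∑ j ∈ Finset.Ioi i, g i j := by
    rw [Finset.mul_sum]
    refine Finset.sum_congr rfl fun i _ => ?_
    rw [Finset.mul_sum]
    exact Finset.sum_congr rfl fun j _ => by rw [hg j i]; ring
  rw [← h1, h, ← Finset.sum_add_distrib]
  refine Finset.sum_congr rfl fun i _ => ?_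
  rw [Finset.sum_congr rfl fun j _ => hg i j, ← Finset.sum_compl_add_sum {i}]
  simp

section

variable {P : ℝ} {V : ℝ → ℝ} {μ : Measure ℝ} {N : ℕ} {η : ℝ}

lemma exp_neg_potential (x : ℝ) : Real.exp (-V x) =
    eqDensity P V μ x * Real.exp (-lagrange P V μ - 2 * P * logPot μ x) := by
  rw [eqDensity, ← Real.exp_add]; congr 1; ring

lemma weight_nonneg (P : ℝ) (V : ℝ → ℝ) (N : ℕ) (x : Fin N → ℝ) : 0 ≤ weight P V N x :=
  mul_nonneg (Finset.prod_nonneg fun _ _ => Finset.prod_nonneg fun _ _ =>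
    Real.rpow_nonneg (abs_nonneg _) _) (Finset.prod_nonneg fun _ _ => (Real.exp_pos _).le)

lemma measurable_weight (hV : Continuous V) : Measurable (weight P V N) := by
  have := hV.measurable
  unfold weight
  fun_prop

/-- A weight whose pair interaction is `exp (2P/N · ℓ)` in terms of the product density. -/
lemma prod_exp_mul_prod_exp (ℓ : Fin N → Fin N → ℝ) (x : Fin N → ℝ) :
    (∏ i, ∏ j ∈ Finset.Ioi i, Real.exp (2 * P / N * ℓ i j)) * ∏ i, Real.exp (-V (x i)) =
      (∏ i, eqDensity P V μ (x i)) * Real.exp (2 * P / N * ∑ i, ∑ j ∈ Finset.Ioi i, ℓ i j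
        - N * lagrange P V μ - 2 * P * ∑ i, logPot μ (x i)) := by
  simp only [← Real.exp_sum, ← Finset.mul_sum, exp_neg_potential (P := P) (μ := μ),
    Finset.prod_mul_distrib]
  rw [mul_left_comm, ← Real.exp_add]
  congr 2
  rw [Finset.sum_sub_distrib, Finset.sum_const, Finset.card_univ, Fintype.card_fin, nsmul_eq_mul,
    ← Finset.mul_sum]
  ring

/-- Pairs are bounded by the regularised logarithm and the sum over i < j is completed to a full
double sum. The N diagonal terms each equal log η, hence -P log η. Writing the self-energy of L_N as
2 (L_N, μ) - (μ, μ) - D², the cross term cancels the potential from the Euler–Lagrange equation up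
to the regularisation error. -/
lemma weight_le (hμ : IsEquilibriumMeasure P V μ) (hV : Admissible V μ) (hP : 0 < P)
    (hN : 1 ≤ N) (hη : 0 < η) (hη1 : η ≤ 1) (x : Fin N → ℝ) :
    weight P V N x ≤ (∏ i, eqDensity P V μ (x i)) *
      Real.exp (-(P * N * energyDistSq η (empiricalMeasure x) μ) - P * N * logEnergy μ
        - P * Real.log η - N * lagrange P V μ + 2 * P * N * (regConst *
          (1 + (eLpNorm (hilbertTransform (density μ)) ⊤ volume).toReal) * √η)) := by
  have := hμ.finite.isProbabilityMeasure
  have := isProbabilityMeasure_empiricalMeasure hN x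
  have hlog := integrable_log_one_add_of_interaction hμ.finite.interaction
  obtain ⟨M0, hM0, hμM⟩ := exists_le_smul_volume hμ hV hP
  set K := (eLpNorm (hilbertTransform (density μ)) ⊤ volume).toReal
  have hN0 : (0 : ℝ) < N := by exact_mod_cast hN
  -- Colliding particles are treated separately: at u = 0 the left side is 0, whereas log |0| is 0
  -- by convention.
  have hpair : ∀ u : ℝ, |u| ^ (2 * P / (N : ℝ)) ≤ Real.exp (2 * P / N * regLog η u) := fun u => by
    rcases eq_or_ne u 0 with rfl | hu
    · rw [abs_zero, Real.zero_rpow (by positivity)]; exact (Real.exp_pos _).le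
    · rw [Real.rpow_def_of_pos (abs_pos.2 hu), mul_comm, Real.exp_le_exp]
      exact mul_le_mul_of_nonneg_left (log_abs_le_regLog hu) (by positivity)
  have h1 : weight P V N x ≤ (∏ i, ∏ j ∈ Finset.Ioi i,
      Real.exp (2 * P / N * regLog η (x i - x j))) * ∏ i, Real.exp (-V (x i)) := by
    unfold weight
    refine mul_le_mul_of_nonneg_right ?_ (Finset.prod_nonneg fun _ _ => (Real.exp_pos _).le)
    exact Finset.prod_le_prod (fun _ _ => Finset.prod_nonneg fun _ _ =>
      Real.rpow_nonneg (abs_nonneg _) _) fun i _ => Finset.prod_le_prod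
        (fun _ _ => Real.rpow_nonneg (abs_nonneg _) _) fun j _ => hpair _
  rw [prod_exp_mul_prod_exp (μ := μ) (fun i j => regLog η (x i - x j))] at h1
  refine h1.trans (mul_le_mul_of_nonneg_left (Real.exp_le_exp.2 ?_)
    (Finset.prod_nonneg fun _ _ => (eqDensity_pos _ _ _ _).le))
  have hsym := sum_sum_eq_two_mul_sum_Ioi (fun i j => regLog η (x i - x j))
    (fun i j => by rw [← regLog_neg, neg_sub])
  simp only [sub_self, regLog_zero_right, Finset.sum_const, Finset.card_univ, Fintype.card_fin,
    nsmul_eq_mul] at hsym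
  have hself := regEnergy_empiricalMeasure_self hN hη hη1 x
  have hcross := regEnergy_empiricalMeasure_left hN hη hη1 hlog x
  obtain ⟨-, hD⟩ := energyDistSq_eq (α := empiricalMeasure x) (β := μ) hη hη1
    (integrable_empiricalMeasure x hN) hlog
  have hU : ∑ i, regPot η μ (x i) - ∑ i, logPot μ (x i) ≤ N * (regConst * (1 + K) * √η) := by
    rw [← Finset.sum_sub_distrib]
    refine (Finset.sum_le_card_nsmul _ _ _ fun i _ => regPot_sub_logPot_le hM0 hμM hlog
      ENNReal.toReal_nonneg (abs_logPot_sub_le hμ hV hP) hη hη1 (x i)).trans_eq ?_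
    rw [Finset.card_univ, Fintype.card_fin, nsmul_eq_mul]
  have hE : logEnergy μ ≤ regEnergy η μ μ := by
    have hi := integrable_regLog_prod hη hη1 hlog hlog
    rw [logEnergy, regEnergy, integral_prod _ hμ.finite.interaction, integral_prod _ hi]
    refine integral_mono hμ.finite.interaction.integral_prod_left hi.integral_prod_left fun y => ?_
    refine integral_mono_ae (integrable_log_sub hμM hM0 hlog y)
      (integrable_regLog_sub hη hη1 hlog y) ?_
    filter_upwards [((Measure.absolutelyContinuous_of_le hμM).trans
      Measure.smul_absolutelyContinuous).ae_le (Measure.ae_ne volume y)] with z hz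
    exact log_abs_le_regLog (sub_ne_zero.2 hz.symm)
  set S := ∑ i, ∑ j ∈ Finset.Ioi i, regLog η (x i - x j)
  set T := ∑ i, ∑ j, regLog η (x i - x j)
  set A := ∑ i, regPot η μ (x i)
  have e1 : 2 * P / N * S = P * N * regEnergy η (empiricalMeasure x) (empiricalMeasure x) -
      P * Real.log η := by
    rw [hself, hsym]; field_simp; ring
  have e2 : A = N * regEnergy η (empiricalMeasure x) μ := by
    rw [hcross]; field_simp
  have hE' := mul_le_mul_of_nonneg_left hE (by positivity : 0 ≤ P * N)
  have hU' := mul_le_mul_of_nonneg_left hU (by positivity : 0 ≤ 2 * P)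
  rw [e1, hD]
  rw [e2] at hU'
  linarith

lemma lintegral_prod_eq_prod_of_integrable {f : Fin N → ℝ → ℝ} (hf : ∀ i, Integrable (f i))
    (h0 : ∀ i x, 0 ≤ f i x) :
    ∫⁻ x : Fin N → ℝ, ENNReal.ofReal (∏ i, f i (x i)) = ∏ i, ∫⁻ x, ENNReal.ofReal (f i x) := by
  have h := ofReal_integral_eq_lintegral_ofReal (μ := (volume : Measure (Fin N → ℝ)))
    (f := fun x => ∏ i, f i (x i)) (Integrable.fintype_prod hf)
    (Eventually.of_forall fun x => Finset.prod_nonneg fun i _ => h0 i _)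
  rw [← h, integral_fintype_prod_volume_eq_prod, ENNReal.ofReal_prod_of_nonneg fun i _ =>
      integral_nonneg (h0 i)]
  exact Finset.prod_congr rfl fun i _ => ofReal_integral_eq_lintegral_ofReal (hf i)
    (Eventually.of_forall (h0 i))

lemma pi_eq_withDensity (hμ : IsEquilibriumMeasure P V μ) (hV : Continuous V) :
    Measure.pi (fun _ : Fin N => μ) =
      volume.withDensity fun x => ENNReal.ofReal (∏ i, eqDensity P V μ (x i)) := by
  have := hμ.finite.isProbabilityMeasure
  refine (Measure.pi_eq fun s hs => ?_)
  have hρm := measurable_eqDensity (P := P) (μ := μ) hV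
  rw [withDensity_apply _ (MeasurableSet.univ_pi hs), ← lintegral_indicator
    (MeasurableSet.univ_pi hs)]
  have e : ∀ x : Fin N → ℝ, (Set.univ.pi s).indicator
      (fun x => ENNReal.ofReal (∏ i, eqDensity P V μ (x i))) x =
      ENNReal.ofReal (∏ i, (s i).indicator (eqDensity P V μ) (x i)) := by
    intro x
    by_cases hx : x ∈ Set.univ.pi s
    · rw [Set.indicator_of_mem hx]
      congr 1
      exact Finset.prod_congr rfl fun i _ =>
        (Set.indicator_of_mem (hx i (Set.mem_univ i)) _).symm
    · rw [Set.indicator_of_notMem hx]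
      obtain ⟨i, hi⟩ : ∃ i, x i ∉ s i := by
        by_contra h; push Not at h; exact hx fun i _ => h i
      rw [Finset.prod_eq_zero (Finset.mem_univ i) (Set.indicator_of_notMem hi _),
        ENNReal.ofReal_zero]
  simp only [e]
  rw [lintegral_prod_eq_prod_of_integrable
    (fun i => (integrable_eqDensity hμ hV).indicator (hs i))
    (fun i x => Set.indicator_nonneg (fun _ _ => (eqDensity_pos _ _ _ _).le) x)]
  refine Finset.prod_congr rfl fun i _ => ?_
  conv_rhs => rw [eq_withDensity hμ hV]
  rw [withDensity_apply _ (hs i), ← lintegral_indicator (hs i)]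
  refine lintegral_congr fun x => ?_
  by_cases hx : x ∈ s i <;> simp [hx]

lemma ae_pairwise_ne : ∀ᵐ x : Fin N → ℝ, ∀ i j, i ≠ j → x i ≠ x j := by
  rw [ae_all_iff]; intro i
  rw [ae_all_iff]; intro j
  rcases eq_or_ne i j with h | h
  · exact Eventually.of_forall fun x hne => absurd h hne
  let S : Submodule ℝ (Fin N → ℝ) :=
    LinearMap.ker (LinearMap.proj (R := ℝ) (φ := fun _ : Fin N => ℝ) i - LinearMap.proj j)
  have hS : S ≠ ⊤ := by
    intro hT
    have h1 : Pi.single i (1 : ℝ) ∈ S := by rw [hT]; trivial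
    have h2 : (Pi.single i (1 : ℝ) : Fin N → ℝ) i - (Pi.single i (1 : ℝ) : Fin N → ℝ) j = 0 := h1
    simp [h.symm] at h2
  filter_upwards [measure_eq_zero_iff_ae_notMem.1 (Measure.addHaar_submodule volume S hS)]
    with x hx _ he
  exact hx (show x i - x j = 0 from sub_eq_zero.2 he)

/-! ### Lower bound on the partition function and exponential moments -/

/-- Jensen's inequality from the tangent line of exp at the mean. In this form exp Y need not be
integrable. -/
lemma ofReal_exp_integral_le {X : Type*} [MeasurableSpace X] {π : Measure X}
    [IsProbabilityMeasure π] {Y : X → ℝ} (hY : Integrable Y π) :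
    ENNReal.ofReal (Real.exp (∫ x, Y x ∂π)) ≤ ∫⁻ x, ENNReal.ofReal (Real.exp (Y x)) ∂π := by
  set m := ∫ x, Y x ∂π
  set L : X → ℝ := fun x => Real.exp m * (1 + (Y x - m)) with hL
  have hLi : Integrable L π :=
    ((integrable_const (1 : ℝ)).add (hY.sub (integrable_const m))).const_mul _
  have hLint : ∫ x, L x ∂π = Real.exp m := by
    have h1 : Integrable (fun x => Y x - m) π := hY.sub (integrable_const m)
    rw [hL, integral_const_mul, integral_add (integrable_const _) h1,
      integral_sub hY (integrable_const _)]
    simp [m]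
  have hle : ∀ x, L x ≤ Real.exp (Y x) := fun x => by
    have h1 := Real.add_one_le_exp (Y x - m)
    have h2 : Real.exp (Y x) = Real.exp m * Real.exp (Y x - m) := by
      rw [← Real.exp_add]; congr 1; ring
    rw [h2]
    exact mul_le_mul_of_nonneg_left (by linarith) (Real.exp_pos _).le
  calc ENNReal.ofReal (Real.exp m) = ENNReal.ofReal (∫ x, L x ∂π) := by rw [hLint]
    _ ≤ ENNReal.ofReal (∫ x, max (L x) 0 ∂π) :=
        ENNReal.ofReal_le_ofReal (integral_mono hLi hLi.pos_part fun x => le_max_left _ _)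
    _ = ∫⁻ x, ENNReal.ofReal (max (L x) 0) ∂π :=
        ofReal_integral_eq_lintegral_ofReal hLi.pos_part
          (Eventually.of_forall fun x => le_max_right _ _)
    _ ≤ _ := lintegral_mono fun x => ENNReal.ofReal_le_ofReal
        (max_le (hle x) (Real.exp_pos _).le)

lemma measurePreserving_pair [IsProbabilityMeasure μ] {i j : Fin N} (hij : i ≠ j) :
    MeasurePreserving (fun x : Fin N → ℝ => (x i, x j)) (Measure.pi fun _ => μ) (μ.prod μ) := by
  have hind := ProbabilityTheory.iIndepFun_pi (μ := fun _ : Fin N => μ)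
    (X := fun _ => id) (fun _ => aemeasurable_id)
  have h2 := hind.indepFun hij
  have hm : ∀ k : Fin N, Measurable fun x : Fin N → ℝ => x k := measurable_pi_apply
  refine ⟨(hm i).prodMk (hm j), ?_⟩
  have h3 := (ProbabilityTheory.indepFun_iff_map_prod_eq_prod_map_map (hm i).aemeasurable
    (hm j).aemeasurable).1 h2
  rw [h3, (measurePreserving_eval (fun _ : Fin N => μ) i).map_eq,
    (measurePreserving_eval (fun _ : Fin N => μ) j).map_eq]

/-- Jensen under μ^{⊗N}: the N(N-1)/2 pairs contribute P(N-1) E and the potentials -2PN E, where E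
is the logarithmic energy; together this is -P(N+1) E. -/
lemma exp_le_lintegral_weight (hμ : IsEquilibriumMeasure P V μ) (hV : Continuous V)
    (hN : 1 ≤ N) :
    ENNReal.ofReal (Real.exp (-(P * (N + 1) * logEnergy μ) - N * lagrange P V μ)) ≤
      ∫⁻ x, ENNReal.ofReal (weight P V N x) := by
  have := hμ.finite.isProbabilityMeasure
  have hN0 : (0 : ℝ) < N := by exact_mod_cast hN
  set π := Measure.pi fun _ : Fin N => μ with hπ
  set Y : (Fin N → ℝ) → ℝ := fun x => 2 * P / N * ∑ i, ∑ j ∈ Finset.Ioi i, Real.log |x i - x j|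
        - N * lagrange P V μ - 2 * P * ∑ i, logPot μ (x i) with hY
  have hρm := measurable_eqDensity (P := P) (μ := μ) hV
  have hUm := measurable_logPot μ
  have hYm : Measurable Y := by fun_prop
  have hweight : ∫⁻ x, ENNReal.ofReal (weight P V N x) = ∫⁻ x, ENNReal.ofReal (Real.exp (Y x)) ∂π := by
    rw [hπ, pi_eq_withDensity hμ hV, lintegral_withDensity_eq_lintegral_mul _ (by fun_prop)
      (by fun_prop)]
    refine lintegral_congr_ae ?_
    filter_upwards [ae_pairwise_ne] with x hx
    rw [Pi.mul_apply, ← ENNReal.ofReal_mul (Finset.prod_nonneg fun _ _ =>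
      (eqDensity_pos _ _ _ _).le), hY]
    simp only
    rw [← prod_exp_mul_prod_exp (fun i j => Real.log |x i - x j|), weight]
    congr 2
    refine Finset.prod_congr rfl fun i _ => Finset.prod_congr rfl fun j hj => ?_
    have hne : x i - x j ≠ 0 := sub_ne_zero.2 (hx i j (Finset.mem_Ioi.1 hj).ne)
    rw [Real.rpow_def_of_pos (abs_pos.2 hne), mul_comm]
  have hpair : ∀ i j : Fin N, i ≠ j → Integrable (fun x : Fin N → ℝ => Real.log |x i - x j|) π ∧
      ∫ x, Real.log |x i - x j| ∂π = logEnergy μ := fun i j hij => by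
    have hp := measurePreserving_pair (μ := μ) hij
    refine ⟨(hp.integrable_comp measurable_log_abs_sub.aestronglyMeasurable).2
      hμ.finite.interaction, ?_⟩
    rw [logEnergy, ← hp.map_eq, integral_map hp.measurable.aemeasurable
      measurable_log_abs_sub.aestronglyMeasurable]
  have hUi : Integrable (logPot μ) μ := hμ.finite.interaction.integral_prod_left
  have hone : ∀ i : Fin N, Integrable (fun x : Fin N → ℝ => logPot μ (x i)) π ∧
      ∫ x, logPot μ (x i) ∂π = logEnergy μ := fun i => by
    have hp := measurePreserving_eval (fun _ : Fin N => μ) i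
    refine ⟨(hp.integrable_comp hUm.aestronglyMeasurable).2 hUi, ?_⟩
    have h := integral_map (μ := π) hp.measurable.aemeasurable (f := logPot μ) hUm.aestronglyMeasurable
    rw [hp.map_eq] at h
    rw [logEnergy, integral_prod _ hμ.finite.interaction]
    exact h.symm
  have i1 : Integrable (fun x : Fin N → ℝ => ∑ i, ∑ j ∈ Finset.Ioi i, Real.log |x i - x j|) π :=
    integrable_finsetSum _ fun i _ => integrable_finsetSum _ fun j hj =>
      (hpair i j (Finset.mem_Ioi.1 hj).ne).1
  have i2 : Integrable (fun x : Fin N → ℝ => ∑ i, logPot μ (x i)) π :=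
    integrable_finsetSum _ fun i _ => (hone i).1
  have i3 : Integrable (fun x : Fin N → ℝ => 2 * P / N * ∑ i, ∑ j ∈ Finset.Ioi i,
      Real.log |x i - x j| - N * lagrange P V μ) π := (i1.const_mul _).sub (integrable_const _)
  have hYi : Integrable Y π := i3.sub (i2.const_mul _)
  have hYint : ∫ x, Y x ∂π = -(P * (N + 1) * logEnergy μ) - N * lagrange P V μ := by
    rw [hY, integral_sub i3 (i2.const_mul _), integral_sub (i1.const_mul _) (integrable_const _),
      integral_const_mul, integral_const_mul (2 * P), integral_finsetSum _ fun i _ => (hone i).1,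
      integral_finsetSum _ fun i _ => integrable_finsetSum _ fun j hj =>
      (hpair i j (Finset.mem_Ioi.1 hj).ne).1]
    have e1 : ∑ i, ∫ x, ∑ j ∈ Finset.Ioi i, Real.log |x i - x j| ∂π =
        ∑ i : Fin N, ∑ j ∈ Finset.Ioi i, logEnergy μ := by
      refine Finset.sum_congr rfl fun i _ => ?_
      rw [integral_finsetSum _ fun j hj => (hpair i j (Finset.mem_Ioi.1 hj).ne).1]
      exact Finset.sum_congr rfl fun j hj => (hpair i j (Finset.mem_Ioi.1 hj).ne).2
    have e2 := sum_sum_eq_two_mul_sum_Ioi (fun _ _ : Fin N => logEnergy μ) (fun _ _ => rfl)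
    rw [e1, Finset.sum_congr rfl fun i _ => (hone i).2]
    simp only [Finset.sum_const, Finset.card_univ, Fintype.card_fin, nsmul_eq_mul,
      integral_const, probReal_univ, one_smul] at e2 ⊢
    field_simp
    linear_combination -P * e2
  rw [hweight, ← hYint]
  exact ofReal_exp_integral_le hYi

lemma partitionFunction_eq (hV : Continuous V) :
    partitionFunction P V N = (∫⁻ x, ENNReal.ofReal (weight P V N x)).toReal :=
  integral_eq_lintegral_of_nonneg_ae (Eventually.of_forall fun x => weight_nonneg P V N x)
    (measurable_weight hV).aestronglyMeasurable

lemma measurable_particleDensity (hV : Continuous V) : Measurable (particleDensity P V N) :=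
  (measurable_weight hV).div_const _

lemma particleLaw_univ_le (hV : Continuous V) : particleLaw P V N Set.univ ≤ 1 := by
  rw [particleLaw, withDensity_apply _ MeasurableSet.univ, Measure.restrict_univ]
  have hZ0 : 0 ≤ partitionFunction P V N := integral_nonneg fun x => weight_nonneg P V N x
  simp only [particleDensity]
  rcases hZ0.eq_or_lt with h | h
  · simp [← h]
  · have e : ∀ x, ENNReal.ofReal (weight P V N x / partitionFunction P V N) =
        ENNReal.ofReal (weight P V N x) / ENNReal.ofReal (partitionFunction P V N) := fun x =>
      ENNReal.ofReal_div_of_pos h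
    rw [lintegral_congr e]
    simp only [div_eq_mul_inv]
    rw [lintegral_mul_const _ (measurable_weight hV).ennreal_ofReal]
    have hne : ∫⁻ x, ENNReal.ofReal (weight P V N x) ≠ ⊤ := fun ht => by
      rw [partitionFunction_eq hV, ht] at h; simp at h
    rw [partitionFunction_eq hV, ENNReal.ofReal_toReal hne]
    exact ENNReal.mul_inv_le_one _

/-- The quotient of `weight_le` by `exp_le_lintegral_weight` leaves the product density times exp
(-P N D²) and a constant: the multipliers cancel, and -PN E + P(N+1) E = P E. Any g controlled by
exp (P N D²) is then integrated against a probability density. -/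
theorem lintegral_particleLaw_le (hμ : IsEquilibriumMeasure P V μ) (hV : Admissible V μ)
    (hP : 0 < P) (hN : 1 ≤ N) (hη : 0 < η) (hη1 : η ≤ 1) {g : (Fin N → ℝ) → ℝ} {B : ℝ}
    (hB : 0 ≤ B) (hg : ∀ x, g x *
      Real.exp (-(P * N * energyDistSq η (empiricalMeasure x) μ)) ≤ B) :
    ∫⁻ x, ENNReal.ofReal (g x) ∂(particleLaw P V N) ≤
      ENNReal.ofReal (B * Real.exp (P * logEnergy μ - P * Real.log η +
        2 * P * N * (regConst *
          (1 + (eLpNorm (hilbertTransform (density μ)) ⊤ volume).toReal) * √η))) := by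
  have := hμ.finite.isProbabilityMeasure
  have hVc := hV.smooth.continuous
  set K := (eLpNorm (hilbertTransform (density μ)) ⊤ volume).toReal
  set err := 2 * P * N * (regConst * (1 + K) * √η) with herr
  have hlow := exp_le_lintegral_weight (N := N) hμ hVc hN
  have hZ := partitionFunction_eq (P := P) (N := N) hVc
  refine (lintegral_withDensity_le_lintegral_mul _
    (measurable_particleDensity hVc).ennreal_ofReal _).trans ?_
  -- If the weight were not integrable, the partition function would be 0 by convention and the law
  -- the zero measure, so the bound holds trivially.
  by_cases htop : ∫⁻ x, ENNReal.ofReal (weight P V N x) = ⊤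
  · rw [htop, ENNReal.toReal_top] at hZ
    simp [particleDensity, hZ]
  set z := Real.exp (-(P * (N + 1) * logEnergy μ) - N * lagrange P V μ) with hz
  have hz0 : 0 < z := Real.exp_pos _
  have hzZ : z ≤ partitionFunction P V N := by
    rw [hZ]; exact (ENNReal.ofReal_le_iff_le_toReal htop).1 hlow
  have hZ0 : 0 < partitionFunction P V N := hz0.trans_le hzZ
  set Q := B * Real.exp (P * logEnergy μ - P * Real.log η + err) with hQ
  have hQ0 : 0 ≤ Q := by positivity
  have hρ0 : ∀ x : Fin N → ℝ, 0 ≤ ∏ i, eqDensity P V μ (x i) := fun x =>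
    Finset.prod_nonneg fun _ _ => (eqDensity_pos _ _ _ _).le
  have hpt : ∀ x, ENNReal.ofReal (particleDensity P V N x) * ENNReal.ofReal (g x) ≤
      ENNReal.ofReal (∏ i, eqDensity P V μ (x i)) * ENNReal.ofReal Q := fun x => by
    have hd0 : 0 ≤ particleDensity P V N x := div_nonneg (weight_nonneg _ _ _ _) hZ0.le
    rw [← ENNReal.ofReal_mul hd0, ← ENNReal.ofReal_mul (hρ0 x)]
    rcases le_or_gt (g x) 0 with hgx | hgx
    · rw [ENNReal.ofReal_of_nonpos (mul_nonpos_of_nonneg_of_nonpos hd0 hgx)]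
      exact zero_le
    refine ENNReal.ofReal_le_ofReal ?_
    have hw := weight_le hμ hV hP hN hη hη1 x
    rw [← herr] at hw
    set D := energyDistSq η (empiricalMeasure x) μ
    have h1 : particleDensity P V N x ≤ (∏ i, eqDensity P V μ (x i)) *
        (Real.exp (P * logEnergy μ - P * Real.log η + err) * Real.exp (-(P * N * D))) := by
      have h2 : weight P V N x / partitionFunction P V N ≤ weight P V N x / z := by
        gcongr; exact weight_nonneg _ _ _ _
      refine h2.trans ?_
      rw [div_le_iff₀ hz0]
      refine hw.trans_eq ?_
      have h3 : Real.exp (-(P * N * D) - P * N * logEnergy μ - P * Real.log η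
          - N * lagrange P V μ + err) = Real.exp (P * logEnergy μ - P * Real.log η + err) *
          Real.exp (-(P * N * D)) * z := by
        rw [hz, ← Real.exp_add, ← Real.exp_add]; congr 1; ring
      rw [h3]; ring
    calc particleDensity P V N x * g x
        ≤ (∏ i, eqDensity P V μ (x i)) * (Real.exp (P * logEnergy μ - P * Real.log η + err) *
            Real.exp (-(P * N * D))) * g x := by gcongr
      _ = (∏ i, eqDensity P V μ (x i)) * ((g x * Real.exp (-(P * N * D))) *
            Real.exp (P * logEnergy μ - P * Real.log η + err)) := by ring
      _ ≤ (∏ i, eqDensity P V μ (x i)) * Q := by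
          refine mul_le_mul_of_nonneg_left ?_ (hρ0 x)
          exact mul_le_mul_of_nonneg_right (hg x) (Real.exp_pos _).le
  refine (lintegral_mono hpt).trans ?_
  have hρm := measurable_eqDensity (P := P) (μ := μ) hVc
  rw [lintegral_mul_const _ (by fun_prop), lintegral_prod_eq_prod_of_integrable
    (f := fun _ : Fin N => eqDensity P V μ) (fun _ => integrable_eqDensity hμ hVc)
    (fun _ x => (eqDensity_pos _ _ _ x).le)]
  simp [lintegral_eqDensity hμ hVc]

end

/-! ### Functions in `W^{1,∞}` are Lipschitz -/

section

variable {n : ℕ} {f g : EuclideanSpace ℝ (Fin n) → ℝ}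

lemma isBoundedWeakPartial_weakPartial (hf : MemW1inf f) (i : Fin n) :
    IsBoundedWeakPartial f (weakPartial f i) i := by
  rw [weakPartial, dif_pos (hf.weakPartial i)]
  exact (hf.weakPartial i).choose_spec

lemma normW1inf_ne_top (hf : MemW1inf f) :
    (eLpNorm f ⊤ volume ⊔ ⨆ i, eLpNorm (weakPartial f i) ⊤ volume) ≠ ⊤ := by
  refine (max_lt hf.bounded.2 ?_).ne
  refine lt_of_le_of_lt (iSup_le fun i => Finset.single_le_sum
    (f := fun i => eLpNorm (weakPartial f i) ⊤ volume) (fun _ _ => zero_le) (Finset.mem_univ i)) ?_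
  exact ENNReal.sum_lt_top.2 fun i _ => (isBoundedWeakPartial_weakPartial hf i).1.2

lemma normW1inf_nonneg (f : EuclideanSpace ℝ (Fin n) → ℝ) : 0 ≤ normW1inf f :=
  ENNReal.toReal_nonneg

/-- The bound holds almost everywhere, hence on a dense set, and continuity of f makes it hold at
every point. This is essential since empirical measures charge Lebesgue-null sets. -/
lemma abs_le_normW1inf (hf : MemW1inf f) (x : EuclideanSpace ℝ (Fin n)) :
    |f x| ≤ normW1inf f := by
  have h : ∀ᵐ x, |f x| ≤ normW1inf f := by
    filter_upwards [ae_le_eLpNormEssSup (f := f) (μ := volume)] with x hx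
    rw [← Real.norm_eq_abs, ← toReal_enorm]
    refine ENNReal.toReal_mono (normW1inf_ne_top hf) (hx.trans ?_)
    rw [← eLpNorm_exponent_top]
    exact le_sup_left
  have hcl : IsClosed {x | |f x| ≤ normW1inf f} :=
    isClosed_le hf.continuous.abs continuous_const
  have : Dense {x | |f x| ≤ normW1inf f} := Measure.dense_of_ae h
  exact (hcl.closure_eq ▸ this.closure_eq ▸ Set.mem_univ x : x ∈ {x | |f x| ≤ normW1inf f})

lemma ae_abs_weakPartial_le (hf : MemW1inf f) (i : Fin n) :
    ∀ᵐ x, |weakPartial f i x| ≤ normW1inf f := by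
  filter_upwards [ae_le_eLpNormEssSup (f := weakPartial f i) (μ := volume)] with x hx
  rw [← Real.norm_eq_abs, ← toReal_enorm]
  refine ENNReal.toReal_mono (normW1inf_ne_top hf) (hx.trans ?_)
  rw [← eLpNorm_exponent_top]
  exact le_sup_of_le_right (le_iSup (fun i => eLpNorm (weakPartial f i) ⊤ volume) i)

/-- The definition of the weak derivative moves the derivative from the mollifier to f, leaving an
average of a bounded function. -/
lemma abs_integral_mul_fderiv_comp_sub_le (hf : MemW1inf f) (i : Fin n)
    {ψ : EuclideanSpace ℝ (Fin n) → ℝ} (hψ : ContDiff ℝ ∞ ψ) (hψc : HasCompactSupport ψ)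
    (hψ0 : ∀ x, 0 ≤ ψ x) (hψ1 : ∫ x, ψ x = 1) (x : EuclideanSpace ℝ (Fin n)) :
    |∫ t, f t * fderiv ℝ ψ (x - t) (EuclideanSpace.single i 1)| ≤ normW1inf f := by
  have hsub : ContDiff ℝ ∞ fun t : EuclideanSpace ℝ (Fin n) => x - t :=
    contDiff_const.sub contDiff_id
  have hφ : ContDiff ℝ ∞ fun t => ψ (x - t) := hψ.comp hsub
  have hφc : HasCompactSupport fun t => ψ (x - t) :=
    hψc.comp_homeomorph (Homeomorph.subLeft x)
  have hd : ∀ t v, fderiv ℝ (fun t => ψ (x - t)) t v = -fderiv ℝ ψ (x - t) v := by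
    intro t v
    have h1 : HasFDerivAt (fun t => x - t) (-(ContinuousLinearMap.id ℝ _)) t :=
      (hasFDerivAt_id t).const_sub x
    have h2 := (hψ.differentiable (by simp) (x - t)).hasFDerivAt
    have h3 : HasFDerivAt (fun t => ψ (x - t)) _ t := h2.comp t h1
    rw [h3.fderiv]
    simp
  have h := (isBoundedWeakPartial_weakPartial hf i).2 _ hφ hφc
  simp only [hd, mul_neg, integral_neg, neg_inj] at h
  rw [h, ← Real.norm_eq_abs]
  have hint : Integrable fun t => ψ (x - t) := hφ.continuous.integrable_of_hasCompactSupport hφc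
  refine (norm_integral_le_of_norm_le (hint.const_mul (normW1inf f)) ?_).trans_eq ?_
  · filter_upwards [ae_abs_weakPartial_le hf i] with t ht
    rw [norm_mul, Real.norm_eq_abs, Real.norm_of_nonneg (hψ0 _)]
    exact mul_le_mul_of_nonneg_right ht (hψ0 _)
  · rw [integral_const_mul, integral_sub_left_eq_self ψ volume x, hψ1, mul_one]

/-- A function in `W^{1,∞}` is Lipschitz, with a constant controlled by its norm. -/
theorem MemW1inf.abs_sub_le (hf : MemW1inf f) (x y : EuclideanSpace ℝ (Fin n)) :
    |f x - f y| ≤ n * normW1inf f * ‖x - y‖ := by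
  have hM := normW1inf_nonneg f
  -- Mollifiers supported in balls of radius 1/(k+1): the mollified functions are uniformly
  -- Lipschitz and converge pointwise to f by continuity.
  let b : ℕ → ContDiffBump (0 : EuclideanSpace ℝ (Fin n)) := fun k =>
    ⟨1 / (2 * ((k : ℝ) + 1)), 1 / ((k : ℝ) + 1), by positivity, by
      apply one_div_lt_one_div_of_lt <;> nlinarith [(Nat.cast_nonneg k : (0 : ℝ) ≤ k)]⟩
  let F : ℕ → EuclideanSpace ℝ (Fin n) → ℝ := fun k =>
    convolution f ((b k).normed volume) (ContinuousLinearMap.lsmul ℝ ℝ) volume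
  have hlim : ∀ z, Tendsto (fun k => F k z) atTop (𝓝 (f z)) := by
    intro z
    have h := ContDiffBump.convolution_tendsto_right_of_continuous (μ := volume) (φ := b)
      (l := atTop) tendsto_one_div_add_atTop_nhds_zero_nat hf.continuous z
    refine h.congr fun k => ?_
    simp only [F]
    rw [← convolution_flip]
    congr 1
    ext
    simp
  have hder : ∀ k z, HasFDerivAt (F k)
      (convolution f (fderiv ℝ ((b k).normed volume))
        ((ContinuousLinearMap.lsmul ℝ ℝ).precompR (EuclideanSpace ℝ (Fin n))) volume z) z :=
    fun k z => (b k).hasCompactSupport_normed.hasFDerivAt_convolution_right _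
      hf.continuous.locallyIntegrable (b k).contDiff_normed z
  have hbound : ∀ k z, ‖fderiv ℝ (F k) z‖ ≤ n * normW1inf f := by
    intro k z
    rw [(hder k z).fderiv]
    set L := convolution f (fderiv ℝ ((b k).normed volume))
        ((ContinuousLinearMap.lsmul ℝ ℝ).precompR (EuclideanSpace ℝ (Fin n))) volume z with hL
    have hLi : ∀ i, |L (EuclideanSpace.single i 1)| ≤ normW1inf f := by
      intro i
      have hex := ((b k).hasCompactSupport_normed (μ := volume)).fderiv (𝕜 := ℝ) |>.convolutionExists_right
        ((ContinuousLinearMap.lsmul ℝ ℝ).precompR (EuclideanSpace ℝ (Fin n)))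
        (μ := volume) (f := f) hf.continuous.locallyIntegrable
        ((b k).contDiff_normed (μ := volume) (n := 1) |>.continuous_fderiv (by simp)) z
      have := abs_integral_mul_fderiv_comp_sub_le hf i (b k).contDiff_normed
        (b k).hasCompactSupport_normed (b k).nonneg_normed (b k).integral_normed z
      rw [hL, convolution_def, ContinuousLinearMap.integral_apply hex]
      simpa using this
    -- The factor n arises from bounding each of the n coordinates of v by its Euclidean norm.
    refine ContinuousLinearMap.opNorm_le_bound _ (by positivity) fun v => ?_
    have hv : v = ∑ i, v i • EuclideanSpace.single i (1 : ℝ) := by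
      ext j
      simp [Finset.sum_apply, Pi.single_apply]
    conv_lhs => rw [hv]
    rw [map_sum]
    refine (norm_sum_le _ _).trans ?_
    have : ∀ i ∈ Finset.univ, ‖L (v i • EuclideanSpace.single i 1)‖ ≤ normW1inf f * ‖v‖ := by
      intro i _
      rw [map_smul, norm_smul, mul_comm]
      exact mul_le_mul (hLi i) (PiLp.norm_apply_le v i) (norm_nonneg _) hM
    refine (Finset.sum_le_sum this).trans_eq ?_
    simp [mul_assoc]
  have hk : ∀ k, |F k x - F k y| ≤ n * normW1inf f * ‖x - y‖ := fun k =>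
    Convex.norm_image_sub_le_of_norm_fderiv_le (𝕜 := ℝ) (s := Set.univ)
      (fun z _ => (hder k z).differentiableAt) (fun z _ => hbound k z) convex_univ
      (Set.mem_univ _) (Set.mem_univ _)
  exact le_of_tendsto ((hlim x).sub (hlim y)).abs (Eventually.of_forall hk)

end

/-! ### Band-limited smoothing -/

section

variable {n : ℕ}

/-- A smooth cutoff, equal to `1` near the origin and supported in the ball of radius `2`. -/
def cutoff (n : ℕ) : ContDiffBump (0 : EuclideanSpace ℝ (Fin n)) := ⟨1, 2, by norm_num, by norm_num⟩

/-- The cutoff as a Schwartz function. -/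
def cutoffSchwartz (n : ℕ) : SchwartzMap (EuclideanSpace ℝ (Fin n)) ℂ :=
  ((cutoff n).hasCompactSupport.comp_left (g := fun r : ℝ => (r : ℂ)) (by simp)).toSchwartzMap
    (Complex.ofRealCLM.contDiff.comp (cutoff n).contDiff)

lemma cutoffSchwartz_apply (x : EuclideanSpace ℝ (Fin n)) :
    cutoffSchwartz n x = (cutoff n x : ℂ) := rfl

/-- The kernel of the band-limited smoothing. -/
def smoothingKernel (n : ℕ) : SchwartzMap (EuclideanSpace ℝ (Fin n)) ℂ := 𝓕 (cutoffSchwartz n)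

/-- Fourier inversion at the origin, where the cutoff equals 1. -/
lemma integral_smoothingKernel : ∫ x, smoothingKernel n x = 1 := by
  have h : 𝓕⁻ (smoothingKernel n) = cutoffSchwartz n := FourierTransform.fourierInv_fourier_eq _
  have h0 : (𝓕⁻ (smoothingKernel n)) 0 = 1 := by
    rw [h, cutoffSchwartz_apply, (cutoff n).one_of_mem_closedBall (by simp [cutoff])]
    simp
  rw [SchwartzMap.fourierInv_coe, Real.fourierInv_eq] at h0
  simpa using h0

/-- The Fourier transform of the band-limited smoothing of `f` at scale `η`. -/
def smoothFourier (η : ℝ) (f : EuclideanSpace ℝ (Fin n) → ℝ) (t : EuclideanSpace ℝ (Fin n)) : ℂ :=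
  ((2 * Real.pi) ^ n)⁻¹ * (cutoff n (η • t) * fourierL2 f t)

/-- The band-limited smoothing of `f` at scale `η`. -/
def smoothing (η : ℝ) (f : EuclideanSpace ℝ (Fin n) → ℝ) (x : EuclideanSpace ℝ (Fin n)) : ℂ :=
  ∫ t, Complex.exp (inner ℝ x t * Complex.I) * smoothFourier η f t

/-- The modulated cutoff. -/
def modulatedCutoff (s : ℝ) (x w : EuclideanSpace ℝ (Fin n)) : ℂ :=
  (cutoff n (s • w) : ℂ) * Complex.exp ((2 * Real.pi * inner ℝ x w : ℝ) * Complex.I)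

lemma contDiff_modulatedCutoff (s : ℝ) (x : EuclideanSpace ℝ (Fin n)) :
    ContDiff ℝ ∞ (modulatedCutoff s x) := by
  refine ContDiff.mul ?_ ?_
  · exact Complex.ofRealCLM.contDiff.comp ((cutoff n).contDiff.comp (contDiff_const_smul s))
  · refine ContDiff.cexp (ContDiff.mul ?_ contDiff_const)
    exact Complex.ofRealCLM.contDiff.comp
      (contDiff_const.mul (contDiff_const.inner ℝ contDiff_id))

lemma hasCompactSupport_modulatedCutoff {s : ℝ} (hs : s ≠ 0) (x : EuclideanSpace ℝ (Fin n)) :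
    HasCompactSupport (modulatedCutoff s x) := by
  refine HasCompactSupport.mul_right ?_
  exact ((cutoff n).hasCompactSupport.comp_smul hs).comp_left (g := fun r : ℝ => (r : ℂ)) (by simp)

lemma fourier_modulatedCutoff {s : ℝ} (hs : 0 < s) (x y : EuclideanSpace ℝ (Fin n)) :
    𝓕 (modulatedCutoff s x) y = ((s ^ n)⁻¹ : ℝ) * smoothingKernel n (s⁻¹ • (y - x)) := by
  rw [smoothingKernel, SchwartzMap.fourier_coe, Real.fourier_eq', Real.fourier_eq']
  have h := Measure.integral_comp_smul (volume : Measure (EuclideanSpace ℝ (Fin n)))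
    (fun v => Complex.exp (((-2 * Real.pi * inner ℝ v (s⁻¹ • (y - x)) : ℝ)) * Complex.I) •
      cutoffSchwartz n v) s
  rw [finrank_euclideanSpace_fin, abs_of_pos (by positivity), Complex.real_smul] at h
  rw [← h]
  refine integral_congr_ae (Eventually.of_forall fun w => ?_)
  simp only [modulatedCutoff, smul_eq_mul, cutoffSchwartz_apply]
  rw [mul_left_comm, ← Complex.exp_add, mul_comm]
  congr 2
  rw [← add_mul, ← Complex.ofReal_add, inner_smul_left, inner_smul_right, inner_sub_right,
    real_inner_comm w x]
  congr 2
  simp only [conj_trivial]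
  field_simp
  ring

variable {f : EuclideanSpace ℝ (Fin n) → ℝ}

lemma integrable_cutoff_mul {η : ℝ} (hη : 0 < η) (g : Lp ℂ 2 (volume : Measure
    (EuclideanSpace ℝ (Fin n)))) : Integrable fun w => (cutoff n (η • w) : ℂ) * g w := by
  have h1 : Continuous fun w : EuclideanSpace ℝ (Fin n) => (cutoff n (η • w) : ℂ) :=
    Complex.continuous_ofReal.comp ((cutoff n).continuous.comp (continuous_const_smul η))
  have h2 : HasCompactSupport fun w : EuclideanSpace ℝ (Fin n) => (cutoff n (η • w) : ℂ) :=
    ((cutoff n).hasCompactSupport.comp_smul hη.ne').comp_left (g := fun r : ℝ => (r : ℂ)) (by simp)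
  exact (h1.memLp_of_hasCompactSupport (p := 2) h2).integrable_mul (Lp.memLp g)

lemma smoothFourier_eq (hf : MemLp (fun x => (f x : ℂ)) 2) (η : ℝ)
    (t : EuclideanSpace ℝ (Fin n)) : smoothFourier η f t = ((2 * Real.pi) ^ n)⁻¹ *
      (cutoff n ((2 * Real.pi * η) • (2 * Real.pi)⁻¹ • t) *
        (𝓕 (hf.toLp _) : Lp ℂ 2 (volume : Measure (EuclideanSpace ℝ (Fin n))))
          ((2 * Real.pi)⁻¹ • t)) := by
  rw [smoothFourier, fourierL2, dif_pos hf, smul_smul,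
    show 2 * Real.pi * η * (2 * Real.pi)⁻¹ = η by field_simp]

lemma integrable_smoothFourier (hf : MemLp (fun x => (f x : ℂ)) 2) {η : ℝ} (hη : 0 < η) :
    Integrable (smoothFourier η f) := by
  have h := (integrable_cutoff_mul (η := 2 * Real.pi * η) (by positivity)
    (𝓕 (hf.toLp _))).comp_smul (R := (2 * Real.pi)⁻¹) (by positivity)
  exact (h.const_mul _).congr (Eventually.of_forall fun t => (smoothFourier_eq hf η t).symm)

/-- The frequency cutoff is an average of translates of f against a Schwartz kernel at scale 2πη;
this form is the one comparable with f pointwise. -/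
lemma smoothing_eq (hf : MemLp (fun x => (f x : ℂ)) 2) {η : ℝ} (hη : 0 < η)
    (x : EuclideanSpace ℝ (Fin n)) :
    smoothing η f x = ∫ v, smoothingKernel n v * f (x + (2 * Real.pi * η) • v) := by
  set g : Lp ℂ 2 (volume : Measure (EuclideanSpace ℝ (Fin n))) := hf.toLp _ with hg
  have hs : 0 < 2 * Real.pi * η := by positivity
  set s := 2 * Real.pi * η with hs'
  let φ : SchwartzMap (EuclideanSpace ℝ (Fin n)) ℂ :=
    (hasCompactSupport_modulatedCutoff hs.ne' x).toSchwartzMap (contDiff_modulatedCutoff s x)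
  -- As f is only in L², its transform is not an integral. The transform is moved onto the modulated
  -- cutoff, a Schwartz function, by duality of tempered distributions.
  have h1 : ∫ w, φ w • (𝓕 g : Lp ℂ 2 (volume : Measure (EuclideanSpace ℝ (Fin n)))) w =
      ∫ y, (𝓕 φ) y • g y := by
    rw [← Lp.toTemperedDistribution_apply, ← Lp.toTemperedDistribution_apply,
      ← Lp.fourier_toTemperedDistribution_eq, TemperedDistribution.fourier_apply]
  have h2 : smoothing η f x =
      ∫ w, φ w • (𝓕 g : Lp ℂ 2 (volume : Measure (EuclideanSpace ℝ (Fin n)))) w := by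
    have h := Measure.integral_comp_smul (volume : Measure (EuclideanSpace ℝ (Fin n)))
      (fun w => φ w • (𝓕 g : Lp ℂ 2 (volume : Measure (EuclideanSpace ℝ (Fin n)))) w)
      (2 * Real.pi)⁻¹
    rw [finrank_euclideanSpace_fin, abs_of_pos (by positivity), Complex.real_smul] at h
    have h' : smoothing η f x = ((((2 * Real.pi) ^ n)⁻¹ : ℝ) : ℂ) *
        ∫ t, φ ((2 * Real.pi)⁻¹ • t) •
          (𝓕 g : Lp ℂ 2 (volume : Measure (EuclideanSpace ℝ (Fin n)))) ((2 * Real.pi)⁻¹ • t) := by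
      rw [smoothing, ← integral_const_mul]
      refine integral_congr_ae (Eventually.of_forall fun t => ?_)
      simp only [smoothFourier_eq hf]
      rw [show φ ((2 * Real.pi)⁻¹ • t) = modulatedCutoff s x ((2 * Real.pi)⁻¹ • t) from rfl,
        modulatedCutoff, inner_smul_right, mul_inv_cancel_left₀ (by positivity)]
      push_cast
      simp only [smul_eq_mul]
      ring
    rw [h', h, ← mul_assoc, ← Complex.ofReal_mul]
    rw [show ((2 * Real.pi) ^ n)⁻¹ * (((2 * Real.pi)⁻¹ ^ n)⁻¹) = 1 by
      rw [inv_pow, inv_inv]; exact inv_mul_cancel₀ (by positivity)]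
    simp
  have h3 : ∫ y, (𝓕 φ) y • g y =
      ∫ y, (((s ^ n)⁻¹ : ℝ) : ℂ) * (smoothingKernel n (s⁻¹ • (y - x)) * f y) := by
    refine integral_congr_ae ?_
    filter_upwards [hf.coeFn_toLp] with y hy
    rw [hg, hy, SchwartzMap.fourier_coe, smul_eq_mul, ← mul_assoc,
      ← fourier_modulatedCutoff hs x y]
    rfl
  rw [h2, h1, h3, integral_const_mul]
  have h4 := integral_add_left_eq_self (μ := (volume : Measure (EuclideanSpace ℝ (Fin n))))
    (fun y => smoothingKernel n (s⁻¹ • (y - x)) * (f y : ℂ)) x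
  rw [← h4]
  have h5 := Measure.integral_comp_smul (volume : Measure (EuclideanSpace ℝ (Fin n)))
    (fun u => smoothingKernel n (s⁻¹ • (x + u - x)) * (f (x + u) : ℂ)) s
  rw [finrank_euclideanSpace_fin, abs_of_pos (by positivity), Complex.real_smul] at h5
  rw [← h5]
  refine integral_congr_ae (Eventually.of_forall fun v => ?_)
  simp only [add_sub_cancel_left]
  rw [inv_smul_smul₀ hs.ne']

/-- The distance of `f ∈ W^{1,∞}` to its smoothing at scale `η`. -/
lemma norm_smoothing_sub_le (hW : MemW1inf f) (hf : MemLp (fun x => (f x : ℂ)) 2) {η : ℝ}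
    (hη : 0 < η) (x : EuclideanSpace ℝ (Fin n)) :
    ‖smoothing η f x - f x‖ ≤ n * normW1inf f * (2 * Real.pi * η) *
      ∫ v, ‖v‖ ^ 1 * ‖smoothingKernel n v‖ := by
  have hs : 0 < 2 * Real.pi * η := by positivity
  have hK : Integrable (smoothingKernel n) := (smoothingKernel n).integrable
  have h0 : (f x : ℂ) = ∫ v, smoothingKernel n v * f x := by
    rw [integral_mul_const, integral_smoothingKernel, one_mul]
  have hi : Integrable fun v => smoothingKernel n v * f (x + (2 * Real.pi * η) • v) := by
    refine hK.mul_bdd (c := normW1inf f) ?_ ?_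
    · refine Continuous.aestronglyMeasurable (Complex.continuous_ofReal.comp
        (hW.continuous.comp (by fun_prop)))
    · exact Eventually.of_forall fun v => by
        rw [Complex.norm_real]; exact abs_le_normW1inf hW _
  rw [smoothing_eq hf hη, h0, ← integral_sub hi (hK.mul_const _), ← integral_const_mul]
  refine norm_integral_le_of_norm_le (((smoothingKernel n).integrable_pow_mul volume 1).const_mul _)
    (Eventually.of_forall fun v => ?_)
  rw [← mul_sub, norm_mul, ← Complex.ofReal_sub, Complex.norm_real, Real.norm_eq_abs]
  have h := hW.abs_sub_le (x + (2 * Real.pi * η) • v) x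
  rw [add_sub_cancel_left, norm_smul, Real.norm_of_nonneg hs.le] at h
  calc _ ≤ ‖smoothingKernel n v‖ * (n * normW1inf f * (2 * Real.pi * η * ‖v‖)) := by gcongr
    _ = _ := by ring

end

/-! ### Tensor powers of a difference of measures in Fourier variables -/

section

variable {n : ℕ} {α β : Measure ℝ}

lemma prod_charFun_sub (t : Fin n → ℝ) :
    ∏ i, (charFun α (t i) - charFun β (t i)) = ∑ S : Finset (Fin n), (-1 : ℂ) ^ (n - S.card) *
      ∏ i, charFun (if i ∈ S then α else β) (t i) := by
  simp only [sub_eq_add_neg]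
  rw [Finset.prod_add, Finset.powerset_univ]
  refine Finset.sum_congr rfl fun S _ => ?_
  have h : ∏ i, charFun (if i ∈ S then α else β) (t i) =
      (∏ i ∈ S, charFun α (t i)) * ∏ i ∈ Finset.univ \ S, charFun β (t i) := by
    rw [← Finset.prod_sdiff (Finset.subset_univ S), mul_comm]
    congr 1
    · exact Finset.prod_congr rfl fun i hi => by rw [if_pos hi]
    · exact Finset.prod_congr rfl fun i hi => by rw [if_neg (Finset.mem_sdiff.1 hi).2]
  rw [h, Finset.prod_neg, Finset.card_sdiff_of_subset (Finset.subset_univ S), Finset.card_univ,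
    Fintype.card_fin]
  ring

variable [IsProbabilityMeasure α] [IsProbabilityMeasure β]

instance isProbabilityMeasure_ite (S : Finset (Fin n)) (i : Fin n) :
    IsProbabilityMeasure (if i ∈ S then α else β) := by
  split_ifs <;> infer_instance

lemma integral_exp_inner_pi (ν : Fin n → Measure ℝ) [∀ i, IsProbabilityMeasure (ν i)]
    (t : EuclideanSpace ℝ (Fin n)) :
    ∫ ξ : Fin n → ℝ, Complex.exp (inner ℝ (WithLp.toLp 2 ξ) t * Complex.I) ∂(Measure.pi ν) =
      ∏ i, charFun (ν i) (t i) := by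
  simp only [charFun_apply_real]
  rw [← integral_fintype_prod_eq_prod (𝕜 := ℂ)]
  refine integral_congr_ae (Eventually.of_forall fun ξ => ?_)
  simp only
  rw [← Complex.exp_sum, ← Finset.sum_mul]
  congr 2
  simp [PiLp.inner_apply]

lemma integrable_prod_exp_inner (ν : Fin n → Measure ℝ) [∀ i, IsProbabilityMeasure (ν i)]
    {h : EuclideanSpace ℝ (Fin n) → ℂ} (hh : Integrable h) :
    Integrable (fun q : (Fin n → ℝ) × EuclideanSpace ℝ (Fin n) =>
      Complex.exp (inner ℝ (WithLp.toLp 2 q.1) q.2 * Complex.I) * h q.2)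
      ((Measure.pi ν).prod volume) := by
  refine (hh.comp_snd (Measure.pi ν)).bdd_mul (c := 1) ?_ ?_
  · refine Continuous.aestronglyMeasurable ?_
    have : Continuous fun q : (Fin n → ℝ) × EuclideanSpace ℝ (Fin n) =>
        inner ℝ (WithLp.toLp 2 q.1) q.2 := by fun_prop
    fun_prop
  · exact Eventually.of_forall fun q => by rw [Complex.norm_exp_ofReal_mul_I]

lemma integral_pi_fourier (ν : Fin n → Measure ℝ) [∀ i, IsProbabilityMeasure (ν i)]
    {h : EuclideanSpace ℝ (Fin n) → ℂ} (hh : Integrable h) :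
    Integrable (fun t => (∏ i, charFun (ν i) (t i)) * h t) ∧
    ∫ ξ : Fin n → ℝ, (∫ t, Complex.exp (inner ℝ (WithLp.toLp 2 ξ) t * Complex.I) * h t)
      ∂(Measure.pi ν) = ∫ t, (∏ i, charFun (ν i) (t i)) * h t := by
  have hint := integrable_prod_exp_inner ν hh
  have e : ∀ t, ∫ ξ : Fin n → ℝ, Complex.exp (inner ℝ (WithLp.toLp 2 ξ) t * Complex.I) * h t
      ∂(Measure.pi ν) = (∏ i, charFun (ν i) (t i)) * h t := fun t => by
    rw [integral_mul_const, integral_exp_inner_pi]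
  refine ⟨hint.integral_prod_right.congr (Eventually.of_forall e), ?_⟩
  rw [integral_integral_swap hint]
  simp only [e]

/-- The Fourier representation of `∫ F d(α - β)^{⊗ n}`. -/
lemma sum_integral_pi_fourier {h : EuclideanSpace ℝ (Fin n) → ℂ} (hh : Integrable h) :
    ∑ S : Finset (Fin n), (-1 : ℂ) ^ (n - S.card) *
      ∫ ξ : Fin n → ℝ, (∫ t, Complex.exp (inner ℝ (WithLp.toLp 2 ξ) t * Complex.I) * h t)
        ∂(Measure.pi fun i => if i ∈ S then α else β) =
      ∫ t, (∏ i, (charFun α (t i) - charFun β (t i))) * h t := by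
  have := fun S : Finset (Fin n) => integral_pi_fourier (fun i => if i ∈ S then α else β) hh
  simp only [(this _).2, prod_charFun_sub, Finset.sum_mul, mul_assoc]
  rw [integral_finsetSum _ fun S _ => (this S).1.const_mul _]
  simp only [integral_const_mul]

/-! ### The Cauchy–Schwarz bound -/

end

section

variable {n : ℕ} {α β : Measure ℝ} {η : ℝ}

lemma integrable_comp_abs {g : ℝ → ℝ} (hg : IntegrableOn g (Set.Ioi 0)) :
    Integrable fun t => g |t| := by
  have h1 : IntegrableOn (fun t => g |t|) (Set.Ioi 0) :=
    hg.congr_fun (fun t ht => by rw [abs_of_pos ht]) measurableSet_Ioi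
  have h2 : IntegrableOn (fun t => g |t|) (Set.Iic 0) := by
    have m : MeasurableEmbedding fun x : ℝ => -x := (Homeomorph.neg ℝ).measurableEmbedding
    rw [← Measure.map_neg_eq_self (volume : Measure ℝ)]
    change IntegrableOn _ _ (Measure.map (fun x : ℝ => -x) volume)
    rw [m.integrableOn_map_iff]
    simp only [Function.comp_def, abs_neg, Set.neg_preimage, Set.neg_Iic, neg_zero]
    exact Iff.mpr integrableOn_Ici_iff_integrableOn_Ioi h1
  rw [← integrableOn_univ, ← Set.Iic_union_Ioi (a := (0 : ℝ))]
  exact h2.union h1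

/-- The integrand of the energy distance, extended to an even function. -/
def energyDensity (η : ℝ) (α β : Measure ℝ) (t : ℝ) : ℝ :=
  Real.exp (-(η * |t|)) / |t| * ‖charFun α t - charFun β t‖ ^ 2

lemma energyDensity_nonneg (t : ℝ) : 0 ≤ energyDensity η α β t := by
  unfold energyDensity; positivity

lemma energyDensity_eq (t : ℝ) : energyDensity η α β t =
    (fun s => Real.exp (-(η * s)) / s * ‖charFun α s - charFun β s‖ ^ 2) |t| := by
  unfold energyDensity
  rcases abs_choice t with h | h <;> simp only [h]
  rw [charFun_neg, charFun_neg, ← map_sub, RCLike.norm_conj]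

lemma integrable_energyDensity
    (hD : IntegrableOn (fun t => Real.exp (-(η * t)) / t * ‖charFun α t - charFun β t‖ ^ 2)
      (Set.Ioi 0)) : Integrable (energyDensity η α β) :=
  (integrable_comp_abs hD).congr (Eventually.of_forall fun t => (energyDensity_eq t).symm)

lemma integral_energyDensity : ∫ t, energyDensity η α β t = 2 * energyDistSq η α β := by
  simp only [energyDensity_eq]
  exact integral_comp_abs (f := fun s => Real.exp (-(η * s)) / s * ‖charFun α s - charFun β s‖ ^ 2)

lemma energyDistSq_nonneg : 0 ≤ energyDistSq η α β := by
  have : 0 ≤ ∫ t, energyDensity η α β t := integral_nonneg energyDensity_nonneg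
  rw [integral_energyDensity] at this
  linarith

lemma lintegral_prod_energyDensity
    (hD : IntegrableOn (fun t => Real.exp (-(η * t)) / t * ‖charFun α t - charFun β t‖ ^ 2)
      (Set.Ioi 0)) {k : ℝ} (hk : 0 ≤ k) :
    ∫⁻ t : EuclideanSpace ℝ (Fin n), ENNReal.ofReal (∏ i, (k * energyDensity η α β (t i))) =
      ENNReal.ofReal ((k * (2 * energyDistSq η α β)) ^ n) := by
  have h := (PiLp.volume_preserving_toLp (Fin n)).lintegral_comp_emb
    (MeasurableEquiv.toLp 2 (Fin n → ℝ)).measurableEmbedding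
    (fun t : EuclideanSpace ℝ (Fin n) => ENNReal.ofReal (∏ i, (k * energyDensity η α β (t i))))
  rw [← h]
  have hi := (integrable_energyDensity hD).const_mul k
  rw [lintegral_prod_eq_prod_of_integrable
    (f := fun _ : Fin n => fun s => k * energyDensity η α β s) (fun _ => hi)
    (fun _ s => mul_nonneg hk (energyDensity_nonneg s)),
    ← ofReal_integral_eq_lintegral_ofReal hi
      (Eventually.of_forall fun s => mul_nonneg hk (energyDensity_nonneg s)),
    integral_const_mul, integral_energyDensity, Finset.prod_const, Finset.card_univ,
    Fintype.card_fin, ENNReal.ofReal_pow (mul_nonneg hk (mul_nonneg two_pos.le energyDistSq_nonneg))]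

end

section

variable {n : ℕ} {α β : Measure ℝ} [IsProbabilityMeasure α] [IsProbabilityMeasure β] {η : ℝ}
  {f : EuclideanSpace ℝ (Fin n) → ℝ}

/-- Where the cutoff is nonzero, η |t_i| < 2, so e² e^{-η|t_i|} ≥ 1; also (1 + ‖t‖)/|t_i| ≥ 1.
Inserting both factors for each i turns the product of characteristic functions into energy
densities, at the price of (1 + ‖t‖)^n, the weight of H^{n/2}. -/
lemma cutoff_mul_prod_le (hη : 0 < η) (t : EuclideanSpace ℝ (Fin n)) :
    cutoff n (η • t) * ∏ i, ‖charFun α (t i) - charFun β (t i)‖ ≤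
      √((1 + ‖t‖) ^ n) * √(∏ i, (Real.exp 2 * energyDensity η α β (t i))) := by
  rcases le_or_gt 2 ‖η • t‖ with ht | ht
  · rw [(cutoff n).zero_of_le_dist (by simpa [cutoff] using ht), zero_mul]
    positivity
  refine (mul_le_of_le_one_left (by positivity) (cutoff n).le_one).trans ?_
  -- On the coordinate hyperplanes 1/|t_i| is 0 by convention, but the left side vanishes since
  -- characteristic functions agree at 0.
  by_cases h0 : ∃ i, t i = 0
  · obtain ⟨i, hi⟩ := h0
    rw [Finset.prod_eq_zero (Finset.mem_univ i) (by simp [hi])]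
    positivity
  push Not at h0
  rw [← Real.sqrt_mul (by positivity)]
  refine Real.le_sqrt_of_sq_le ?_
  rw [← Finset.prod_pow, show (1 + ‖t‖) ^ n = ∏ _i : Fin n, (1 + ‖t‖) by simp,
    ← Finset.prod_mul_distrib]
  refine Finset.prod_le_prod (fun i _ => by positivity) fun i _ => ?_
  have hti : 0 < |t i| := abs_pos.2 (h0 i)
  have hle : |t i| ≤ ‖t‖ := PiLp.norm_apply_le t i
  rw [norm_smul, Real.norm_of_nonneg hη.le] at ht
  have h1 : 1 ≤ Real.exp 2 * Real.exp (-(η * |t i|)) := by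
    rw [← Real.exp_add]
    refine Real.one_le_exp ?_
    have := mul_le_mul_of_nonneg_left hle hη.le
    linarith
  have h2 : 1 ≤ (1 + ‖t‖) / |t i| := by rw [le_div_iff₀ hti]; linarith
  rw [energyDensity]
  calc _ ≤ ((1 + ‖t‖) / |t i| * (Real.exp 2 * Real.exp (-(η * |t i|)))) *
        ‖charFun α (t i) - charFun β (t i)‖ ^ 2 :=
      le_mul_of_one_le_left (by positivity) (one_le_mul_of_one_le_of_one_le h2 h1)
    _ = _ := by ring

lemma measurable_fourierL2 (hf : MemLp (fun x => (f x : ℂ)) 2) : Measurable (fourierL2 f) := by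
  have : fourierL2 f = fun t =>
    (𝓕 (hf.toLp (fun x => (f x : ℂ))) : Lp ℂ 2 (volume : Measure (EuclideanSpace ℝ (Fin n))))
      ((2 * Real.pi)⁻¹ • t) := by
    ext t; rw [fourierL2, dif_pos hf]
  rw [this]
  exact (Lp.stronglyMeasurable _).measurable.comp (measurable_const_smul _)

/-- Cauchy–Schwarz after the pointwise bound: one factor is exactly the H^{n/2} norm, the other a
product integral that factorises into n copies of 2e² D². The normalisation (2π)^{-n} is bounded by
1. -/
lemma norm_integral_prod_charFun_le (hH : MemH ((n : ℝ) / 2) f)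
    (hf : MemLp (fun x => (f x : ℂ)) 2) (hη : 0 < η)
    (hD : IntegrableOn (fun t => Real.exp (-(η * t)) / t * ‖charFun α t - charFun β t‖ ^ 2)
      (Set.Ioi 0)) :
    ‖∫ t, (∏ i, (charFun α (t i) - charFun β (t i))) * smoothFourier η f t‖ ≤
      normH ((n : ℝ) / 2) f * √((Real.exp 2 * (2 * energyDistSq η α β)) ^ n) := by
  set A : EuclideanSpace ℝ (Fin n) → ℝ≥0∞ := fun t =>
    ENNReal.ofReal (√((1 + ‖t‖) ^ n)) * ‖fourierL2 f t‖ₑ with hA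
  set B : EuclideanSpace ℝ (Fin n) → ℝ≥0∞ := fun t =>
    ENNReal.ofReal (√(∏ i, (Real.exp 2 * energyDensity η α β (t i)))) with hB
  have hAm : AEMeasurable A volume := by
    refine AEMeasurable.mul (Measurable.aemeasurable ?_)
      (measurable_fourierL2 hf).enorm.aemeasurable
    fun_prop
  have hBm : AEMeasurable B volume := by
    refine Measurable.aemeasurable (Measurable.ennreal_ofReal (Measurable.sqrt ?_))
    refine Finset.measurable_prod _ fun i _ => Measurable.const_mul ?_ _
    have hc : Measurable fun t : ℝ => charFun α t - charFun β t :=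
      (continuous_charFun.sub continuous_charFun).measurable
    have : Measurable (energyDensity η α β) := by
      unfold energyDensity
      fun_prop
    fun_prop
  have hAB : ∀ t, ‖(∏ i, (charFun α (t i) - charFun β (t i))) * smoothFourier η f t‖ₑ ≤
      (A * B) t := by
    intro t
    rw [← ofReal_norm, Pi.mul_apply, hA, hB]
    simp only
    rw [← ofReal_norm (fourierL2 f t), mul_right_comm,
      ← ENNReal.ofReal_mul (Real.sqrt_nonneg _), ← ENNReal.ofReal_mul (by positivity)]
    refine ENNReal.ofReal_le_ofReal ?_
    have h1 : ((2 * Real.pi) ^ n)⁻¹ ≤ 1 := by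
      refine inv_le_one_of_one_le₀ (one_le_pow₀ ?_)
      linarith [Real.pi_gt_three]
    simp only [smoothFourier, norm_mul, norm_prod, Complex.norm_real]
    rw [Real.norm_of_nonneg (cutoff n).nonneg,
      Real.norm_of_nonneg (show 0 ≤ ((2 * Real.pi) ^ n)⁻¹ by positivity)]
    have h2 := cutoff_mul_prod_le (α := α) (β := β) hη t
    have hc : 0 ≤ cutoff n (η • t) := (cutoff n).nonneg
    calc _ = ((2 * Real.pi) ^ n)⁻¹ *
          ((cutoff n (η • t) * ∏ i, ‖charFun α (t i) - charFun β (t i)‖) * ‖fourierL2 f t‖) := by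
          ring
      _ ≤ 1 * ((√((1 + ‖t‖) ^ n) * √(∏ i, (Real.exp 2 * energyDensity η α β (t i)))) *
          ‖fourierL2 f t‖) := by gcongr
      _ = _ := by ring
  have hA2 : ∫⁻ t, A t ^ (2 : ℝ) = normHSq ((n : ℝ) / 2) f := by
    refine lintegral_congr fun t => ?_
    rw [hA]
    simp only [ENNReal.rpow_two]
    rw [mul_pow, ← ENNReal.ofReal_pow (Real.sqrt_nonneg _), Real.sq_sqrt (by positivity),
      mul_div_cancel₀ _ (two_ne_zero), Real.rpow_natCast]
  have hB2 : ∫⁻ t, B t ^ (2 : ℝ) =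
      ENNReal.ofReal ((Real.exp 2 * (2 * energyDistSq η α β)) ^ n) := by
    rw [← lintegral_prod_energyDensity hD (Real.exp_pos 2).le]
    refine lintegral_congr fun t => ?_
    rw [hB]
    simp only [ENNReal.rpow_two]
    rw [← ENNReal.ofReal_pow (Real.sqrt_nonneg _), Real.sq_sqrt]
    exact Finset.prod_nonneg fun i _ => mul_nonneg (Real.exp_pos 2).le (energyDensity_nonneg _)
  have h := (enorm_integral_le_lintegral_enorm _).trans ((lintegral_mono hAB).trans
    (ENNReal.lintegral_mul_le_Lp_mul_Lq volume Real.HolderConjugate.two_two hAm hBm))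
  rw [hA2, hB2] at h
  have hfin : normHSq ((n : ℝ) / 2) f ^ (1 / 2 : ℝ) *
      ENNReal.ofReal ((Real.exp 2 * (2 * energyDistSq η α β)) ^ n) ^ (1 / 2 : ℝ) ≠ ⊤ :=
    ENNReal.mul_ne_top (ENNReal.rpow_ne_top_of_nonneg (by norm_num) hH.finite.ne)
      (ENNReal.rpow_ne_top_of_nonneg (by norm_num) ENNReal.ofReal_ne_top)
  have h' := ENNReal.toReal_mono hfin h
  rw [toReal_enorm, ENNReal.toReal_mul, ← ENNReal.toReal_rpow, ← ENNReal.toReal_rpow,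
    ENNReal.toReal_ofReal, ← Real.sqrt_eq_rpow, ← Real.sqrt_eq_rpow] at h'
  · exact h'
  · exact pow_nonneg (mul_nonneg (Real.exp_pos 2).le
      (mul_nonneg two_pos.le energyDistSq_nonneg)) n

/-- The multilinear statistic of `f` is controlled by the energy distance, up to a
regularisation error. -/
theorem abs_integralTensorDiff_le (hW : MemW1inf f) (hH : MemH ((n : ℝ) / 2) f) (hη : 0 < η)
    (hD : IntegrableOn (fun t => Real.exp (-(η * t)) / t * ‖charFun α t - charFun β t‖ ^ 2)
      (Set.Ioi 0)) :
    |integralTensorDiff α β f| ≤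
      2 ^ n * (n * normW1inf f * (2 * Real.pi * η) * ∫ v, ‖v‖ ^ 1 * ‖smoothingKernel n v‖) +
      normH ((n : ℝ) / 2) f * √((Real.exp 2 * (2 * energyDistSq η α β)) ^ n) := by
  have hf : MemLp (fun x => (f x : ℂ)) 2 := hH.memLp.ofReal
  have hh := integrable_smoothFourier hf hη
  have hsum := sum_integral_pi_fourier (α := α) (β := β) hh
  have hbound := norm_integral_prod_charFun_le (α := α) (β := β) hH hf hη hD
  rw [← hsum] at hbound
  set δ := n * normW1inf f * (2 * Real.pi * η) * ∫ v, ‖v‖ ^ 1 * ‖smoothingKernel n v‖ with hδ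
  set I : Finset (Fin n) → ℂ := fun S => ∫ ξ : Fin n → ℝ, smoothing η f (WithLp.toLp 2 ξ)
    ∂(Measure.pi fun i => if i ∈ S then α else β) with hI
  -- The statistic of f is that of its smoothing minus the smoothing error; the latter is bounded
  -- uniformly for each of the 2^n product measures.
  have hsplit : (integralTensorDiff α β f : ℂ) = ∑ S, (-1 : ℂ) ^ (n - S.card) * I S -
      ∑ S : Finset (Fin n), (-1 : ℂ) ^ (n - S.card) * ∫ ξ : Fin n → ℝ,
        (smoothing η f (WithLp.toLp 2 ξ) - f (WithLp.toLp 2 ξ))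
          ∂(Measure.pi fun i => if i ∈ S then α else β) := by
    rw [integralTensorDiff, ← Finset.sum_sub_distrib]
    push_cast
    refine Finset.sum_congr rfl fun S _ => ?_
    have h1 : Integrable (fun ξ : Fin n → ℝ => smoothing η f (WithLp.toLp 2 ξ))
        (Measure.pi fun i => if i ∈ S then α else β) :=
      (integrable_prod_exp_inner (fun i => if i ∈ S then α else β) hh).integral_prod_left
    have h2 : Integrable (fun ξ : Fin n → ℝ => (f (WithLp.toLp 2 ξ) : ℂ))
        (Measure.pi fun i => if i ∈ S then α else β) := by
      refine (integrable_const (normW1inf f)).mono' ?_ (Eventually.of_forall fun ξ => ?_)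
      · exact (Complex.continuous_ofReal.comp
          (hW.continuous.comp (by fun_prop))).aestronglyMeasurable
      · rw [Complex.norm_real]; exact abs_le_normW1inf hW _
    rw [integral_sub h1 h2, ← integral_complex_ofReal]
    ring
  rw [← Real.norm_eq_abs, ← Complex.norm_real, hsplit]
  refine (norm_sub_le _ _).trans ?_
  rw [add_comm]
  refine add_le_add ?_ hbound
  refine (norm_sum_le_of_le (f := fun S : Finset (Fin n) => (-1 : ℂ) ^ (n - S.card) *
    ∫ ξ : Fin n → ℝ, (smoothing η f (WithLp.toLp 2 ξ) - f (WithLp.toLp 2 ξ))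
      ∂(Measure.pi fun i => if i ∈ S then α else β)) Finset.univ (n := fun _ => δ)
      fun S _ => ?_).trans_eq ?_
  · rw [norm_mul, norm_pow, norm_neg, norm_one, one_pow, one_mul]
    refine (norm_integral_le_of_norm_le (integrable_const δ) (Eventually.of_forall fun ξ =>
      norm_smoothing_sub_le hW hf hη _)).trans_eq ?_
    simp
  · simp

end

/-! ### The bound on linear statistics -/

/-- Case split at d = u: below it monotonicity is enough, above it (d/u)^{n/2} ≤ (d/u)^j. An integer
power j is what the factorial moment bound controls. -/
lemma sqrt_pow_le_of_pos {k d u : ℝ} {n j : ℕ} (hk : 0 ≤ k) (hd : 0 ≤ d) (hu : 0 < u)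
    (hj : n ≤ 2 * j) : √((k * d) ^ n) ≤ √(k ^ n) * √(u ^ n) * (1 + (d / u) ^ j) := by
  rw [mul_pow, Real.sqrt_mul (by positivity), mul_assoc]
  refine mul_le_mul_of_nonneg_left ?_ (Real.sqrt_nonneg _)
  rcases le_or_gt d u with h | h
  · refine (Real.sqrt_le_sqrt (pow_le_pow_left₀ hd h n)).trans ?_
    exact le_mul_of_one_le_right (Real.sqrt_nonneg _) (le_add_of_nonneg_right (by positivity))
  · have h1 : 1 ≤ d / u := (one_le_div hu).2 h.le
    have h2 : d ^ n = u ^ n * (d / u) ^ n := by rw [← mul_pow, mul_div_cancel₀ _ hu.ne']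
    rw [h2, Real.sqrt_mul (by positivity)]
    refine mul_le_mul_of_nonneg_left ?_ (Real.sqrt_nonneg _)
    refine (Real.sqrt_le_sqrt (pow_le_pow_right₀ h1 hj)).trans ?_
    rw [mul_comm 2 j, pow_mul, Real.sqrt_sq (by positivity)]
    linarith

lemma pow_mul_exp_neg_le {a d : ℝ} (ha : 0 < a) (hd : 0 ≤ d) (j : ℕ) :
    d ^ j * Real.exp (-(a * d)) ≤ j.factorial / a ^ j := by
  have h := Real.pow_div_factorial_le_exp (a * d) (by positivity) j
  rw [Real.exp_neg, ← div_eq_mul_inv, div_le_div_iff₀ (Real.exp_pos _) (by positivity)]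
  rw [div_le_iff₀ (by positivity), mul_pow] at h
  linarith

lemma normH_nonneg {n : ℕ} (m : ℝ) (f : EuclideanSpace ℝ (Fin n) → ℝ) : 0 ≤ normH m f :=
  Real.sqrt_nonneg _

/-- The regularisation scale. -/
def regScale (n N : ℕ) : ℝ := ((1 + regConst) ^ 2 * (N : ℝ) ^ (n + 2))⁻¹

section

variable {n N : ℕ}

lemma regScale_pos (hN : 1 ≤ N) : 0 < regScale n N := by
  have := regConst_nonneg
  have : (0 : ℝ) < N := by exact_mod_cast hN
  unfold regScale; positivity

lemma regScale_le (hN : 1 ≤ N) : regScale n N ≤ ((N : ℝ) ^ (n + 2))⁻¹ := by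
  have h := regConst_nonneg
  have hN' : (0 : ℝ) < N := by exact_mod_cast hN
  refine inv_anti₀ (by positivity) (le_mul_of_one_le_left (by positivity) ?_)
  exact one_le_pow₀ (by linarith)

lemma regScale_le_one (hN : 1 ≤ N) : regScale n N ≤ 1 :=
  (regScale_le hN).trans (inv_le_one_of_one_le₀ (one_le_pow₀ (by exact_mod_cast hN)))

/-- This is what the scale is designed for: the regularisation error, summed over the N particles,
stays bounded apart from the factor 1 + K. -/
lemma natCast_mul_regConst_mul_sqrt_le (hN : 1 ≤ N) : N * regConst * √(regScale n N) ≤ 1 := by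
  have h := regConst_nonneg
  have hN' : (1 : ℝ) ≤ N := by exact_mod_cast hN
  have h1 : √(regScale n N) ≤ ((1 + regConst) * N)⁻¹ := by
    refine Real.sqrt_le_iff.2 ⟨by positivity, ?_⟩
    rw [regScale, inv_pow, mul_pow]
    refine inv_anti₀ (by positivity) (mul_le_mul_of_nonneg_left ?_ (by positivity))
    exact pow_le_pow_right₀ hN' (by omega)
  calc N * regConst * √(regScale n N) ≤ N * regConst * ((1 + regConst) * N)⁻¹ := by gcongr
    _ = regConst / (1 + regConst) := by field_simp
    _ ≤ 1 := by rw [div_le_one (by positivity)]; linarith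

lemma neg_mul_log_regScale (P : ℝ) (hN : 1 ≤ N) : -(P * Real.log (regScale n N)) =
    2 * P * Real.log (1 + regConst) + (n + 2) * P * Real.log N := by
  have h := regConst_nonneg
  have hN' : (0 : ℝ) < N := by exact_mod_cast hN
  rw [regScale, Real.log_inv, Real.log_mul (by positivity) (by positivity), Real.log_pow,
    Real.log_pow]
  push_cast
  ring

variable {P : ℝ} {V : ℝ → ℝ} {μ : Measure ℝ}

/-- The regularisation costs at most 2P(1 + K), whose K-part has exactly the coefficient appearing
in K_V, and η^{-P} becomes the power N^{(n+2)P}. -/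
lemma regScale_exponent_le (hP : 0 < P) (hN : 1 ≤ N) {K : ℝ} (hK : 0 ≤ K) :
    Real.exp (P * logEnergy μ - P * Real.log (regScale n N) +
        2 * P * N * (regConst * (1 + K) * √(regScale n N))) ≤
      Real.exp (2 * P * Real.log (1 + regConst) + 2 * P) *
        Real.exp (2 * P * K + P * |logEnergy μ|) * (N : ℝ) ^ ((n + 2) * P : ℝ) := by
  have hN' : (0 : ℝ) < N := by exact_mod_cast hN
  rw [Real.rpow_def_of_pos hN', ← Real.exp_add, ← Real.exp_add, Real.exp_le_exp]
  have h1 := neg_mul_log_regScale (n := n) P hN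
  have h2 := mul_le_mul_of_nonneg_left (natCast_mul_regConst_mul_sqrt_le (n := n) hN)
    (show 0 ≤ 2 * P * (1 + K) by positivity)
  have h3 := mul_le_mul_of_nonneg_left (le_abs_self (logEnergy μ)) hP.le
  nlinarith

/-- The expectation of the multilinear statistic, in terms of an arbitrary scale `u`. -/
lemma abs_linearStatistic_le (hP : 0 < P) (hμ : IsEquilibriumMeasure P V μ)
    (hV : Admissible V μ) {f : EuclideanSpace ℝ (Fin n) → ℝ} (hW : MemW1inf f)
    (hH : MemH ((n : ℝ) / 2) f) (hN : 1 ≤ N) {u : ℝ} (hu : 0 < u) {j : ℕ} (hj : n ≤ 2 * j) :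
    |linearStatistic P V μ N f| ≤
      2 ^ n * (n * normW1inf f * (2 * Real.pi * regScale n N) *
        ∫ v, ‖v‖ ^ 1 * ‖smoothingKernel n v‖) +
      normH ((n : ℝ) / 2) f * (√((2 * Real.exp 2) ^ n) * √(u ^ n)) *
        (1 + j.factorial / (P * N * u) ^ j *
          (Real.exp (2 * P * Real.log (1 + regConst) + 2 * P) *
            Real.exp (2 * P * (eLpNorm (hilbertTransform (density μ)) ⊤ volume).toReal +
              P * |logEnergy μ|) * (N : ℝ) ^ ((n + 2) * P : ℝ))) := by
  have hprob := hμ.finite.isProbabilityMeasure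
  have hN' : (0 : ℝ) < N := by exact_mod_cast hN
  have hη := regScale_pos (n := n) hN
  have hη1 := regScale_le_one (n := n) hN
  set η := regScale n N with hη_def
  set a := 2 ^ n * (n * normW1inf f * (2 * Real.pi * η) *
    ∫ v, ‖v‖ ^ 1 * ‖smoothingKernel n v‖) with ha
  set b := normH ((n : ℝ) / 2) f * (√((2 * Real.exp 2) ^ n) * √(u ^ n)) with hb
  have ha0 : 0 ≤ a := by
    have := normW1inf_nonneg f
    have : 0 ≤ ∫ v, ‖v‖ ^ 1 * ‖smoothingKernel n v‖ := integral_nonneg fun v => by positivity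
    positivity
  have hb0 : 0 ≤ b := by unfold b normH; positivity
  -- Bounding the statistic by a constant plus a multiple of D^{2j} leaves only one moment of the
  -- energy distance to integrate.
  have hpt : ∀ x : Fin N → ℝ, |integralTensorDiff (empiricalMeasure x) μ f| ≤
      (a + b) + b / u ^ j * energyDistSq η (empiricalMeasure x) μ ^ j := by
    intro x
    have := isProbabilityMeasure_empiricalMeasure hN x
    have hD := (energyDistSq_eq hη hη1 (integrable_empiricalMeasure x hN)
      (integrable_log_one_add_of_interaction hμ.finite.interaction)).1
    have h1 := abs_integralTensorDiff_le hW hH hη hD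
    have h2 := sqrt_pow_le_of_pos (k := 2 * Real.exp 2) (n := n) (j := j) (by positivity)
      (energyDistSq_nonneg (η := η) (α := empiricalMeasure x) (β := μ)) hu hj
    have h3 := mul_le_mul_of_nonneg_left h2 (normH_nonneg ((n : ℝ) / 2) f)
    rw [show Real.exp 2 * (2 * energyDistSq η (empiricalMeasure x) μ) =
      2 * Real.exp 2 * energyDistSq η (empiricalMeasure x) μ by ring] at h1
    refine h1.trans ((add_le_add_right h3 _).trans_eq ?_)
    rw [div_pow, hb, ha]
    ring
  have hexp : ∫⁻ x, ENNReal.ofReal (b / u ^ j * energyDistSq η (empiricalMeasure x) μ ^ j)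
      ∂(particleLaw P V N) ≤ _ :=
    lintegral_particleLaw_le hμ hV hP hN hη hη1
      (B := b / u ^ j * (j.factorial / (P * N) ^ j)) (by positivity) fun x => by
        rw [mul_assoc]
        exact mul_le_mul_of_nonneg_left (pow_mul_exp_neg_le (by positivity) energyDistSq_nonneg j)
          (by positivity)
  set K := (eLpNorm (hilbertTransform (density μ)) ⊤ volume).toReal with hK
  set T := Real.exp (2 * P * Real.log (1 + regConst) + 2 * P) *
    Real.exp (2 * P * K + P * |logEnergy μ|) * (N : ℝ) ^ ((n + 2) * P : ℝ) with hT
  have hT0 : 0 ≤ T := by positivity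
  have hexp' := hexp.trans (ENNReal.ofReal_le_ofReal (mul_le_mul_of_nonneg_left
    (regScale_exponent_le (n := n) (μ := μ) hP hN (ENNReal.toReal_nonneg : 0 ≤ K))
    (show 0 ≤ b / u ^ j * (j.factorial / (P * N) ^ j) by positivity)))
  have hle : ENNReal.ofReal |linearStatistic P V μ N f| ≤
      ENNReal.ofReal (a + b + b / u ^ j * (j.factorial / (P * N) ^ j) * T) := by
    rw [← Real.enorm_eq_ofReal_abs]
    refine (enorm_integral_le_lintegral_enorm _).trans ?_
    calc _ ≤ ∫⁻ x, (ENNReal.ofReal (a + b) +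
          ENNReal.ofReal (b / u ^ j * energyDistSq η (empiricalMeasure x) μ ^ j))
            ∂(particleLaw P V N) := by
          refine lintegral_mono fun x => ?_
          rw [Real.enorm_eq_ofReal_abs, ← ENNReal.ofReal_add (by positivity)
            (mul_nonneg (by positivity) (pow_nonneg energyDistSq_nonneg j))]
          exact ENNReal.ofReal_le_ofReal (hpt x)
      _ ≤ ENNReal.ofReal (a + b) +
          ENNReal.ofReal (b / u ^ j * (j.factorial / (P * N) ^ j) * T) := by
          rw [lintegral_add_left measurable_const, lintegral_const]
          exact add_le_add (mul_le_of_le_one_right zero_le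
            (particleLaw_univ_le hV.smooth.continuous)) hexp'
      _ = _ := (ENNReal.ofReal_add (by positivity) (by positivity)).symm
  rw [ENNReal.ofReal_le_ofReal_iff (by positivity)] at hle
  refine hle.trans_eq ?_
  rw [mul_pow (P * N) u j]
  field_simp
  ring

end

/-- The a priori bound on multilinear statistics. -/
theorem exists_abs_linearStatistic_le (P : ℝ) (hP : 0 < P) (c : ℝ) (ε : ℝ) (hε : 0 < ε) (n : ℕ) :
    ∃ C : ℝ, 0 < C ∧
      ∀ (V : ℝ → ℝ) (μ : Measure ℝ),
        IsEquilibriumMeasure P V μ → Admissible V μ →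
        ∀ f : EuclideanSpace ℝ (Fin n) → ℝ,
          MemW1inf f → MemH ((n : ℝ) / 2) f →
          ∀ N : ℕ, 1 ≤ N →
            |linearStatistic P V μ N f| ≤
              C * Real.exp (constK P c μ) / (N : ℝ) ^ ((n : ℝ) / 2 * (1 - ε)) *
                (normW1inf f + normH ((n : ℝ) / 2) f) := by
  -- The first lower bound makes N^{εj} beat N^{(n+2)P}; the second ensures n ≤ 2j.
  obtain ⟨j, hj⟩ := exists_nat_ge (max ((n + 2) * P / ε) n)
  have hjε : (n + 2) * P ≤ ε * j := by
    rw [← div_le_iff₀' hε]; exact (le_max_left _ _).trans hj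
  have hjn : n ≤ 2 * j := by
    have : n ≤ j := by exact_mod_cast (le_max_right _ _).trans hj
    omega
  set M := ∫ v, ‖v‖ ^ 1 * ‖smoothingKernel n v‖ with hM
  have hM0 : 0 ≤ M := integral_nonneg fun v => by positivity
  set a := 2 ^ n * (n * (2 * Real.pi) * M) with ha
  set A := Real.exp (2 * P * Real.log (1 + regConst) + 2 * P) with hA
  set s := √((2 * Real.exp 2) ^ n) with hs
  set J : ℝ := j.factorial / P ^ j with hJ
  have ha0 : 0 ≤ a := by positivity
  have hs0 : 0 < s := by positivity
  -- The factor e^{-c} undoes the constant c in K_V; a is the smoothing error, s(1 + JA) the main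
  -- term together with the moment contribution.
  refine ⟨Real.exp (-c) * (a + s * (1 + J * A)), by positivity, ?_⟩
  intro V μ hμ hV f hW hH N hN
  have hN1 : (1 : ℝ) ≤ N := by exact_mod_cast hN
  have hN0 : (0 : ℝ) < N := by linarith
  -- Slightly above the typical size 1/N of D²: then u^{n/2} is the claimed rate and N u = N^ε is
  -- the gain per moment.
  set u : ℝ := (N : ℝ) ^ (-(1 - ε)) with hu
  have hu0 : 0 < u := Real.rpow_pos_of_pos hN0 _
  set r : ℝ := ((N : ℝ) ^ ((n : ℝ) / 2 * (1 - ε)))⁻¹ with hr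
  have hr0 : 0 < r := by positivity
  have hur : √(u ^ n) = r := by
    rw [Real.sqrt_eq_rpow, hu, ← Real.rpow_natCast, ← Real.rpow_mul hN0.le,
      ← Real.rpow_mul hN0.le, hr, ← Real.rpow_neg hN0.le]
    congr 1
    ring
  have hη : regScale n N ≤ r := by
    refine (regScale_le hN).trans (inv_anti₀ (by positivity) ?_)
    rw [← Real.rpow_natCast]
    refine Real.rpow_le_rpow_of_exponent_le hN1 ?_
    push_cast
    have : (0 : ℝ) ≤ n := Nat.cast_nonneg n
    nlinarith
  set K := (eLpNorm (hilbertTransform (density μ)) ⊤ volume).toReal with hK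
  have hK0 : 0 ≤ K := ENNReal.toReal_nonneg
  set G := Real.exp (2 * P * K + P * |logEnergy μ|) with hG
  -- Allows the terms that do not carry the exponential factor to be multiplied by it.
  have hG1 : 1 ≤ G := Real.one_le_exp (by positivity)
  have hexpK : Real.exp (-c) * Real.exp (constK P c μ) = G := by
    rw [← Real.exp_add, constK, hG]
    congr 1
    ring
  have hNu : j.factorial / (P * N * u) ^ j * (A * G * (N : ℝ) ^ ((n + 2) * P : ℝ)) ≤
      J * A * G := by
    have h1 : (N : ℝ) ^ ((n + 2) * P : ℝ) ≤ (N * u) ^ j := by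
      have : (N : ℝ) * u = (N : ℝ) ^ ε := by
        rw [hu, ← Real.rpow_one_add' hN0.le (by linarith)]
        congr 1
        ring
      rw [this, ← Real.rpow_natCast, ← Real.rpow_mul hN0.le]
      exact Real.rpow_le_rpow_of_exponent_le hN1 hjε
    calc _ ≤ j.factorial / (P * N * u) ^ j * (A * G * (N * u) ^ j) := by gcongr
      _ = J * A * G := by
        rw [mul_assoc P, mul_pow P, hJ]
        field_simp
  have hWn := normW1inf_nonneg f
  have hHn := normH_nonneg ((n : ℝ) / 2) f
  have hmain := abs_linearStatistic_le hP hμ hV hW hH hN hu0 hjn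
  rw [hur] at hmain
  set W := normW1inf f
  set H := normH ((n : ℝ) / 2) f
  calc |linearStatistic P V μ N f|
      ≤ 2 ^ n * (n * W * (2 * Real.pi * regScale n N) * M) + H * (s * r) *
        (1 + j.factorial / (P * N * u) ^ j * (A * G * (N : ℝ) ^ ((n + 2) * P : ℝ))) := hmain
    _ ≤ 2 ^ n * (n * W * (2 * Real.pi * r) * M) + H * (s * r) * (1 + J * A * G) := by gcongr
    _ = r * (a * 1 * W + s * (1 + J * A * G) * H) := by rw [ha]; ring
    _ ≤ r * (a * G * W + s * (G + J * A * G) * H) := by gcongr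
    _ = r * G * (a * W + s * (1 + J * A) * H) := by ring
    _ ≤ r * G * ((a + s * (1 + J * A)) * W + (a + s * (1 + J * A)) * H) := by
      have h1 : 0 ≤ s * (1 + J * A) := by positivity
      gcongr
      · linarith
      · linarith
    _ = Real.exp (-c) * (a + s * (1 + J * A)) * Real.exp (constK P c μ) * r * (W + H) := by
      rw [← hexpK]; ring
    _ = _ := by simp only [hr, div_eq_mul_inv]

end HighTemp

end

theorem theorema (P : ℝ) (hP : 0 < P) (c : ℝ) (ε : ℝ) (hε : 0 < ε) (n : ℕ) (hn : 1 ≤ n) :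
    ∃ C : ℝ, 0 < C ∧
      ∀ (V : ℝ → ℝ) (μ : MeasureTheory.Measure ℝ),
        HighTemp.IsEquilibriumMeasure P V μ → HighTemp.Admissible V μ →
        ∀ f : EuclideanSpace ℝ (Fin n) → ℝ,
          HighTemp.MemW1inf f → HighTemp.MemH ((n : ℝ) / 2) f →
          ∀ N : ℕ, 1 ≤ N →
            |HighTemp.linearStatistic P V μ N f| ≤
              C * Real.exp (HighTemp.constK P c μ) / (N : ℝ) ^ ((n : ℝ) / 2 * (1 - ε)) *
                (HighTemp.normW1inf f + HighTemp.normH ((n : ℝ) / 2) f) :=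
  HighTemp.exists_abs_linearStatistic_le P hP c ε hε n
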